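/- Let $(A(m))_{m\ge 1}$ be real numbers that are the coefficients of an $L$-function in the Selberg class without a pole, that is: $L$ is an entire function of finite order such that, for $\Re(s)>1$, $$L(s)=\sum_{m\ge 1}\frac{A(m)}{m^s}=\prod_p\Big(\sum_{k\ge 0}\frac{A(p^k)}{p^{ks}}\Big)$$ (both absolutely convergent), and there are an integer $d\ge 1$, complex numbers $\mu_1,\dots,\mu_d$, a real number $Q>0$ and $w\in\mathbb{C}$ with $|w|=1$ such that, with $\gamma(s)=\prod_{j=1}^d\Gamma\big(\tfrac{s+\mu_j}{2}\big)$, $$L(s)=w\,Q^{1-2s}\,\frac{\gamma(1-s)}{\gamma(s)}\,L(1-s).$$ Let $\theta\ge 0$ and $\kappa>0$ be such that for every $\eta>0$: * $L(\tfrac12+it)\ll_\eta (1+|t|)^{\theta+\eta}$ for all real $t$; * $\sum_{m\le X}|A(m)|^2\ll_\eta X^{1+\eta}$ for all $X\ge 1$; * $\sum_{X<m\le 2X}|A(m)|\gg_\eta X^{\kappa-\eta}$ for all sufficiently large $X$. The number of sign changes in $(A(m))_{m\le X}$ is the number of $m\le X$ with $A(m)\neq 0$ whose last preceding non-zero term $A(n)$,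 $1\le n<m$, exists and has the opposite sign. Let $\varepsilon>0$ and $\delta=\sqrt{2-2\kappa+\varepsilon}$. Then for all sufficiently large $X$ (in terms of the sequence $A$, $\theta$, $\kappa$ and $\varepsilon$): 1. if $\theta\ge \tfrac12$ and $\kappa\ge 1-\Big(2\big(7\theta+3+\sqrt{(7\theta+3)^2+2}\big)^2\Big)^{-1}$, the number of sign changes in $(A(m))_{m\le X}$ is at least $$X^{\,2\kappa-2+\frac{1}{2\theta}-\delta-\frac{6\delta+2\delta^2}{2\theta}};$$ 2. if $\theta\le \tfrac12$ and $\kappa\ge -\tfrac{17}{2}+3\sqrt{10}$, the number of sign changes in $(A(m))_{m\le X}$ is at least $$X^{\,2\kappa-1-6\delta}.$$ -/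

import Mathlib

/-- The gamma factor `γ(s) = ∏_j Γ((s + μ_j) / 2)`. -/
noncomputable def gammaFactor {d : ℕ} (μ : Fin d → ℂ) (s : ℂ) : ℂ :=
  ∏ j, Complex.Gamma ((s + μ j) / 2)

/-- The local factor `L_p(s) = ∑_{k ≥ 0} A(p^k) p^{-ks}`. -/
noncomputable def localFactor (A : ℕ → ℝ) (p : ℕ) (s : ℂ) : ℂ :=
  ∑' k : ℕ, (A (p ^ k) : ℂ) / (p : ℂ) ^ ((k : ℂ) * s)

/-- `L(1-s)` is tied to `L(s)` by a functional equation of degree `d` with gamma shifts `μ`,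
conductor parameter `Q > 0` and root number `w`. The equation is asserted wherever `γ(1-s)` has
no pole. At a pole of `γ(s)` the quotient by `γ(s)` is `0`, which is the value of the entire
function `1/γ` there. -/
def FunctionalEquation (L : ℂ → ℂ) (d : ℕ) (μ : Fin d → ℂ) (Q : ℝ) (w : ℂ) : Prop :=
  ∀ s : ℂ, (∀ (j : Fin d) (n : ℕ), (1 - s + μ j) / 2 ≠ -(n : ℂ)) →
    L s = w * (Q : ℂ) ^ (1 - 2 * s) * (gammaFactor μ (1 - s) / gammaFactor μ s) * L (1 - s)

/-- `L` is the (analytically continued) `L`-function with real coefficients `A(m)`, `m ≥ 1`,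
in the Selberg class, without a pole. The value `A 0` plays no role. -/
structure IsSelbergLFunction (A : ℕ → ℝ) (L : ℂ → ℂ) : Prop where
  /-- Dirichlet series in `Re s > 1`. -/
  dirichlet_series : ∀ s : ℂ, 1 < s.re → LSeriesHasSum (fun m => (A m : ℂ)) s (L s)
  /-- Euler product in `Re s > 1`. -/
  euler_product : ∀ s : ℂ, 1 < s.re →
    HasProd (fun p : Nat.Primes => localFactor A (p : ℕ) s) (L s)
  /-- `L` is entire. -/
  entire : Differentiable ℂ L
  /-- `L` has finite order. -/
  finite_order : ∃ C ρ : ℝ, ∀ s : ℂ, ‖L s‖ ≤ C * Real.exp ((1 + ‖s‖) ^ ρ)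
  /-- Functional equation. -/
  functional_equation : ∃ (d : ℕ) (μ : Fin d → ℂ) (Q : ℝ) (w : ℂ),
    1 ≤ d ∧ 0 < Q ∧ ‖w‖ = 1 ∧ FunctionalEquation L d μ Q w

/-- `L(1/2 + it) ≪_ε (1 + |t|)^{θ + ε}` for every `ε > 0`. -/
def LindelofExponent (L : ℂ → ℂ) (θ : ℝ) : Prop :=
  ∀ ε : ℝ, 0 < ε → ∃ C : ℝ, ∀ t : ℝ,
    ‖L (1 / 2 + (t : ℂ) * Complex.I)‖ ≤ C * (1 + |t|) ^ (θ + ε)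

/-- `∑_{m ≤ X} |A(m)|² ≪_ε X^{1 + ε}` for every `ε > 0`. -/
def RankinSelbergBound (A : ℕ → ℝ) : Prop :=
  ∀ ε : ℝ, 0 < ε → ∃ C : ℝ, ∀ X : ℝ, 1 ≤ X →
    ∑ m ∈ Finset.Icc 1 ⌊X⌋₊, |A m| ^ 2 ≤ C * X ^ (1 + ε)

/-- `∑_{X < m ≤ 2X} |A(m)| ≫_ε X^{κ - ε}` for every `ε > 0`, as `X → ∞`. -/
def NonvanishingExponent (A : ℕ → ℝ) (κ : ℝ) : Prop :=
  ∀ ε : ℝ, 0 < ε → ∃ c : ℝ, 0 < c ∧ ∃ X₀ : ℝ, ∀ X : ℝ, X₀ ≤ X → 1 ≤ X →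
    c * X ^ (κ - ε) ≤ ∑ m ∈ Finset.Ioc ⌊X⌋₊ ⌊2 * X⌋₊, |A m|

open Classical in
/-- The number of sign changes in `(A(m))_{1 ≤ m ≤ X}`, zero terms being disregarded: the number
of `m ≤ X` such that `A(m)` and the last non-zero term before it have opposite signs. -/
noncomputable def signChanges (A : ℕ → ℝ) (X : ℝ) : ℕ :=
  {m ∈ Finset.Icc 1 ⌊X⌋₊ |
    ∃ n : ℕ, 1 ≤ n ∧ n < m ∧ A n * A m < 0 ∧ ∀ j : ℕ, n < j → j < m → A j = 0}.card

/-!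
Normalise the coefficients to `f(m) = A(m) m^{-σ}` with `σ` slightly larger than `1/2`, and consider
the products `f(n) f(m)` over coprime pairs with `n ≤ X^δ` and `m ≪ X^(1-δ)`, where `n` is free of
small primes and `m` is smoothly truncated. By multiplicativity `f(n) f(m) = f(nm)`, so if `f` had
few sign changes up to `9X`, then on most multiplicatively short windows, of relative length
`X^(-τ)`, the sum of these products would equal the sum of their absolute values up to sign. The two
are compared in mean square.

For absolute values, the hypothesis on `∑ |A(m)|` bounds the total mass from below, and the one on
`∑ |A(m)|²` bounds the second moment from above. For the signed sums, Plancherel turns the mean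
square over windows into that of a Dirichlet polynomial over `|ξ| ≤ X^(τ+η)`. Möbius inversion and
Cauchy–Schwarz bound it by a short factor times a long one. Where the short factor is at most `Λ`,
the mean value theorem for Dirichlet polynomials handles the long factor. The remaining `ξ` are rare
by a `k`-th moment of the short factor, with `kδ ≈ 1`, and there the whole product is bounded
pointwise, since the long sum is an integral of `L` against a Schwartz function. Taking `τ` just
above `(1 - 6δ) / (2θ)` balances the two.

When the claimed exponent is not positive, one sign change suffices, and Landau's theorem on
Dirichlet series with nonnegative coefficients provides it.
-/

open Filter Topology MeasureTheory Asymptotics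
open scoped Real FourierTransform SchwartzMap

/-- Multiplicative functions on `ℕ`, as coefficients of Dirichlet series with an Euler product.
Unlike for `ArithmeticFunction.IsMultiplicative`, the value at `0` is unconstrained. -/
structure IsCoprimeMultiplicative {R : Type*} [MulOneClass R] (a : ℕ → R) : Prop where
  map_one : a 1 = 1
  map_mul_of_coprime : ∀ {m n : ℕ}, m.Coprime n → a (m * n) = a m * a n

section EulerProduct

theorem tendsto_cofinite_one_of_hasProd {ι K : Type*} [Field K] [TopologicalSpace K]
    [ContinuousMul K] [ContinuousInv₀ K] [T1Space K] {f : ι → K} {a : K} (hf : HasProd f a)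
    (ha : a ≠ 0) : Tendsto f cofinite (𝓝 1) := by
  classical
  have hdiv : Tendsto (Prod.fst / Prod.snd) (𝓝 a ×ˢ 𝓝 a) (𝓝 1) := by
    simpa only [div_self ha] using (tendsto_fst (f := 𝓝 a) (g := 𝓝 a)).div tendsto_snd ha
  intro U hU
  obtain ⟨V, hV, hVU⟩ := mem_prod_self_iff.mp (hdiv hU)
  have hprod : Tendsto (fun s : Finset ι => ∏ i ∈ s, f i) atTop (𝓝 a) := by
    simpa only [HasProd, SummationFilter.unconditional_filter] using hf
  obtain ⟨s, hs⟩ := mem_atTop_sets.mp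
    (hprod (inter_mem hV (isOpen_compl_singleton.mem_nhds ha)))
  rw [mem_map]
  filter_upwards [s.finite_toSet.compl_mem_cofinite] with i hi
  obtain ⟨hsV, hs₀⟩ : ∏ j ∈ s, f j ∈ V ∩ {0}ᶜ := hs s le_rfl
  obtain ⟨hisV, -⟩ : ∏ j ∈ insert i s, f j ∈ V ∩ {0}ᶜ := hs _ (Finset.subset_insert i s)
  rw [Finset.prod_insert hi] at hisV
  simpa [mul_div_cancel_right₀ _ hs₀] using hVU (Set.mk_mem_prod hisV hsV)

theorem LSeries_term_prime_pow (a : ℕ → ℂ) (s : ℂ) {p : ℕ} (hp : p.Prime) (k : ℕ) :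
    LSeries.term a s (p ^ k) = a (p ^ k) / (p : ℂ) ^ ((k : ℂ) * s) := by
  rw [LSeries.term_of_ne_zero (pow_ne_zero _ hp.ne_zero), Complex.natCast_cpow_natCast_mul,
    Nat.cast_pow]

theorem localFactor_eq_tsum_term (A : ℕ → ℝ) (s : ℂ) {p : ℕ} (hp : p.Prime) :
    localFactor A p s = ∑' k, LSeries.term (fun m => (A m : ℂ)) s (p ^ k) := by
  simp only [localFactor, LSeries_term_prime_pow _ s hp]

theorem summable_primes_prod_pow_succ {E : Type*} [NormedAddCommGroup E] [CompleteSpace E]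
    {f : ℕ → E} (hf : Summable f) :
    Summable fun x : Nat.Primes × ℕ => f ((x.1 : ℕ) ^ (x.2 + 1)) := by
  refine (hf.comp_injective
    (Subtype.val_injective.comp Nat.Primes.prodNatEquiv.injective)).congr fun x => ?_
  simp [Nat.Primes.prodNatEquiv]

theorem sum_le_tsum_smoothNumbers {f : ℕ → ℝ} (hf₀ : f 0 = 0) (hf : ∀ n, 0 ≤ f n) (u : Finset ℕ)
    (hu : Summable fun m : (u.sup id + 1).smoothNumbers => f m) :
    ∑ n ∈ u, f n ≤ ∑' m : (u.sup id + 1).smoothNumbers, f m := by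
  classical
  have hsmooth : ∀ n ∈ u, f n ≠ 0 → n ∈ (u.sup id + 1).smoothNumbers := fun n hn hfn =>
    Nat.mem_smoothNumbers_of_lt (Nat.pos_of_ne_zero fun h => hfn (h ▸ hf₀))
      (Nat.lt_succ_of_le (Finset.le_sup (f := id) hn))
  rw [← Finset.sum_filter_of_ne hsmooth, ← Finset.sum_subtype_eq_sum_filter]
  exact hu.sum_le_tsum _ fun m _ => hf m

theorem summable_of_summable_prime_pow {f : ℕ → ℝ} (hmul : IsCoprimeMultiplicative f)
    (hf₀ : f 0 = 0) (hf : ∀ n, 0 ≤ f n)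
    (hsum : Summable fun x : Nat.Primes × ℕ => f ((x.1 : ℕ) ^ (x.2 + 1))) : Summable f := by
  have hpow {p : ℕ} (hp : p.Prime) : Summable fun k => f (p ^ k) :=
    (summable_nat_add_iff 1).mp
      (hsum.comp_injective (Prod.mk_right_injective (⟨p, hp⟩ : Nat.Primes)) :)
  set x : Nat.Primes → ℝ := fun p => ∑' k, f ((p : ℕ) ^ (k + 1))
  have hxsum : Summable x := hsum.prod
  have hx : ∀ p, 0 ≤ x p := fun p => tsum_nonneg fun _ => hf _
  have hfactor (p : Nat.Primes) : ∑' k, f ((p : ℕ) ^ k) = 1 + x p := by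
    rw [(hpow p.2).tsum_eq_zero_add, pow_zero, hmul.map_one]
  refine summable_of_sum_le (c := Real.exp (∑' p, x p)) hf fun u => ?_
  obtain ⟨-, hprod⟩ :=
    EulerProduct.summable_and_hasSum_smoothNumbers_prod_primesBelow_tsum hmul.map_one
      hmul.map_mul_of_coprime (fun {p} hp => (hpow hp).norm) (u.sup id + 1)
  let P : Finset Nat.Primes := (u.sup id + 1).primesBelow.subtype Nat.Prime
  calc ∑ n ∈ u, f n
      ≤ ∑' m : (u.sup id + 1).smoothNumbers, f m :=
        sum_le_tsum_smoothNumbers hf₀ hf u hprod.summable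
    _ = ∏ p ∈ (u.sup id + 1).primesBelow, ∑' k, f (p ^ k) := hprod.tsum_eq
    _ = ∏ p ∈ P, (1 + x p) := by
        rw [← Finset.prod_subtype_of_mem (fun p => ∑' k, f (p ^ k))
          fun p hp => Nat.prime_of_mem_primesBelow hp]
        exact Finset.prod_congr rfl fun p _ => hfactor p
    _ ≤ Real.exp (∑ p ∈ P, x p) :=
        Real.prod_one_add_le_exp_sum _ fun p => hx p
    _ ≤ Real.exp (∑' p, x p) :=
        Real.exp_le_exp.mpr (hxsum.sum_le_tsum _ fun p _ => hx p)

/-- The multiplicative function with the same values as `a` at prime powers. -/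
noncomputable def primePowerExtension {R : Type*} [CommMonoid R] (a : ℕ → R) (n : ℕ) : R :=
  n.factorization.prod fun p k => a (p ^ k)

theorem isCoprimeMultiplicative_primePowerExtension {R : Type*} [CommMonoid R] (a : ℕ → R) :
    IsCoprimeMultiplicative (primePowerExtension a) where
  map_one := by simp [primePowerExtension]
  map_mul_of_coprime h := by
    simp only [primePowerExtension]
    rw [Nat.factorization_mul_of_coprime h]
    exact Finsupp.prod_add_index_of_disjoint (by simpa using h.disjoint_primeFactors) _

theorem primePowerExtension_prime_pow {R : Type*} [CommMonoid R] {a : ℕ → R} (ha : a 1 = 1)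
    {p : ℕ} (hp : p.Prime) (k : ℕ) : primePowerExtension a (p ^ k) = a (p ^ k) := by
  rw [primePowerExtension, hp.factorization_pow, Finsupp.prod_single_index (by simpa using ha)]

theorem IsCoprimeMultiplicative.LSeries_term {a : ℕ → ℂ} (ha : IsCoprimeMultiplicative a) (s : ℂ) :
    IsCoprimeMultiplicative (LSeries.term a s) where
  map_one := by simp [LSeries.term_of_ne_zero, ha.map_one]
  map_mul_of_coprime {m n} h := by
    rcases eq_or_ne m 0 with rfl | hm
    · simp
    rcases eq_or_ne n 0 with rfl | hn
    · simp
    rw [LSeries.term_of_ne_zero hm, LSeries.term_of_ne_zero hn,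
      LSeries.term_of_ne_zero (mul_ne_zero hm hn), ha.map_mul_of_coprime h, Nat.cast_mul,
      Complex.natCast_mul_natCast_cpow, mul_div_mul_comm]

theorem LSeriesHasSum_primePowerExtension {a : ℕ → ℂ} (ha : a 1 = 1) {s z : ℂ}
    (hs : LSeriesSummable a s)
    (hz : HasProd (fun p : Nat.Primes => ∑' k, LSeries.term a s ((p : ℕ) ^ k)) z) :
    LSeriesHasSum (primePowerExtension a) s z := by
  have hmul := (isCoprimeMultiplicative_primePowerExtension a).LSeries_term s
  have hterm {p : ℕ} (hp : p.Prime) (k : ℕ) :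
      LSeries.term (primePowerExtension a) s (p ^ k) = LSeries.term a s (p ^ k) := by
    rw [LSeries_term_prime_pow _ s hp, LSeries_term_prime_pow _ s hp,
      primePowerExtension_prime_pow ha hp]
  have hnorm : Summable fun n => ‖LSeries.term (primePowerExtension a) s n‖ := by
    refine summable_of_summable_prime_pow
      ⟨by rw [hmul.map_one, norm_one], fun h => by rw [hmul.map_mul_of_coprime h, norm_mul]⟩
      (by simp) (fun _ => norm_nonneg _) ?_
    refine (summable_primes_prod_pow_succ hs.norm).congr fun x => ?_
    rw [hterm x.1.2]
  have hprod := EulerProduct.eulerProduct_hasProd hmul.map_one hmul.map_mul_of_coprime hnorm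
    (by simp)
  have hfactor (p : Nat.Primes) : ∑' k, LSeries.term (primePowerExtension a) s ((p : ℕ) ^ k) =
      ∑' k, LSeries.term a s ((p : ℕ) ^ k) := tsum_congr (hterm p.2)
  simp only [hfactor] at hprod
  exact hprod.unique hz ▸ hnorm.of_norm.hasSum

end EulerProduct

/-- `L` is an entire function of finite order given by the Dirichlet series `∑ a(m) m⁻ˢ` in
`Re s > 1`: the part of the Selberg class axioms that controls smooth sums of coefficients. -/
structure IsEntireDirichletSeries (a : ℕ → ℂ) (L : ℂ → ℂ) : Prop where
  dirichlet_series : ∀ s : ℂ, 1 < s.re → LSeriesHasSum a s (L s)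
  entire : Differentiable ℂ L
  finite_order : ∃ C ρ : ℝ, ∀ s : ℂ, ‖L s‖ ≤ C * Real.exp ((1 + ‖s‖) ^ ρ)

section DirichletSeries

variable {a b : ℕ → ℂ} {L : ℂ → ℂ}

theorem abscissaOfAbsConv_lt_top_of_hasSum (ha : ∀ s : ℂ, 1 < s.re → LSeriesHasSum a s (L s)) :
    LSeries.abscissaOfAbsConv a < ⊤ :=
  (ha 2 (by simp)).LSeriesSummable.abscissaOfAbsConv_le.trans_lt (by simp)

theorem eq_of_LSeriesHasSum (ha : ∀ s : ℂ, 1 < s.re → LSeriesHasSum a s (L s))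
    (hb : ∀ s : ℂ, 1 < s.re → LSeriesHasSum b s (L s)) {n : ℕ} (hn : n ≠ 0) : a n = b n := by
  refine LSeries.eq_of_LSeries_eventually_eq (abscissaOfAbsConv_lt_top_of_hasSum ha)
    (abscissaOfAbsConv_lt_top_of_hasSum hb) ?_ hn
  filter_upwards [eventually_gt_atTop (1 : ℝ)] with x hx
  rw [(ha x (by simpa using hx)).LSeries_eq, (hb x (by simpa using hx)).LSeries_eq]

theorem exists_ne_zero_of_LSeriesHasSum (ha : ∀ s : ℂ, 1 < s.re → LSeriesHasSum a s (L s))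
    (hne : ∃ m ≠ 0, a m ≠ 0) : ∃ s : ℂ, 1 < s.re ∧ L s ≠ 0 := by
  by_contra! hL
  obtain ⟨m, hm, ham⟩ := hne
  refine ham (eq_of_LSeriesHasSum (b := 0) ha (fun s hs => ?_) hm)
  simpa only [hL s hs, LSeries_zero, Pi.zero_apply] using
    (LSeriesSummable_zero (s := s)).LSeriesHasSum

/- The Euler factors of a convergent product tend to `1`, and they tend to `a 1` since the sum of
all the terms at prime powers converges. -/
theorem map_one_of_hasProd {s z : ℂ} (hs : LSeriesSummable a s) (hz₀ : z ≠ 0)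
    (hz : HasProd (fun p : Nat.Primes => ∑' k, LSeries.term a s ((p : ℕ) ^ k)) z) : a 1 = 1 := by
  have htail : Tendsto (fun p : Nat.Primes => ∑' k, LSeries.term a s ((p : ℕ) ^ (k + 1)))
      cofinite (𝓝 0) :=
    (summable_primes_prod_pow_succ hs).prod.tendsto_cofinite_zero
  have hfactor (p : Nat.Primes) : ∑' k, LSeries.term a s ((p : ℕ) ^ k) =
      a 1 + ∑' k, LSeries.term a s ((p : ℕ) ^ (k + 1)) := by
    have hpow : Summable fun k => LSeries.term a s ((p : ℕ) ^ k) :=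
      hs.comp_injective (Nat.pow_right_injective p.2.two_le)
    rw [hpow.tsum_eq_zero_add]
    simp [LSeries_term_prime_pow a s p.2]
  refine tendsto_nhds_unique ?_ (tendsto_cofinite_one_of_hasProd hz hz₀)
  simpa [hfactor] using htail.const_add (a 1)

namespace IsSelbergLFunction

variable {A : ℕ → ℝ}

theorem isEntireDirichletSeries (hL : IsSelbergLFunction A L) :
    IsEntireDirichletSeries (fun m => (A m : ℂ)) L :=
  ⟨hL.dirichlet_series, hL.entire, hL.finite_order⟩

theorem hasProd_tsum_term (hL : IsSelbergLFunction A L) {s : ℂ} (hs : 1 < s.re) :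
    HasProd (fun p : Nat.Primes =>
      ∑' k, LSeries.term (fun m => (A m : ℂ)) s ((p : ℕ) ^ k)) (L s) := by
  simpa only [fun p : Nat.Primes => localFactor_eq_tsum_term A s p.2] using hL.euler_product s hs

theorem isCoprimeMultiplicative (hL : IsSelbergLFunction A L) (hA : ∃ m ≠ 0, A m ≠ 0) :
    IsCoprimeMultiplicative A := by
  obtain ⟨s, hs, hLs⟩ := exists_ne_zero_of_LSeriesHasSum hL.dirichlet_series (by simpa using hA)
  have hone : (A 1 : ℂ) = 1 := map_one_of_hasProd (a := fun m => (A m : ℂ))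
    (hL.dirichlet_series s hs).LSeriesSummable hLs (hL.hasProd_tsum_term hs)
  have hext {n : ℕ} (hn : n ≠ 0) : (A n : ℂ) = primePowerExtension (fun m => (A m : ℂ)) n :=
    eq_of_LSeriesHasSum hL.dirichlet_series (fun s hs => LSeriesHasSum_primePowerExtension hone
      (hL.dirichlet_series s hs).LSeriesSummable (hL.hasProd_tsum_term hs)) hn
  have hone' : A 1 = 1 := by exact_mod_cast hone
  refine ⟨hone', fun {m n} h => ?_⟩
  rcases eq_or_ne m 0 with rfl | hm
  · simp [(Nat.coprime_zero_left n).mp h, hone']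
  rcases eq_or_ne n 0 with rfl | hn
  · simp [(Nat.coprime_zero_right m).mp h, hone']
  have hmul := (isCoprimeMultiplicative_primePowerExtension
    (fun m => (A m : ℂ))).map_mul_of_coprime h
  rw [← hext hm, ← hext hn, ← hext (mul_ne_zero hm hn)] at hmul
  exact_mod_cast hmul

end IsSelbergLFunction

end DirichletSeries

section GrowthInHalfPlane

theorem isBigO_strip_of_finite_order {f : ℂ → ℂ} {C ρ : ℝ}
    (hf : ∀ s : ℂ, ‖f s‖ ≤ C * Real.exp ((1 + ‖s‖) ^ ρ)) (σ₁ σ₂ : ℝ) :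
    f =O[comap (abs ∘ Complex.im) atTop ⊓ 𝓟 (Complex.re ⁻¹' Set.Ioo σ₁ σ₂)]
      fun z => Real.exp (1 * Real.exp (1 * |z.im|)) := by
  set B := 1 + max |σ₁| |σ₂|
  have hpow : ∀ᶠ y : ℝ in atTop, (B + y) ^ |ρ| ≤ Real.exp y := by
    have hshift : Tendsto (fun y : ℝ => B + y) atTop atTop :=
      tendsto_atTop_add_const_left _ _ tendsto_id
    filter_upwards [((isLittleO_rpow_exp_atTop |ρ|).comp_tendsto hshift).def (Real.exp_pos (-B)),
      eventually_ge_atTop 0] with y hy hy₀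
    rw [Function.comp_apply, Function.comp_apply, Real.norm_of_nonneg (by positivity),
      Real.norm_of_nonneg (by positivity), ← Real.exp_add] at hy
    simpa using hy
  refine IsBigO.of_bound |C| (eventually_inf_principal.mpr ?_)
  filter_upwards [tendsto_comap.eventually hpow] with z hz hzσ
  have hnorm : 1 + ‖z‖ ≤ B + |z.im| := by
    have hre : |z.re| ≤ max |σ₁| |σ₂| := abs_le_max_abs_abs hzσ.1.le hzσ.2.le
    linarith [Complex.norm_le_abs_re_add_abs_im z]
  calc ‖f z‖ ≤ C * Real.exp ((1 + ‖z‖) ^ ρ) := hf z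
    _ ≤ |C| * Real.exp ((1 + ‖z‖) ^ |ρ|) := by
        gcongr
        · exact le_abs_self C
        · linarith [norm_nonneg z]
        · exact le_abs_self ρ
    _ ≤ |C| * Real.exp ((B + |z.im|) ^ |ρ|) := by gcongr
    _ ≤ |C| * ‖Real.exp (1 * Real.exp (1 * |z.im|))‖ := by
        rw [Real.norm_of_nonneg (by positivity), one_mul, one_mul]
        gcongr
        exact hz

theorem one_le_norm_add_one {s : ℂ} (hs : 0 ≤ s.re) : 1 ≤ ‖s + 1‖ :=
  le_trans (by simpa using hs) (Complex.re_le_norm (s + 1))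

theorem norm_le_norm_add_one {s : ℂ} (hs : 0 ≤ s.re) : ‖s‖ ≤ ‖s + 1‖ := by
  rw [← sq_le_sq₀ (norm_nonneg _) (norm_nonneg _), Complex.sq_norm, Complex.sq_norm,
    Complex.normSq_add]
  simp only [map_one, mul_one]
  linarith

/- Phragmén–Lindelöf for `f(s) (s + 1)^{-α}`. -/
theorem norm_le_rpow_of_vertical_strip {f : ℂ → ℂ} (hf : Differentiable ℂ f) {C₀ ρ : ℝ}
    (hfin : ∀ s : ℂ, ‖f s‖ ≤ C₀ * Real.exp ((1 + ‖s‖) ^ ρ)) {σ₁ σ₂ C α : ℝ} (hσ₁ : 0 ≤ σ₁)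
    (hσ : σ₁ < σ₂) (hσπ : σ₂ - σ₁ < π) (hα : 0 ≤ α)
    (hbd : ∀ s : ℂ, s.re = σ₁ ∨ s.re = σ₂ → ‖f s‖ ≤ C * (1 + ‖s‖) ^ α) {s : ℂ}
    (hs₁ : σ₁ ≤ s.re) (hs₂ : s.re ≤ σ₂) : ‖f s‖ ≤ C * 2 ^ α * (1 + ‖s‖) ^ α := by
  set g : ℂ → ℂ := fun z => f z * (z + 1) ^ ((-α : ℝ) : ℂ)
  have hg (z : ℂ) : ‖g z‖ = ‖f z‖ * ‖z + 1‖ ^ (-α) := by rw [norm_mul, Complex.norm_cpow_real]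
  have hgf {z : ℂ} (hz : σ₁ ≤ z.re) : ‖g z‖ ≤ ‖f z‖ := by
    rw [hg]
    exact mul_le_of_le_one_right (norm_nonneg _) (Real.rpow_le_one_of_one_le_of_nonpos
      (one_le_norm_add_one (hσ₁.trans hz)) (neg_nonpos.mpr hα))
  have hg_bd (z : ℂ) (hz : z.re = σ₁ ∨ z.re = σ₂) : ‖g z‖ ≤ C * 2 ^ α := by
    have hre : 0 ≤ z.re := by rcases hz with h | h <;> linarith
    have hpos : 0 < ‖z + 1‖ := one_pos.trans_le (one_le_norm_add_one hre)
    have hC : 0 ≤ C * (1 + ‖z‖) ^ α := (norm_nonneg _).trans (hbd z hz)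
    rw [hg, Real.rpow_neg hpos.le, ← div_eq_mul_inv, div_le_iff₀ (by positivity), mul_assoc,
      ← Real.mul_rpow zero_le_two hpos.le]
    refine (hbd z hz).trans ?_
    have : 0 ≤ C := nonneg_of_mul_nonneg_left hC (by positivity)
    gcongr
    linarith [one_le_norm_add_one hre, norm_le_norm_add_one hre]
  have hg_diff : DiffContOnCl ℂ g (Complex.re ⁻¹' Set.Ioo σ₁ σ₂) := by
    refine DifferentiableOn.diffContOnCl fun z hz => ?_
    rw [Complex.closure_preimage_re, closure_Ioo hσ.ne] at hz
    have hslit : z + 1 ∈ Complex.slitPlane := by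
      refine .inl ?_
      rw [Complex.add_re, Complex.one_re]
      linarith [hz.1]
    exact ((hf z).mul
      ((differentiableAt_id.add_const 1).cpow_const hslit)).differentiableWithinAt
  have hg_strip : ‖g s‖ ≤ C * 2 ^ α := by
    refine PhragmenLindelof.vertical_strip hg_diff ⟨1, ?_, 1, ?_⟩ (fun z hz => hg_bd z (.inl hz))
      (fun z hz => hg_bd z (.inr hz)) hs₁ hs₂
    · rwa [lt_div_iff₀ (sub_pos.mpr hσ), one_mul]
    · refine IsBigO.trans (IsBigO.of_bound 1 (eventually_inf_principal.mpr (.of_forall ?_)))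
        (isBigO_strip_of_finite_order hfin σ₁ σ₂)
      intro z hz
      rw [one_mul]
      exact hgf hz.1.le
  have hpos : 0 < ‖s + 1‖ := one_pos.trans_le (one_le_norm_add_one (hσ₁.trans hs₁))
  rw [hg, Real.rpow_neg hpos.le, ← div_eq_mul_inv, div_le_iff₀ (by positivity)] at hg_strip
  have hC : 0 ≤ C * 2 ^ α := (norm_nonneg _).trans (hg_bd σ₁ (by simp))
  refine hg_strip.trans ?_
  gcongr
  simpa [add_comm] using norm_add_le s 1

theorem norm_le_tsum_norm_term {a : ℕ → ℂ} {s z : ℂ} {x : ℝ} (hx : LSeriesSummable a x)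
    (hs : x ≤ s.re) (hz : LSeriesHasSum a s z) :
    ‖z‖ ≤ ∑' n, ‖LSeries.term a x n‖ := by
  rw [← hz.LSeries_eq, LSeries]
  exact tsum_of_norm_bounded hx.norm.hasSum fun n =>
    LSeries.norm_term_le_of_re_le_re a (by simpa using hs) n

theorem IsEntireDirichletSeries.exists_norm_le_rpow {a : ℕ → ℂ} {L : ℂ → ℂ}
    (hL : IsEntireDirichletSeries a L) {θ η : ℝ} (hθ : 0 ≤ θ) (hLθ : LindelofExponent L θ)
    (hη : 0 < η) :
    ∃ C : ℝ, 0 < C ∧ ∀ s : ℂ, 1 / 2 ≤ s.re → ‖L s‖ ≤ C * (1 + ‖s‖) ^ (θ + η) := by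
  obtain ⟨C₁, hC₁⟩ := hLθ η hη
  obtain ⟨C₀, ρ, hfin⟩ := hL.finite_order
  have hC₁₀ : 0 ≤ C₁ := by simpa using (norm_nonneg _).trans (hC₁ 0)
  have hα : 0 ≤ θ + η := by positivity
  have hone (s : ℂ) : 1 ≤ (1 + ‖s‖) ^ (θ + η) :=
    Real.one_le_rpow (le_add_of_nonneg_right (norm_nonneg s)) hα
  obtain ⟨M, hM₀, hM⟩ : ∃ M : ℝ, 0 ≤ M ∧ ∀ s : ℂ, 2 ≤ s.re → ‖L s‖ ≤ M :=
    ⟨_, tsum_nonneg fun _ => norm_nonneg _, fun s hs => norm_le_tsum_norm_term (x := 2)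
      (hL.dirichlet_series _ (by simp)).LSeriesSummable hs
      (hL.dirichlet_series s (by linarith))⟩
  have hbd (s : ℂ) (hs : s.re = 1 / 2 ∨ s.re = 2) :
      ‖L s‖ ≤ (C₁ + M) * (1 + ‖s‖) ^ (θ + η) := by
    rcases hs with hs | hs
    · have hs' : s = 1 / 2 + (s.im : ℂ) * Complex.I := by apply Complex.ext <;> simp [hs]
      calc ‖L s‖ ≤ C₁ * (1 + |s.im|) ^ (θ + η) := by
            conv_lhs => rw [hs']
            exact hC₁ s.im
        _ ≤ (C₁ + M) * (1 + ‖s‖) ^ (θ + η) := by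
            gcongr
            · exact le_add_of_nonneg_right hM₀
            · exact Complex.abs_im_le_norm s
    · exact (hM s hs.ge).trans ((le_add_of_nonneg_left hC₁₀).trans
        (le_mul_of_one_le_right (by positivity) (hone s)))
  refine ⟨(C₁ + M) * 2 ^ (θ + η) + M + 1, by positivity, fun s hs => ?_⟩
  rcases le_total s.re 2 with hs₂ | hs₂
  · refine (norm_le_rpow_of_vertical_strip hL.entire hfin (by norm_num) (by norm_num)
      (by linarith [Real.pi_gt_three]) hα hbd hs hs₂).trans ?_
    gcongr
    linarith
  · refine (hM s hs₂).trans (le_trans ?_ (le_mul_of_one_le_right (by positivity) (hone s)))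
    linarith [show 0 ≤ (C₁ + M) * 2 ^ (θ + η) by positivity]

end GrowthInHalfPlane

theorem differentiableOn_integral_of_locally_dominated {α E : Type*} [MeasurableSpace α]
    {μ : Measure α} [NormedAddCommGroup E] [NormedSpace ℂ E] [CompleteSpace E] {F : ℂ → α → E}
    {U : Set ℂ} (hU : IsOpen U) (hmeas : ∀ s, AEStronglyMeasurable (F s) μ)
    (hdiff : ∀ ξ, DifferentiableOn ℂ (F · ξ) U)
    (hbound : ∀ s₀ ∈ U, ∃ bound : α → ℝ, Integrable bound μ ∧
      ∀ᶠ s in 𝓝 s₀, ∀ ξ, ‖F s ξ‖ ≤ bound ξ) :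
    DifferentiableOn ℂ (fun s => ∫ ξ, F s ξ ∂μ) U := by
  intro s₀ hs₀
  obtain ⟨bound, hInt, hle⟩ := hbound s₀ hs₀
  obtain ⟨R, hR, hball⟩ := Metric.mem_nhds_iff.mp (inter_mem (hU.mem_nhds hs₀) hle)
  have hsub {s : ℂ} (hs : s ∈ Metric.ball s₀ (R / 2)) :
      Metric.closedBall s (R / 3) ⊆ Metric.ball s₀ R :=
    Metric.closedBall_subset_ball' (by linarith [Metric.mem_ball.mp hs])
  have hderiv {s : ℂ} (hs : s ∈ Metric.ball s₀ (R / 2)) (ξ : α) :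
      HasDerivAt (F · ξ) (deriv (F · ξ) s) s :=
    ((hdiff ξ).differentiableAt
      (hU.mem_nhds (hball (hsub hs (Metric.mem_closedBall_self (by positivity)))).1)).hasDerivAt
  have hmeas' : AEStronglyMeasurable (fun ξ => deriv (F · ξ) s₀) μ :=
    aestronglyMeasurable_of_tendsto_ae (𝓝[≠] s₀) (f := fun s ξ => slope (F · ξ) s₀ s)
      (fun s => ((hmeas s).sub (hmeas s₀)).const_smul (s - s₀)⁻¹)
      (.of_forall fun ξ => (hderiv (Metric.mem_ball_self (by positivity)) ξ).tendsto_slope)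
  refine (hasDerivAt_integral_of_dominated_loc_of_deriv_le
    (bound := fun ξ => bound ξ / (R / 3)) (Metric.ball_mem_nhds s₀ (half_pos hR))
    (.of_forall hmeas) (hInt.mono' (hmeas s₀) (.of_forall hle.self_of_nhds)) hmeas'
    (.of_forall fun ξ s hs => ?_) (hInt.div_const _)
    (.of_forall fun ξ s hs => hderiv hs ξ)).2.differentiableAt.differentiableWithinAt
  refine Complex.norm_deriv_le_of_forall_mem_sphere_norm_le (by positivity)
    (DifferentiableOn.diffContOnCl_ball ((hdiff ξ).mono ?_) le_rfl) fun w hw =>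
      (hball (hsub hs (Metric.sphere_subset_closedBall hw))).2 ξ
  exact fun w hw => (hball (hsub hs hw)).1

section Bump

/-- A smooth bump function, equal to `1` on `[-1, 1]` and supported in `[-2, 2]`. -/
noncomputable def bump : ContDiffBump (0 : ℝ) := ⟨1, 2, one_pos, one_lt_two⟩

theorem bump_eq_one {u : ℝ} (hu : |u| ≤ 1) : bump u = 1 :=
  bump.one_of_mem_closedBall (by simpa [bump] using hu)

theorem bump_eq_zero {u : ℝ} (hu : 2 ≤ |u|) : bump u = 0 :=
  bump.zero_of_le_dist (by simpa [bump] using hu)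

theorem abs_lt_two_of_bump_ne_zero {u : ℝ} (hu : bump u ≠ 0) : |u| < 2 := by
  by_contra! h
  exact hu (bump_eq_zero h)

/-- The bump function as a complex-valued Schwartz function, for use with the Fourier transform. -/
noncomputable def schwartzBump : 𝓢(ℝ, ℂ) :=
  HasCompactSupport.toSchwartzMap (f := fun u => ((bump u : ℝ) : ℂ))
    (bump.hasCompactSupport.comp_left (g := fun x : ℝ => (x : ℂ)) Complex.ofReal_zero)
    (Complex.ofRealCLM.contDiff.comp bump.contDiff)

theorem schwartzBump_apply (u : ℝ) : schwartzBump u = bump u := rfl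

/-- The Fourier transform `ξ ↦ e^{-2πixξ} φ̂(ξ)` of the translate `u ↦ φ(u - x)` of the bump
function `φ`. -/
noncomputable def bumpHat (x ξ : ℝ) : ℂ :=
  Complex.exp ((-(2 * π * ξ * x) : ℝ) * Complex.I) * 𝓕 schwartzBump ξ

theorem norm_bumpHat (x ξ : ℝ) : ‖bumpHat x ξ‖ = ‖𝓕 schwartzBump ξ‖ := by
  rw [bumpHat, norm_mul, Complex.norm_exp_ofReal_mul_I, one_mul]

theorem continuous_bumpHat (x : ℝ) : Continuous (bumpHat x) := by
  have h := (𝓕 schwartzBump).continuous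
  unfold bumpHat
  fun_prop

theorem integral_exp_mul_bumpHat (x u : ℝ) :
    ∫ ξ : ℝ, Complex.exp ((2 * π * ξ * u : ℝ) * Complex.I) * bumpHat x ξ = bump (u - x) := by
  have hinv : 𝓕⁻ (𝓕 schwartzBump) (u - x) = bump (u - x) :=
    congr_fun (congr_arg _ (FourierTransform.fourierInv_fourier_eq schwartzBump)) (u - x)
  rw [← hinv, SchwartzMap.fourierInv_coe, Real.fourierInv_eq']
  refine integral_congr_ae (.of_forall fun ξ => ?_)
  dsimp only
  rw [bumpHat, ← mul_assoc, ← Complex.exp_add, smul_eq_mul]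
  congr 2
  simp
  ring

theorem integrable_norm_mul_one_add_rpow {F : Type*} [NormedAddCommGroup F] [NormedSpace ℝ F]
    (f : 𝓢(ℝ, F)) {c α : ℝ} (hc : 0 ≤ c) (hα : 0 ≤ α) :
    Integrable fun ξ : ℝ => ‖f ξ‖ * (1 + c * |ξ|) ^ α := by
  obtain ⟨k, hk⟩ := exists_nat_ge α
  have hdom : Integrable fun ξ : ℝ =>
      2 ^ (k - 1) * (‖f ξ‖ + c ^ k * (‖ξ‖ ^ k * ‖f ξ‖)) :=
    (f.integrable.norm.add ((f.integrable_pow_mul volume k).const_mul _)).const_mul _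
  refine hdom.mono' (Continuous.aestronglyMeasurable (f.continuous.norm.mul
    (Continuous.rpow_const (by fun_prop) fun ξ => .inr hα))) (.of_forall fun ξ => ?_)
  rw [Real.norm_of_nonneg (by positivity)]
  calc ‖f ξ‖ * (1 + c * |ξ|) ^ α ≤ ‖f ξ‖ * (1 + c * |ξ|) ^ k := by
        rw [← Real.rpow_natCast _ k]
        gcongr
        exact le_add_of_nonneg_right (by positivity)
    _ ≤ ‖f ξ‖ * (2 ^ (k - 1) * (1 ^ k + (c * |ξ|) ^ k)) := by
        gcongr
        exact add_pow_le zero_le_one (by positivity) k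
    _ = _ := by rw [one_pow, mul_pow, Real.norm_eq_abs]; ring

end Bump

section SmoothSums

variable {a : ℕ → ℂ} {L : ℂ → ℂ}

theorem norm_LSeries_term_sub_mul_I (a : ℕ → ℂ) (s : ℂ) (y : ℝ) (m : ℕ) :
    ‖LSeries.term a (s - y * Complex.I) m‖ = ‖LSeries.term a s m‖ := by
  simp [LSeries.norm_term_eq]

theorem bumpHat_mul_LSeries_term (a : ℕ → ℂ) (s : ℂ) (x : ℝ) {m : ℕ} (hm : m ≠ 0) (ξ : ℝ) :
    bumpHat x ξ * LSeries.term a (s - (2 * π * ξ : ℝ) * Complex.I) m =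
      LSeries.term a s m *
        (Complex.exp ((2 * π * ξ * Real.log m : ℝ) * Complex.I) * bumpHat x ξ) := by
  have hm' : (m : ℂ) ≠ 0 := Nat.cast_ne_zero.mpr hm
  have hexp : (m : ℂ) ^ (((2 * π * ξ : ℝ) : ℂ) * Complex.I) =
      Complex.exp ((2 * π * ξ * Real.log m : ℝ) * Complex.I) := by
    rw [Complex.cpow_def_of_ne_zero hm', ← Complex.natCast_log]
    push_cast
    ring_nf
  rw [LSeries.term_of_ne_zero hm, LSeries.term_of_ne_zero hm, Complex.cpow_sub _ _ hm', hexp]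
  field_simp

theorem integral_bumpHat_mul_LSeries_term (a : ℕ → ℂ) (s : ℂ) (x : ℝ) (m : ℕ) :
    ∫ ξ : ℝ, bumpHat x ξ * LSeries.term a (s - (2 * π * ξ : ℝ) * Complex.I) m =
      LSeries.term a s m * bump (Real.log m - x) := by
  rcases eq_or_ne m 0 with rfl | hm
  · simp
  simp_rw [bumpHat_mul_LSeries_term a s x hm]
  rw [integral_const_mul, integral_exp_mul_bumpHat]

theorem integrable_bumpHat_mul_LSeries_term (a : ℕ → ℂ) (s : ℂ) (x : ℝ) (m : ℕ) :
    Integrable fun ξ : ℝ =>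
      bumpHat x ξ * LSeries.term a (s - (2 * π * ξ : ℝ) * Complex.I) m := by
  rcases eq_or_ne m 0 with rfl | hm
  · simp
  refine ((𝓕 schwartzBump).integrable.norm.mul_const ‖LSeries.term a s m‖).mono' ?_
    (.of_forall fun ξ => ?_)
  · simp_rw [bumpHat_mul_LSeries_term a s x hm]
    have := continuous_bumpHat x
    exact Continuous.aestronglyMeasurable (by fun_prop)
  · rw [norm_mul, norm_bumpHat, norm_LSeries_term_sub_mul_I]

theorem hasSum_LSeries_term_mul_bump {s : ℂ} (hs : LSeriesSummable a s) (x : ℝ) :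
    HasSum (fun m => LSeries.term a s m * bump (Real.log m - x))
      (∫ ξ : ℝ, bumpHat x ξ * LSeries a (s - (2 * π * ξ : ℝ) * Complex.I)) := by
  have h := hasSum_integral_of_summable_integral_norm
    (integrable_bumpHat_mul_LSeries_term a s x) (by
      simp_rw [norm_mul, norm_bumpHat, norm_LSeries_term_sub_mul_I, integral_mul_const]
      exact hs.norm.mul_left _)
  simpa only [integral_bumpHat_mul_LSeries_term, tsum_mul_left, LSeries] using h

theorem sum_LSeries_term_mul_bump_eq_integral {s : ℂ} (hs : LSeriesSummable a s) {x : ℝ} {M : ℕ}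
    (hM : Real.exp (x + 2) ≤ M) :
    ∑ m ∈ Finset.Icc 1 M, LSeries.term a s m * bump (Real.log m - x) =
      ∫ ξ : ℝ, bumpHat x ξ * LSeries a (s - (2 * π * ξ : ℝ) * Complex.I) := by
  refine HasSum.unique (hasSum_sum_of_ne_finset_zero fun m hm => ?_)
    (hasSum_LSeries_term_mul_bump hs x)
  rcases eq_or_ne m 0 with rfl | hm₀
  · simp
  have hMm : M < m := by
    rw [Finset.mem_Icc] at hm
    omega
  have hlog : x + 2 ≤ Real.log m := by
    rw [Real.le_log_iff_exp_le (by positivity)]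
    exact hM.trans (by exact_mod_cast hMm.le)
  rw [bump_eq_zero (by rw [abs_of_nonneg] <;> linarith), Complex.ofReal_zero, mul_zero]

theorem norm_bumpHat_mul_shift_le {C α : ℝ} (hα : 0 ≤ α)
    (hbd : ∀ s : ℂ, 1 / 2 ≤ s.re → ‖L s‖ ≤ C * (1 + ‖s‖) ^ α) {s : ℂ} (hs : 1 / 2 ≤ s.re)
    (x ξ : ℝ) :
    ‖bumpHat x ξ * L (s - (2 * π * ξ : ℝ) * Complex.I)‖ ≤
      C * (1 + ‖s‖) ^ α * (‖𝓕 schwartzBump ξ‖ * (1 + 2 * π * |ξ|) ^ α) := by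
  have hC : 0 ≤ C := nonneg_of_mul_nonneg_left ((norm_nonneg _).trans (hbd s hs)) (by positivity)
  have hnorm : 1 + ‖s - (2 * π * ξ : ℝ) * Complex.I‖ ≤ (1 + ‖s‖) * (1 + 2 * π * |ξ|) := by
    have h : ‖s - (2 * π * ξ : ℝ) * Complex.I‖ ≤ ‖s‖ + 2 * π * |ξ| := by
      refine (norm_sub_le _ _).trans (le_of_eq ?_)
      simp [abs_of_pos Real.pi_pos]
    have : 0 ≤ ‖s‖ * (2 * π * |ξ|) := by positivity
    linarith
  calc ‖bumpHat x ξ * L (s - (2 * π * ξ : ℝ) * Complex.I)‖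
      ≤ ‖𝓕 schwartzBump ξ‖ * (C * ((1 + ‖s‖) * (1 + 2 * π * |ξ|)) ^ α) := by
        rw [norm_mul, norm_bumpHat]
        gcongr
        exact (hbd _ (by simpa using hs)).trans (by gcongr)
    _ = _ := by
        rw [Real.mul_rpow (by positivity) (by positivity)]
        ring

theorem differentiableOn_integral_bumpHat_mul_shift (hL : Differentiable ℂ L) {C α : ℝ}
    (hα : 0 ≤ α) (hbd : ∀ s : ℂ, 1 / 2 ≤ s.re → ‖L s‖ ≤ C * (1 + ‖s‖) ^ α) (x : ℝ) :
    DifferentiableOn ℂ (fun s => ∫ ξ : ℝ, bumpHat x ξ * L (s - (2 * π * ξ : ℝ) * Complex.I))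
      {s | 1 / 2 < s.re} := by
  have hU : IsOpen {s : ℂ | 1 / 2 < s.re} := isOpen_lt continuous_const Complex.continuous_re
  have hLc := hL.continuous
  have hbc := continuous_bumpHat x
  have hC : 0 ≤ C :=
    nonneg_of_mul_nonneg_left ((norm_nonneg _).trans (hbd 1 (by norm_num))) (by positivity)
  refine differentiableOn_integral_of_locally_dominated hU
    (fun s => Continuous.aestronglyMeasurable (by fun_prop))
    (fun ξ => Differentiable.differentiableOn (by fun_prop)) fun s₀ hs₀ =>
    ⟨_, (integrable_norm_mul_one_add_rpow (𝓕 schwartzBump) Real.two_pi_pos.le hα).const_mul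
      (C * (1 + (‖s₀‖ + 1)) ^ α), ?_⟩
  have hnorm : ∀ᶠ s in 𝓝 s₀, ‖s‖ < ‖s₀‖ + 1 :=
    continuous_norm.continuousAt.eventually_lt continuousAt_const (lt_add_one _)
  filter_upwards [hU.mem_nhds hs₀, hnorm] with s hs hs_norm ξ
  refine (norm_bumpHat_mul_shift_le hα hbd (le_of_lt hs) x ξ).trans ?_
  gcongr

theorem differentiable_LSeries_term (a : ℕ → ℂ) (m : ℕ) :
    Differentiable ℂ fun s => LSeries.term a s m := by
  rcases eq_or_ne m 0 with rfl | hm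
  · simp
  have hm' : (m : ℂ) ≠ 0 := Nat.cast_ne_zero.mpr hm
  simp_rw [LSeries.term_of_ne_zero hm, div_eq_mul_inv, ← Complex.cpow_neg]
  exact (differentiable_id.neg.const_cpow (.inl hm')).const_mul _

/- The integral formula of `sum_LSeries_term_mul_bump_eq_integral` continues to `Re s > 1/2` by
the identity theorem, so smooth sums are bounded like `L`, uniformly in their length. -/
theorem IsEntireDirichletSeries.exists_norm_smooth_sum_le (hL : IsEntireDirichletSeries a L)
    {θ η : ℝ} (hθ : 0 ≤ θ) (hLθ : LindelofExponent L θ) (hη : 0 < η) :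
    ∃ C : ℝ, 0 < C ∧ ∀ (s : ℂ) (x : ℝ) (M : ℕ), 1 / 2 < s.re → Real.exp (x + 2) ≤ M →
      ‖∑ m ∈ Finset.Icc 1 M, LSeries.term a s m * bump (Real.log m - x)‖ ≤
        C * (1 + ‖s‖) ^ (θ + η) := by
  obtain ⟨C, hC, hbd⟩ := hL.exists_norm_le_rpow hθ hLθ hη
  have hα : 0 ≤ θ + η := by positivity
  set J := ∫ ξ : ℝ, ‖𝓕 schwartzBump ξ‖ * (1 + 2 * π * |ξ|) ^ (θ + η)
  have : 0 ≤ J := integral_nonneg fun ξ => by positivity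
  refine ⟨C * (J + 1), by positivity, fun s x M hs hM => ?_⟩
  have hcont : Set.EqOn
      (fun s => ∑ m ∈ Finset.Icc 1 M, LSeries.term a s m * bump (Real.log m - x))
      (fun s => ∫ ξ : ℝ, bumpHat x ξ * L (s - (2 * π * ξ : ℝ) * Complex.I))
      {s | 1 / 2 < s.re} := by
    have hU : IsOpen {s : ℂ | 1 / 2 < s.re} := isOpen_lt continuous_const Complex.continuous_re
    have hterm := differentiable_LSeries_term a
    refine (DifferentiableOn.analyticOnNhd (by fun_prop) hU).eqOn_of_preconnected_of_eventuallyEq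
      ((differentiableOn_integral_bumpHat_mul_shift hL.entire hα hbd x).analyticOnNhd hU)
      (convex_halfSpace_re_gt (1 / 2)).isPreconnected (z₀ := 2) (by norm_num) ?_
    have hmem : {s : ℂ | 1 < s.re} ∈ 𝓝 (2 : ℂ) :=
      (isOpen_lt continuous_const Complex.continuous_re).mem_nhds (by simp)
    filter_upwards [hmem] with s hs
    rw [sum_LSeries_term_mul_bump_eq_integral (hL.dirichlet_series s hs).LSeriesSummable hM]
    refine integral_congr_ae (.of_forall fun ξ => ?_)
    dsimp only
    rw [(hL.dirichlet_series _ (by simpa using hs)).LSeries_eq]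
  calc ‖∑ m ∈ Finset.Icc 1 M, LSeries.term a s m * bump (Real.log m - x)‖
      = ‖∫ ξ : ℝ, bumpHat x ξ * L (s - (2 * π * ξ : ℝ) * Complex.I)‖ := congr_arg _ (hcont hs)
    _ ≤ ∫ ξ : ℝ, C * (1 + ‖s‖) ^ (θ + η) *
          (‖𝓕 schwartzBump ξ‖ * (1 + 2 * π * |ξ|) ^ (θ + η)) :=
        norm_integral_le_of_norm_le
          ((integrable_norm_mul_one_add_rpow _ Real.two_pi_pos.le hα).const_mul _)
          (.of_forall (norm_bumpHat_mul_shift_le hα hbd (le_of_lt hs) x))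
    _ = C * (1 + ‖s‖) ^ (θ + η) * J := integral_const_mul _ _
    _ ≤ C * (J + 1) * (1 + ‖s‖) ^ (θ + η) := by
        rw [mul_right_comm]
        gcongr
        exact le_add_of_nonneg_right zero_le_one

end SmoothSums

section Sieve

/-- The integers `1 ≤ m ≤ M` divisible by no element of `S`. -/
def sievedRange (S : Finset ℕ) (M : ℕ) : Finset ℕ :=
  {m ∈ Finset.Icc 1 M | ∀ q ∈ S, ¬ q ∣ m}

variable {S : Finset ℕ} {p M : ℕ}

theorem mem_sievedRange {m : ℕ} :
    m ∈ sievedRange S M ↔ (1 ≤ m ∧ m ≤ M) ∧ ∀ q ∈ S, ¬ q ∣ m := by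
  rw [sievedRange, Finset.mem_filter, Finset.mem_Icc]

theorem sievedRange_empty (M : ℕ) : sievedRange ∅ M = Finset.Icc 1 M := by
  simp [sievedRange]

theorem sievedRange_insert (p : ℕ) (S : Finset ℕ) (M : ℕ) :
    sievedRange (insert p S) M = {m ∈ sievedRange S M | ¬ p ∣ m} := by
  ext m
  simp only [mem_sievedRange, Finset.mem_filter, Finset.forall_mem_insert]
  tauto

theorem coprime_iff_forall_primeFactors {n m : ℕ} (hn : n ≠ 0) :
    n.Coprime m ↔ ∀ q ∈ n.primeFactors, ¬ q ∣ m := by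
  refine ⟨fun h q hq hd => ?_, fun h => Nat.coprime_of_dvd fun k hk hkn =>
    h k (Nat.mem_primeFactors.mpr ⟨hk, hkn, hn⟩)⟩
  exact Nat.not_coprime_of_dvd_of_dvd (Nat.prime_of_mem_primeFactors hq).one_lt
    (Nat.dvd_of_mem_primeFactors hq) hd h

theorem sievedRange_primeFactors {n : ℕ} (hn : n ≠ 0) (M : ℕ) :
    sievedRange n.primeFactors M = {m ∈ Finset.Icc 1 M | n.Coprime m} :=
  Finset.filter_congr fun _ _ => (coprime_iff_forall_primeFactors hn).symm

theorem sum_sievedRange_filter_dvd {E : Type*} [AddCommMonoid E] (hS : ∀ q ∈ S, q.Prime)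
    (hp : p.Prime) (hpS : p ∉ S) {h : ℕ → E} (hh : ∀ m, M < m → h m = 0) :
    ∑ m ∈ sievedRange S M with p ∣ m, h m = ∑ m ∈ sievedRange S M, h (p * m) := by
  refine Finset.sum_of_injOn (· / p) ?_ ?_ ?_ ?_
  · intro m hm n hn hmn
    rw [Finset.mem_coe, Finset.mem_filter] at hm hn
    exact (Nat.div_left_inj hm.2 hn.2).mp hmn
  · intro m hm
    rw [Finset.mem_coe, Finset.mem_filter, mem_sievedRange] at hm
    obtain ⟨⟨⟨hm1, hmM⟩, hmS⟩, hpm⟩ := hm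
    exact mem_sievedRange.mpr ⟨⟨Nat.div_pos (Nat.le_of_dvd hm1 hpm) hp.pos,
      (Nat.div_le_self m p).trans hmM⟩, fun q hq hd => hmS q hq (hd.trans (Nat.div_dvd_of_dvd hpm))⟩
  · intro m hm hm'
    refine hh _ (not_le.mp fun hle => hm' ⟨p * m, ?_, Nat.mul_div_cancel_left m hp.pos⟩)
    obtain ⟨⟨hm1, -⟩, hmS⟩ := mem_sievedRange.mp hm
    rw [Finset.mem_coe, Finset.mem_filter, mem_sievedRange]
    refine ⟨⟨⟨Nat.mul_pos hp.pos hm1, hle⟩, fun q hq hd => ?_⟩, dvd_mul_right p m⟩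
    rcases (hS q hq).dvd_mul.mp hd with hqp | hqm
    · exact hpS ((Nat.prime_dvd_prime_iff_eq (hS q hq) hp).mp hqp ▸ hq)
    · exact hmS q hq hqm
  · intro m hm
    rw [Nat.mul_div_cancel' (Finset.mem_filter.mp hm).2]

theorem sum_sievedRange_eq_sum_range_add {E : Type*} [AddCommMonoid E] (hS : ∀ q ∈ S, q.Prime)
    (hp : p.Prime) (hpS : p ∉ S) {h : ℕ → E} (hh : ∀ m, M < m → h m = 0) (K : ℕ) :
    ∑ m ∈ sievedRange S M, h m =
      ∑ k ∈ Finset.range K, ∑ m ∈ sievedRange (insert p S) M, h (p ^ k * m) +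
        ∑ m ∈ sievedRange S M, h (p ^ K * m) := by
  induction K with
  | zero => simp
  | succ K ih =>
    have hhK : ∀ m, M < m → h (p ^ K * m) = 0 := fun m hm =>
      hh _ (hm.trans_le (Nat.le_mul_of_pos_left m (pow_pos hp.pos K)))
    have hstep : ∑ m ∈ sievedRange S M, h (p ^ K * m) =
        ∑ m ∈ sievedRange (insert p S) M, h (p ^ K * m) +
          ∑ m ∈ sievedRange S M, h (p ^ (K + 1) * m) := by
      rw [← Finset.sum_filter_not_add_sum_filter _ (p ∣ ·), sievedRange_insert,
        sum_sievedRange_filter_dvd hS hp hpS hhK]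
      simp only [pow_succ, mul_assoc]
    rw [ih, hstep, Finset.sum_range_succ, add_assoc]

theorem sum_sievedRange_eq_sum_range {E : Type*} [AddCommMonoid E] (hS : ∀ q ∈ S, q.Prime)
    (hp : p.Prime) (hpS : p ∉ S) {h : ℕ → E} (hh : ∀ m, M < m → h m = 0) {K : ℕ}
    (hMK : M < 2 ^ K) :
    ∑ m ∈ sievedRange S M, h m =
      ∑ k ∈ Finset.range K, ∑ m ∈ sievedRange (insert p S) M, h (p ^ k * m) := by
  rw [sum_sievedRange_eq_sum_range_add hS hp hpS hh K, Finset.sum_eq_zero (s := sievedRange S M),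
    add_zero]
  intro m hm
  refine hh _ (hMK.trans_le ((Nat.pow_le_pow_left hp.two_le K).trans ?_))
  exact Nat.le_mul_of_pos_right _ (mem_sievedRange.mp hm).1.1

theorem IsCoprimeMultiplicative.map_prime_pow_mul {R : Type*} [MulOneClass R] {f : ℕ → R}
    (hf : IsCoprimeMultiplicative f) (hp : p.Prime) {m : ℕ}
    (hm : m ∈ sievedRange (insert p S) M) (k : ℕ) : f (p ^ k * m) = f (p ^ k) * f m :=
  hf.map_mul_of_coprime <| Nat.Coprime.pow_left k <| hp.coprime_iff_not_dvd.mpr <|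
    (mem_sievedRange.mp hm).2 p (Finset.mem_insert_self p S)

section SmoothSum

/-- The smoothed sum of `f m` over the integers `m ≈ e^x` up to `M` with no divisor in `S`. -/
noncomputable def smoothSum (f : ℕ → ℂ) (S : Finset ℕ) (M : ℕ) (x : ℝ) : ℂ :=
  ∑ m ∈ sievedRange S M, f m * bump (Real.log m - x)

variable {f : ℕ → ℂ}

theorem smoothSum_of_lt_neg_two (f : ℕ → ℂ) (S : Finset ℕ) (M : ℕ) {x : ℝ} (hx : x < -2) :
    smoothSum f S M x = 0 := by
  refine Finset.sum_eq_zero fun m hm => ?_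
  have hlog : 0 ≤ Real.log m := Real.log_nonneg (by exact_mod_cast (mem_sievedRange.mp hm).1.1)
  rw [bump_eq_zero (le_abs.mpr (.inl (by linarith))), Complex.ofReal_zero, mul_zero]

theorem smoothSum_eq_sum_range (hf : IsCoprimeMultiplicative f) (hS : ∀ q ∈ S, q.Prime)
    (hp : p.Prime) (hpS : p ∉ S) {K : ℕ} (hMK : M < 2 ^ K) {x : ℝ}
    (hM : Real.exp (x + 2) ≤ M) :
    smoothSum f S M x = ∑ k ∈ Finset.range K,
      f (p ^ k) * smoothSum f (insert p S) M (x - k * Real.log p) := by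
  have hvanish : ∀ m, M < m → f m * bump (Real.log m - x) = 0 := by
    intro m hm
    have hlog : x + 2 ≤ Real.log m :=
      (Real.le_log_iff_exp_le (by exact_mod_cast (Nat.zero_le M).trans_lt hm)).mpr
        (hM.trans (by exact_mod_cast hm.le))
    rw [bump_eq_zero (le_abs.mpr (.inl (by linarith))), Complex.ofReal_zero, mul_zero]
  rw [smoothSum, sum_sievedRange_eq_sum_range hS hp hpS hvanish hMK]
  refine Finset.sum_congr rfl fun k _ => ?_
  rw [smoothSum, Finset.mul_sum]
  refine Finset.sum_congr rfl fun m hm => ?_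
  have hlog : Real.log ((p ^ k * m : ℕ) : ℝ) = Real.log m + k * Real.log p := by
    have hm0 : (m : ℝ) ≠ 0 := by
      exact_mod_cast (Nat.one_le_iff_ne_zero.mp (mem_sievedRange.mp hm).1.1)
    have hpk : ((p ^ k : ℕ) : ℝ) ≠ 0 := by exact_mod_cast pow_ne_zero k hp.ne_zero
    rw [Nat.cast_mul, Real.log_mul hpk hm0, Nat.cast_pow, Real.log_pow, add_comm]
  rw [hf.map_prime_pow_mul hp hm, hlog, mul_assoc, sub_sub_eq_add_sub]

theorem smoothSum_insert_eq_sub (hf : IsCoprimeMultiplicative f) (hS : ∀ q ∈ S, q.Prime)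
    (hp : p.Prime) (hpS : p ∉ S) {x : ℝ} (hM : Real.exp (x + 2) ≤ M) :
    smoothSum f (insert p S) M x = smoothSum f S M x -
      ∑ k ∈ Finset.Ico 1 (M + 1), f (p ^ k) * smoothSum f (insert p S) M (x - k * Real.log p) := by
  have hMK : M < 2 ^ (M + 1) := Nat.lt_two_pow_self.trans (Nat.pow_lt_pow_succ one_lt_two)
  rw [smoothSum_eq_sum_range hf hS hp hpS hMK hM,
    ← Finset.sum_range_add_sum_Ico _ (Nat.le_add_left 1 M), Finset.sum_range_one, pow_zero,
    hf.map_one, one_mul, Nat.cast_zero, zero_mul, sub_zero, add_sub_cancel_right]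

/- The terms of `smoothSum_insert_eq_sub` are smooth sums over shorter ranges, so the bound is
proved by induction on the length; the factor `2` absorbs their total weight `1 / 2`. -/
theorem norm_smoothSum_insert_le (hf : IsCoprimeMultiplicative f) (hS : ∀ q ∈ S, q.Prime)
    (hp : p.Prime) (hpS : p ∉ S) {B : ℝ}
    (hlocal : ∀ K, ∑ k ∈ Finset.Ico 1 K, ‖f (p ^ k)‖ ≤ 1 / 2)
    (hB : ∀ x, Real.exp (x + 2) ≤ M → ‖smoothSum f S M x‖ ≤ B) {x : ℝ}
    (hM : Real.exp (x + 2) ≤ M) : ‖smoothSum f (insert p S) M x‖ ≤ 2 * B := by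
  have hlog2 : 0 < Real.log 2 := Real.log_pos one_lt_two
  obtain ⟨j, hj⟩ : ∃ j : ℕ, x < -2 + j * Real.log 2 := by
    obtain ⟨j, hj⟩ := exists_nat_gt ((x + 2) / Real.log 2)
    exact ⟨j, by linarith [(div_lt_iff₀ hlog2).mp hj]⟩
  have hB0 : 0 ≤ B := (norm_nonneg _).trans (hB x hM)
  induction j generalizing x with
  | zero =>
    rw [smoothSum_of_lt_neg_two _ _ _ (by simpa using hj), norm_zero]
    positivity
  | succ j ih =>
    have htail : ‖∑ k ∈ Finset.Ico 1 (M + 1),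
        f (p ^ k) * smoothSum f (insert p S) M (x - k * Real.log p)‖ ≤ 1 / 2 * (2 * B) := by
      refine (norm_sum_le_of_le _ fun k hk => ?_).trans
        ((Finset.sum_mul _ _ (2 * B)).symm.trans_le
          (mul_le_mul_of_nonneg_right (hlocal (M + 1)) (by positivity)))
      have hlog : Real.log 2 ≤ k * Real.log p := by
        rw [← Real.log_pow, ← Nat.cast_pow]
        refine Real.log_le_log two_pos ?_
        exact_mod_cast hp.two_le.trans (Nat.le_self_pow (by grind) p)
      rw [norm_mul]
      refine mul_le_mul_of_nonneg_left (ih ?_ ?_) (norm_nonneg _)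
      · exact (Real.exp_le_exp.mpr (by linarith)).trans hM
      · push_cast at hj
        linarith
    rw [smoothSum_insert_eq_sub hf hS hp hpS hM]
    linarith [norm_sub_le_of_le (hB x hM) htail]

theorem norm_smoothSum_le_two_pow (hf : IsCoprimeMultiplicative f) {B : ℝ}
    (hB : ∀ x, Real.exp (x + 2) ≤ M → ‖smoothSum f ∅ M x‖ ≤ B) (hS : ∀ q ∈ S, q.Prime)
    (hlocal : ∀ p ∈ S, ∀ K, ∑ k ∈ Finset.Ico 1 K, ‖f (p ^ k)‖ ≤ 1 / 2) {x : ℝ}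
    (hM : Real.exp (x + 2) ≤ M) : ‖smoothSum f S M x‖ ≤ 2 ^ S.card * B := by
  induction S using Finset.induction generalizing x with
  | empty => simpa using hB x hM
  | insert p S hpS ih =>
    simp only [Finset.forall_mem_insert] at hS hlocal
    rw [Finset.card_insert_of_notMem hpS, pow_succ', mul_assoc]
    exact norm_smoothSum_insert_le hf hS.2 hS.1 hpS hlocal.1 (fun _ => ih hS.2 hlocal.2) hM

end SmoothSum

section NormSum

variable {E : Type*} [NormedField E] {f : ℕ → E}

theorem sum_norm_sievedRange_le_mul_insert (hf : IsCoprimeMultiplicative f)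
    (hS : ∀ q ∈ S, q.Prime) (hp : p.Prime) (hpS : p ∉ S) {Z : ℝ}
    (hZ : ∀ K, ∑ k ∈ Finset.range K, ‖f (p ^ k)‖ ≤ Z) :
    ∑ m ∈ sievedRange S M, ‖f m‖ ≤ Z * ∑ m ∈ sievedRange (insert p S) M, ‖f m‖ := by
  have hcut : ∀ m, M < m → (if m ≤ M then ‖f m‖ else 0) = 0 := fun m hm => if_neg hm.not_ge
  calc ∑ m ∈ sievedRange S M, ‖f m‖
      = ∑ m ∈ sievedRange S M, if m ≤ M then ‖f m‖ else 0 :=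
        Finset.sum_congr rfl fun m hm => (if_pos (mem_sievedRange.mp hm).1.2).symm
    _ = ∑ k ∈ Finset.range M, ∑ m ∈ sievedRange (insert p S) M,
          if p ^ k * m ≤ M then ‖f (p ^ k * m)‖ else 0 :=
        sum_sievedRange_eq_sum_range hS hp hpS hcut Nat.lt_two_pow_self
    _ ≤ ∑ k ∈ Finset.range M, ∑ m ∈ sievedRange (insert p S) M, ‖f (p ^ k)‖ * ‖f m‖ := by
        gcongr with k _ m hm
        rw [hf.map_prime_pow_mul hp hm, norm_mul]
        split_ifs
        exacts [le_rfl, by positivity]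
    _ = (∑ k ∈ Finset.range M, ‖f (p ^ k)‖) * ∑ m ∈ sievedRange (insert p S) M, ‖f m‖ :=
        Finset.sum_mul_sum .. |>.symm
    _ ≤ Z * ∑ m ∈ sievedRange (insert p S) M, ‖f m‖ := by
        gcongr
        exact hZ M

theorem sum_norm_Icc_le_pow_mul_sievedRange (hf : IsCoprimeMultiplicative f) {Z : ℝ}
    (hS : ∀ q ∈ S, q.Prime) (hZ : ∀ p ∈ S, ∀ K, ∑ k ∈ Finset.range K, ‖f (p ^ k)‖ ≤ Z) (M : ℕ) :
    ∑ m ∈ Finset.Icc 1 M, ‖f m‖ ≤ Z ^ S.card * ∑ m ∈ sievedRange S M, ‖f m‖ := by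
  induction S using Finset.induction with
  | empty => simp [sievedRange_empty]
  | insert p S hpS ih =>
    simp only [Finset.forall_mem_insert] at hS hZ
    have : 0 ≤ Z := by simpa using hZ.1 0
    rw [Finset.card_insert_of_notMem hpS, pow_succ, mul_assoc]
    refine (ih hS.2 hZ.2).trans ?_
    gcongr
    exact sum_norm_sievedRange_le_mul_insert hf hS.2 hS.1 hpS hZ.1

end NormSum

end Sieve

section DivisorBound

theorem natCast_rpow_eq_prod_primeFactors {n : ℕ} (hn : n ≠ 0) (ε : ℝ) :
    (n : ℝ) ^ ε = ∏ p ∈ n.primeFactors, ((p : ℝ) ^ ε) ^ n.factorization p := by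
  conv_lhs =>
    rw [← Nat.prod_factorization_pow_eq_self hn, Nat.prod_factorization_eq_prod_primeFactors]
  rw [Nat.cast_prod, ← Real.finsetProd_rpow _ _ fun p _ => Nat.cast_nonneg _]
  refine Finset.prod_congr rfl fun p _ => ?_
  rw [Nat.cast_pow, Real.rpow_pow_comm p.cast_nonneg]

theorem natCast_add_one_le_pow {x : ℝ} (hx : 2 ≤ x) (a : ℕ) : (a : ℝ) + 1 ≤ x ^ a :=
  calc (a : ℝ) + 1 ≤ 2 ^ a := by exact_mod_cast Nat.lt_two_pow_self
    _ ≤ x ^ a := by gcongr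

theorem natCast_add_one_le_max_mul_pow {ε p : ℝ} (hε : 0 < ε) (hp : 2 ≤ p) (a : ℕ) :
    (a : ℝ) + 1 ≤ max 1 (1 / (ε * Real.log 2)) * (p ^ ε) ^ a := by
  have : 0 < Real.log 2 := Real.log_pos one_lt_two
  set c := max 1 (1 / (ε * Real.log 2))
  have hc : 1 ≤ c * (ε * Real.log 2) :=
    (div_le_iff₀ (by positivity)).mp (le_max_right 1 (1 / (ε * Real.log 2)))
  calc (a : ℝ) + 1 ≤ a * (c * (ε * Real.log 2)) + c :=
        add_le_add (le_mul_of_one_le_right a.cast_nonneg hc) (le_max_left _ _)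
    _ = c * (a * (ε * Real.log 2) + 1) := by ring
    _ ≤ c * Real.exp (a * (ε * Real.log 2)) := by
        gcongr
        exact Real.add_one_le_exp _
    _ = c * (2 ^ ε) ^ a := by
        rw [Real.rpow_def_of_pos two_pos, ← Real.exp_nat_mul, mul_comm ε]
    _ ≤ c * (p ^ ε) ^ a := by gcongr

/- Primes with `p ^ ε ≥ 2` contribute no constant, and each of the finitely many others
contributes a bounded one. -/
theorem exists_card_divisors_le_rpow {ε : ℝ} (hε : 0 < ε) :
    ∃ C : ℝ, 1 ≤ C ∧ ∀ n : ℕ, n ≠ 0 → (n.divisors.card : ℝ) ≤ C * (n : ℝ) ^ ε := by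
  obtain ⟨N, hN⟩ := exists_nat_ge ((2 : ℝ) ^ (1 / ε))
  set c := max 1 (1 / (ε * Real.log 2))
  have hc : 1 ≤ c := le_max_left _ _
  refine ⟨c ^ N, one_le_pow₀ hc, fun n hn => ?_⟩
  have hcard : (n.primeFactors.filter (· < N)).card ≤ N := by
    refine (Finset.card_le_card fun p hp => ?_).trans_eq (Finset.card_range N)
    exact Finset.mem_range.mpr (Finset.mem_filter.mp hp).2
  have hfactor : ∀ p ∈ n.primeFactors, (n.factorization p : ℝ) + 1 ≤
      (if p < N then c else 1) * ((p : ℝ) ^ ε) ^ n.factorization p := by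
    intro p hp
    split_ifs with hpN
    · exact natCast_add_one_le_max_mul_pow hε
        (by exact_mod_cast (Nat.prime_of_mem_primeFactors hp).two_le) _
    · rw [one_mul]
      refine natCast_add_one_le_pow ?_ _
      calc (2 : ℝ) = ((2 : ℝ) ^ (1 / ε)) ^ ε := by
            rw [one_div, Real.rpow_inv_rpow two_pos.le hε.ne']
        _ ≤ (p : ℝ) ^ ε := by
            gcongr
            exact hN.trans (by exact_mod_cast not_lt.mp hpN)
  calc (n.divisors.card : ℝ) = ∏ p ∈ n.primeFactors, ((n.factorization p : ℝ) + 1) := by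
        rw [Nat.card_divisors hn]
        push_cast
        rfl
    _ ≤ ∏ p ∈ n.primeFactors,
          ((if p < N then c else 1) * ((p : ℝ) ^ ε) ^ n.factorization p) :=
        Finset.prod_le_prod (fun p _ => by positivity) hfactor
    _ = c ^ (n.primeFactors.filter (· < N)).card * (n : ℝ) ^ ε := by
        rw [Finset.prod_mul_distrib, Finset.prod_ite, Finset.prod_const, Finset.prod_const_one,
          mul_one, natCast_rpow_eq_prod_primeFactors hn]
    _ ≤ c ^ N * (n : ℝ) ^ ε := by gcongr

theorem two_pow_card_primeFactors_le_card_divisors {n : ℕ} (hn : n ≠ 0) :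
    2 ^ n.primeFactors.card ≤ n.divisors.card := by
  rw [Nat.card_divisors hn, ← Finset.prod_const]
  refine Finset.prod_le_prod' fun p hp => Nat.succ_le_succ ?_
  exact (Nat.prime_of_mem_primeFactors hp).factorization_pos_of_dvd hn
    (Nat.dvd_of_mem_primeFactors hp)

end DivisorBound

section ScaledCoeff

/-- The terms `A(m) m^{-σ}` of the Dirichlet series at the real point `σ`. -/
noncomputable def scaledCoeff (A : ℕ → ℝ) (σ : ℝ) (m : ℕ) : ℝ :=
  A m * (m : ℝ) ^ (-σ)

theorem isCoprimeMultiplicative_scaledCoeff {A : ℕ → ℝ}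
    (hA : IsCoprimeMultiplicative A) (σ : ℝ) :
    IsCoprimeMultiplicative (scaledCoeff A σ) where
  map_one := by simp [scaledCoeff, hA.map_one]
  map_mul_of_coprime h := by
    simp only [scaledCoeff]
    rw [hA.map_mul_of_coprime h, Nat.cast_mul, Real.mul_rpow (Nat.cast_nonneg _)
      (Nat.cast_nonneg _), mul_mul_mul_comm]

namespace RankinSelbergBound

variable {A : ℕ → ℝ} {σ : ℝ}

theorem summable_scaledCoeff_sq (hRS : RankinSelbergBound A) (hσ : 1 / 2 < σ) :
    Summable fun m : ℕ => scaledCoeff A σ m ^ 2 := by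
  obtain ⟨C, hC⟩ := hRS (σ - 1 / 2) (by linarith)
  have hseries : LSeriesSummable (fun m => ((|A m| ^ 2 : ℝ) : ℂ)) ((2 * σ : ℝ) : ℂ) := by
    refine LSeriesSummable_of_sum_norm_bigO_and_nonneg (r := 1 + (σ - 1 / 2)) ?_
      (fun n => by positivity) (by linarith) (by rw [Complex.ofReal_re]; linarith)
    refine IsBigO.of_bound C ?_
    filter_upwards [eventually_ge_atTop 1] with n hn
    rw [Real.norm_of_nonneg (Finset.sum_nonneg fun k _ => by positivity),
      Real.norm_of_nonneg (by positivity)]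
    simpa only [Nat.floor_natCast] using hC n (by exact_mod_cast hn)
  refine hseries.norm.congr fun m => ?_
  rw [LSeries.norm_term_eq, scaledCoeff, mul_pow, ← Real.rpow_mul_natCast m.cast_nonneg]
  split_ifs with hm
  · rw [hm, Nat.cast_zero, Real.zero_rpow (by push_cast; linarith), mul_zero]
  · rw [Complex.norm_real, Complex.ofReal_re, Real.norm_of_nonneg (by positivity), sq_abs,
      div_eq_mul_inv, ← Real.rpow_neg m.cast_nonneg]
    ring_nf

theorem exists_abs_scaledCoeff_le (hRS : RankinSelbergBound A) (hσ : 1 / 2 < σ) :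
    ∃ C : ℝ, 1 ≤ C ∧ ∀ m : ℕ, |scaledCoeff A σ m| ≤ C := by
  have hsum := hRS.summable_scaledCoeff_sq hσ
  refine ⟨max 1 √(∑' m, scaledCoeff A σ m ^ 2), le_max_left _ _, fun m => ?_⟩
  exact le_max_of_le_right (Real.abs_le_sqrt (hsum.le_tsum m fun _ _ => sq_nonneg _))

theorem exists_abs_scaledCoeff_prime_pow_le (hRS : RankinSelbergBound A) (hσ : 1 / 2 < σ) :
    ∃ C ρ : ℝ, 1 ≤ C ∧ 0 < ρ ∧
      ∀ p k : ℕ, 0 < p → |scaledCoeff A σ (p ^ k)| ≤ C * ((p : ℝ) ^ (-ρ)) ^ k := by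
  obtain ⟨σ', hσ', hσσ'⟩ := exists_between hσ
  obtain ⟨C, hC1, hC⟩ := hRS.exists_abs_scaledCoeff_le hσ'
  refine ⟨C, σ - σ', hC1, sub_pos.mpr hσσ', fun p k hp => ?_⟩
  have hpk : (0 : ℝ) < ((p ^ k : ℕ) : ℝ) := by exact_mod_cast pow_pos hp k
  have hsplit : scaledCoeff A σ (p ^ k) =
      scaledCoeff A σ' (p ^ k) * ((p : ℝ) ^ (-(σ - σ'))) ^ k := by
    rw [scaledCoeff, scaledCoeff, mul_assoc, Real.rpow_pow_comm p.cast_nonneg, ← Nat.cast_pow,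
      ← Real.rpow_add hpk]
    ring_nf
  rw [hsplit, abs_mul, abs_of_nonneg (by positivity : 0 ≤ ((p : ℝ) ^ (-(σ - σ'))) ^ k)]
  gcongr
  exact hC _

theorem exists_local_sum_le (hRS : RankinSelbergBound A) (hσ : 1 / 2 < σ) :
    ∃ Z : ℝ, ∀ p : ℕ, p.Prime →
      ∀ K, ∑ k ∈ Finset.range K, |scaledCoeff A σ (p ^ k)| ≤ Z := by
  obtain ⟨C, ρ, hC1, hρ, hC⟩ := hRS.exists_abs_scaledCoeff_prime_pow_le hσ
  have hlt : (2 : ℝ) ^ (-ρ) < 1 := Real.rpow_lt_one_of_one_lt_of_neg one_lt_two (by linarith)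
  refine ⟨C * ((2 : ℝ) ^ (-ρ)) ^ 0 / (1 - (2 : ℝ) ^ (-ρ)), fun p hp K => ?_⟩
  have hp2 : (2 : ℝ) ≤ p := by exact_mod_cast hp.two_le
  calc ∑ k ∈ Finset.range K, |scaledCoeff A σ (p ^ k)|
      ≤ ∑ k ∈ Finset.Ico 0 K, C * ((2 : ℝ) ^ (-ρ)) ^ k := by
        rw [Finset.range_eq_Ico]
        gcongr with k _
        refine (hC p k hp.pos).trans ?_
        gcongr ?_ * ?_ ^ k
        exact Real.rpow_le_rpow_of_nonpos two_pos hp2 (by linarith)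
    _ ≤ C * ((2 : ℝ) ^ (-ρ)) ^ 0 / (1 - (2 : ℝ) ^ (-ρ)) := by
        rw [← Finset.mul_sum, mul_div_assoc]
        gcongr
        exact geom_sum_Ico_le_of_lt_one (by positivity) hlt

theorem exists_local_tail_le (hRS : RankinSelbergBound A) (hσ : 1 / 2 < σ) :
    ∃ p₀ : ℕ, ∀ p : ℕ, p.Prime → p₀ ≤ p →
      ∀ K, ∑ k ∈ Finset.Ico 1 K, |scaledCoeff A σ (p ^ k)| ≤ 1 / 2 := by
  obtain ⟨C, ρ, hC1, hρ, hC⟩ := hRS.exists_abs_scaledCoeff_prime_pow_le hσ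
  have htend : Tendsto (fun p : ℕ => (p : ℝ) ^ (-ρ)) atTop (𝓝 0) :=
    (tendsto_rpow_neg_atTop hρ).comp tendsto_natCast_atTop_atTop
  obtain ⟨p₀, hp₀⟩ := eventually_atTop.mp
    (htend.eventually_le_const (show (0 : ℝ) < 1 / (4 * C) by positivity))
  refine ⟨p₀, fun p hp hpp K => ?_⟩
  set q := (p : ℝ) ^ (-ρ)
  have hq0 : 0 ≤ q := by positivity
  have hqC : q * (4 * C) ≤ 1 := (le_div_iff₀ (by positivity)).mp (hp₀ p hpp)
  have hq1 : q ≤ 1 / 2 := by nlinarith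
  calc ∑ k ∈ Finset.Ico 1 K, |scaledCoeff A σ (p ^ k)|
      ≤ C * ∑ k ∈ Finset.Ico 1 K, q ^ k := by
        rw [Finset.mul_sum]
        exact Finset.sum_le_sum fun k _ => hC p k hp.pos
    _ ≤ C * (q ^ 1 / (1 - q)) := by
        gcongr
        exact geom_sum_Ico_le_of_lt_one hq0 (by linarith)
    _ ≤ 1 / 2 := by
        rw [pow_one, ← mul_div_assoc, div_le_iff₀ (by linarith)]
        linarith

end RankinSelbergBound

end ScaledCoeff

section MeanValue

variable {ι : Type*} {E : Type*} [NormedAddCommGroup E] [NormedSpace ℝ E]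

/-- The smooth short sum `w ↦ ∑ φ(w - T log νᵢ) bᵢ`, over the `νᵢ` lying in a multiplicative window
of width `≍ 1/T` around `e^{w/T}`. -/
noncomputable def shortSum (I : Finset ι) (b : ι → E) (ν : ι → ℕ) (T w : ℝ) : E :=
  ∑ i ∈ I, bump (w - T * Real.log (ν i)) • b i

theorem shortSum_ofReal (I : Finset ι) (b : ι → ℝ) (ν : ι → ℕ) (T w : ℝ) :
    shortSum I (fun i => (b i : ℂ)) ν T w = (shortSum I b ν T w : ℝ) := by
  simp [shortSum]

theorem continuous_shortSum (I : Finset ι) (b : ι → E) (ν : ι → ℕ) (T : ℝ) :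
    Continuous (shortSum I b ν T) := by
  have := bump.continuous
  unfold shortSum
  fun_prop

theorem hasCompactSupport_bump_sub (x : ℝ) : HasCompactSupport fun w => bump (w - x) :=
  bump.hasCompactSupport.comp_homeomorph (Homeomorph.subRight x)

theorem hasCompactSupport_shortSum (I : Finset ι) (b : ι → E) (ν : ι → ℕ) (T : ℝ) :
    HasCompactSupport (shortSum I b ν T) := by
  classical
  unfold shortSum
  induction I using Finset.induction_on with
  | empty =>
    simp only [Finset.sum_empty]
    exact HasCompactSupport.zero
  | insert i I hi ih =>
    simp only [Finset.sum_insert hi]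
    exact (hasCompactSupport_bump_sub _).smul_right.add ih

theorem integrable_shortSum (I : Finset ι) (b : ι → E) (ν : ι → ℕ) (T : ℝ) :
    Integrable (shortSum I b ν T) :=
  (continuous_shortSum I b ν T).integrable_of_hasCompactSupport (hasCompactSupport_shortSum I b ν T)

theorem memLp_shortSum (I : Finset ι) (b : ι → E) (ν : ι → ℕ) (T : ℝ) :
    MemLp (shortSum I b ν T) 2 :=
  (continuous_shortSum I b ν T).memLp_of_hasCompactSupport (hasCompactSupport_shortSum I b ν T)

theorem integrable_norm_shortSum_sq (I : Finset ι) (b : ι → E) (ν : ι → ℕ) (T : ℝ) :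
    Integrable fun w => ‖shortSum I b ν T w‖ ^ 2 := by
  simpa using (memLp_shortSum I b ν T).integrable_norm_pow two_ne_zero

theorem integral_shortSum [CompleteSpace E] (I : Finset ι) (b : ι → E) (ν : ι → ℕ) (T : ℝ) :
    ∫ w, shortSum I b ν T w = (∫ w, bump w) • ∑ i ∈ I, b i := by
  have hInt (i : ι) : Integrable fun w => bump (w - T * Real.log (ν i)) • b i :=
    (bump.integrable.comp_sub_right _).smul_const _
  simp_rw [shortSum, integral_finsetSum I fun i _ => hInt i, integral_smul_const,
    integral_sub_right_eq_self (fun w => bump w), ← Finset.smul_sum]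

theorem card_le_of_log_window {F : Finset ℕ} {N : ℕ} {T w : ℝ} (hT : 0 < T)
    (hF : ∀ l ∈ F, 1 ≤ l ∧ l ≤ N) (hw : ∀ l ∈ F, |w - T * Real.log l| < 2) :
    (F.card : ℝ) ≤ 1 + 4 * N / T := by
  rcases F.eq_empty_or_nonempty with rfl | hne
  · simp only [Finset.card_empty, Nat.cast_zero]
    positivity
  have hmin := F.min'_mem hne
  have hmax := F.max'_mem hne
  set l₀ := F.min' hne
  set l₁ := F.max' hne
  have hle : l₀ ≤ l₁ := F.min'_le _ hmax
  have hl₀ : (0 : ℝ) < l₀ := by exact_mod_cast (hF _ hmin).1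
  have hl₁ : (0 : ℝ) < l₁ := by exact_mod_cast (hF _ hmax).1
  have hl₁N : (l₁ : ℝ) ≤ N := by exact_mod_cast (hF _ hmax).2
  have hcard : (F.card : ℝ) ≤ 1 + (l₁ - l₀) := by
    have h : F.card ≤ l₁ + 1 - l₀ := by
      rw [← Nat.card_Icc]
      exact Finset.card_le_card fun l hl => Finset.mem_Icc.mpr ⟨F.min'_le _ hl, F.le_max' _ hl⟩
    have h' : (F.card : ℝ) + l₀ ≤ l₁ + 1 := by exact_mod_cast (by omega : F.card + l₀ ≤ l₁ + 1)
    linarith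
  have hlog : (l₁ - l₀ : ℝ) / l₁ ≤ Real.log l₁ - Real.log l₀ := by
    have h := Real.one_sub_inv_le_log_of_pos (div_pos hl₁ hl₀)
    rwa [Real.log_div hl₁.ne' hl₀.ne', inv_div, one_sub_div hl₁.ne'] at h
  have hwindow : T * (Real.log l₁ - Real.log l₀) ≤ 4 := by
    linarith [abs_lt.mp (hw _ hmin), abs_lt.mp (hw _ hmax)]
  refine hcard.trans (add_le_add_right ?_ 1)
  rw [le_div_iff₀ hT]
  calc (l₁ - l₀ : ℝ) * T = l₁ * (T * ((l₁ - l₀) / l₁)) := by field_simp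
    _ ≤ l₁ * (T * (Real.log l₁ - Real.log l₀)) := by gcongr
    _ ≤ l₁ * 4 := by gcongr
    _ ≤ 4 * N := by linarith

section MeanSquare

variable {I : Finset ι} {ν : ι → ℕ} {N R : ℕ} {T : ℝ}

theorem card_filter_bump_ne_zero_le (hν : ∀ i ∈ I, 1 ≤ ν i ∧ ν i ≤ N)
    (hR : ∀ l, {i ∈ I | ν i = l}.card ≤ R) (hT : 0 < T) (w : ℝ) :
    ({i ∈ I | bump (w - T * Real.log (ν i)) ≠ 0}.card : ℝ) ≤ R * (1 + 4 * N / T) := by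
  set J := {i ∈ I | bump (w - T * Real.log (ν i)) ≠ 0}
  have hfibres : J.card ≤ R * (J.image ν).card :=
    Finset.card_le_mul_card_image _ _ fun l _ =>
      (Finset.card_le_card (Finset.filter_subset_filter _ (Finset.filter_subset _ _))).trans (hR l)
  have himage : ((J.image ν).card : ℝ) ≤ 1 + 4 * N / T := by
    refine card_le_of_log_window (w := w) hT ?_ ?_ <;>
      exact Finset.forall_mem_image.mpr fun i hi => by
        obtain ⟨hiI, hi⟩ := Finset.mem_filter.mp hi
        first | exact hν i hiI | exact abs_lt_two_of_bump_ne_zero hi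
  calc (J.card : ℝ) ≤ R * (J.image ν).card := by exact_mod_cast hfibres
    _ ≤ _ := by gcongr

theorem norm_shortSum_sq_le (hν : ∀ i ∈ I, 1 ≤ ν i ∧ ν i ≤ N)
    (hR : ∀ l, {i ∈ I | ν i = l}.card ≤ R) (hT : 0 < T) (b : ι → E) (w : ℝ) :
    ‖shortSum I b ν T w‖ ^ 2 ≤
      R * (1 + 4 * N / T) * ∑ i ∈ I, bump (w - T * Real.log (ν i)) ^ 2 * ‖b i‖ ^ 2 := by
  set J := {i ∈ I | bump (w - T * Real.log (ν i)) ≠ 0}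
  have hJ : shortSum I b ν T w = ∑ i ∈ J, bump (w - T * Real.log (ν i)) • b i :=
    (Finset.sum_filter_of_ne fun _ _ hi => (smul_ne_zero_iff.mp hi).1).symm
  calc ‖shortSum I b ν T w‖ ^ 2 ≤ (∑ i ∈ J, bump (w - T * Real.log (ν i)) * ‖b i‖) ^ 2 := by
        rw [hJ]
        gcongr
        exact norm_sum_le_of_le _ fun i _ => by
          rw [norm_smul, Real.norm_of_nonneg bump.nonneg]
    _ ≤ J.card * ∑ i ∈ J, (bump (w - T * Real.log (ν i)) * ‖b i‖) ^ 2 :=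
        sq_sum_le_card_mul_sum_sq
    _ ≤ (R * (1 + 4 * N / T)) * ∑ i ∈ I, (bump (w - T * Real.log (ν i)) * ‖b i‖) ^ 2 := by
        gcongr
        · exact card_filter_bump_ne_zero_le hν hR hT w
        · exact Finset.filter_subset _ _
    _ = _ := by simp_rw [mul_pow]

theorem integral_norm_shortSum_sq_le (hν : ∀ i ∈ I, 1 ≤ ν i ∧ ν i ≤ N)
    (hR : ∀ l, {i ∈ I | ν i = l}.card ≤ R) (hT : 0 < T) (b : ι → E) :
    ∫ w, ‖shortSum I b ν T w‖ ^ 2 ≤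
      (∫ w, bump w ^ 2) * R * (1 + 4 * N / T) * ∑ i ∈ I, ‖b i‖ ^ 2 := by
  have hbump : Integrable fun w : ℝ => bump w ^ 2 :=
    (bump.continuous.memLp_of_hasCompactSupport bump.hasCompactSupport).integrable_sq
  have hterm (i : ι) :
      Integrable fun w => bump (w - T * Real.log (ν i)) ^ 2 * ‖b i‖ ^ 2 :=
    (hbump.comp_sub_right _).mul_const _
  calc ∫ w, ‖shortSum I b ν T w‖ ^ 2
      ≤ ∫ w, R * (1 + 4 * N / T) * ∑ i ∈ I, bump (w - T * Real.log (ν i)) ^ 2 * ‖b i‖ ^ 2 :=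
        integral_mono (integrable_norm_shortSum_sq I b ν T)
          ((integrable_finsetSum _ fun i _ => hterm i).const_mul _)
          (norm_shortSum_sq_le hν hR hT b)
    _ = R * (1 + 4 * N / T) * ∑ i ∈ I, (∫ w, bump w ^ 2) * ‖b i‖ ^ 2 := by
        rw [integral_const_mul, integral_finsetSum _ fun i _ => hterm i]
        simp_rw [integral_mul_const, integral_sub_right_eq_self (fun w => bump w ^ 2)]
    _ = _ := by
        rw [← Finset.mul_sum]
        ring

end MeanSquare

/-- The Dirichlet polynomial `ξ ↦ ∑ bᵢ νᵢ^{-2πiξ}`. -/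
noncomputable def dirichletPoly (I : Finset ι) (b : ι → ℂ) (ν : ι → ℕ) (ξ : ℝ) : ℂ :=
  ∑ i ∈ I, b i * Complex.exp ((-(2 * π * ξ * Real.log (ν i)) : ℝ) * Complex.I)

theorem continuous_dirichletPoly (I : Finset ι) (b : ι → ℂ) (ν : ι → ℕ) :
    Continuous (dirichletPoly I b ν) := by
  unfold dirichletPoly
  fun_prop

theorem norm_dirichletPoly_le (I : Finset ι) (b : ι → ℂ) (ν : ι → ℕ) (ξ : ℝ) :
    ‖dirichletPoly I b ν ξ‖ ≤ ∑ i ∈ I, ‖b i‖ :=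
  norm_sum_le_of_le _ fun i _ => by rw [norm_mul, Complex.norm_exp_ofReal_mul_I, mul_one]

theorem fourier_translate_schwartzBump (x ξ : ℝ) :
    𝓕 (schwartzBump.compSubConstCLM ℂ x) ξ = bumpHat x ξ := by
  rw [SchwartzMap.fourier_coe, Real.fourier_eq',
    ← integral_add_right_eq_self _ x, bumpHat, SchwartzMap.fourier_coe, Real.fourier_eq',
    ← integral_const_mul]
  refine integral_congr_ae (.of_forall fun w => ?_)
  simp only [SchwartzMap.compSubConstCLM_apply, add_sub_cancel_right, smul_eq_mul]
  rw [← mul_assoc, ← Complex.exp_add]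
  congr 2
  simp
  ring

/- Plancherel: the short sum has Fourier transform `φ̂(ξ) ∑ bᵢ νᵢ^{-2πiTξ}`. -/
theorem integral_norm_shortSum_sq (I : Finset ι) (b : ι → ℂ) (ν : ι → ℕ) (T : ℝ) :
    ∫ w, ‖shortSum I b ν T w‖ ^ 2 =
      ∫ ξ : ℝ, ‖𝓕 schwartzBump ξ‖ ^ 2 * ‖dirichletPoly I b ν (T * ξ)‖ ^ 2 := by
  set f : 𝓢(ℝ, ℂ) := ∑ i ∈ I, b i • schwartzBump.compSubConstCLM ℂ (T * Real.log (ν i)) with hf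
  have hshort (w : ℝ) : f w = shortSum I b ν T w := by
    simp [hf, shortSum, schwartzBump_apply, mul_comm]
  have hfourier (ξ : ℝ) : 𝓕 f ξ = 𝓕 schwartzBump ξ * dirichletPoly I b ν (T * ξ) := by
    simp only [hf, FourierTransform.fourier_sum, FourierTransform.fourier_smul,
      sum_apply, smul_apply, fourier_translate_schwartzBump, bumpHat,
      dirichletPoly, Finset.mul_sum, smul_eq_mul]
    refine Finset.sum_congr rfl fun i _ => ?_
    rw [mul_left_comm, mul_comm (𝓕 schwartzBump ξ), mul_assoc, mul_left_comm]
    ring_nf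
  simpa only [hfourier, hshort, norm_mul, mul_pow] using
    (SchwartzMap.integral_norm_sq_fourier f).symm

theorem integrable_fourier_bump_sq_mul_dirichletPoly_sq (I : Finset ι) (b : ι → ℂ) (ν : ι → ℕ)
    (T : ℝ) :
    Integrable fun ξ : ℝ => ‖𝓕 schwartzBump ξ‖ ^ 2 * ‖dirichletPoly I b ν (T * ξ)‖ ^ 2 := by
  have hsq : Integrable fun ξ : ℝ => ‖𝓕 schwartzBump ξ‖ ^ 2 := by
    simpa using ((𝓕 schwartzBump).memLp 2 (μ := volume)).integrable_norm_pow two_ne_zero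
  have := (𝓕 schwartzBump).continuous
  have := continuous_dirichletPoly I b ν
  refine (hsq.mul_const ((∑ i ∈ I, ‖b i‖) ^ 2)).mono'
    (Continuous.aestronglyMeasurable (by fun_prop)) (.of_forall fun ξ => ?_)
  rw [Real.norm_of_nonneg (by positivity)]
  gcongr
  exact norm_dirichletPoly_le _ _ _ _

theorem exists_forall_abs_le_le_norm_fourier_bump :
    ∃ ξ₀ c : ℝ, 0 < ξ₀ ∧ 0 < c ∧ ∀ ξ, |ξ| ≤ ξ₀ → c ≤ ‖𝓕 schwartzBump ξ‖ ^ 2 := by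
  have hzero : 𝓕 schwartzBump 0 = (∫ u, bump u : ℝ) := by
    rw [SchwartzMap.fourier_coe, Real.fourier_eq', ← integral_complex_ofReal]
    simp [schwartzBump_apply]
  have hpos : 0 < ‖𝓕 schwartzBump 0‖ ^ 2 := by
    rw [hzero, Complex.norm_real, Real.norm_of_nonneg bump.integral_pos.le]
    exact pow_pos bump.integral_pos 2
  have hcont : Continuous fun ξ : ℝ => ‖𝓕 schwartzBump ξ‖ ^ 2 :=
    (𝓕 schwartzBump).continuous.norm.pow 2
  obtain ⟨r, hr, hball⟩ := Metric.eventually_nhds_iff.mp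
    (hcont.continuousAt.eventually_const_lt (half_lt_self hpos))
  refine ⟨r / 2, _, half_pos hr, half_pos hpos, fun ξ hξ => (hball ?_).le⟩
  rw [dist_zero_right, Real.norm_eq_abs]
  linarith

theorem exists_integral_dirichletPoly_sq_le_integral_shortSum_sq : ∃ ξ₀ C : ℝ, 0 < ξ₀ ∧ 0 < C ∧
    ∀ {ι : Type*} (I : Finset ι) (b : ι → ℂ) (ν : ι → ℕ) {T : ℝ}, 0 < T →
      ∫ ξ in (-(T * ξ₀))..(T * ξ₀), ‖dirichletPoly I b ν ξ‖ ^ 2 ≤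
        C * T * ∫ w, ‖shortSum I b ν T w‖ ^ 2 := by
  obtain ⟨ξ₀, c, hξ₀, hc, hlow⟩ := exists_forall_abs_le_le_norm_fourier_bump
  refine ⟨ξ₀, c⁻¹, hξ₀, by positivity, fun I b ν T hT => ?_⟩
  have hcont := continuous_dirichletPoly I b ν
  have hInt := integrable_fourier_bump_sq_mul_dirichletPoly_sq I b ν T
  have h : c * ∫ ξ in (-ξ₀)..ξ₀, ‖dirichletPoly I b ν (T * ξ)‖ ^ 2 ≤
      ∫ w, ‖shortSum I b ν T w‖ ^ 2 := by
    rw [integral_norm_shortSum_sq, ← intervalIntegral.integral_const_mul,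
      intervalIntegral.integral_of_le (by linarith)]
    refine (setIntegral_mono_on (Continuous.integrableOn_Ioc (by fun_prop)) hInt.integrableOn
      measurableSet_Ioc fun ξ hξ => ?_).trans
        (setIntegral_le_integral hInt (.of_forall fun ξ => by positivity))
    gcongr
    exact hlow ξ (abs_le.mpr ⟨hξ.1.le, hξ.2⟩)
  calc ∫ ξ in (-(T * ξ₀))..(T * ξ₀), ‖dirichletPoly I b ν ξ‖ ^ 2
      = c⁻¹ * T * (c * ∫ ξ in (-ξ₀)..ξ₀, ‖dirichletPoly I b ν (T * ξ)‖ ^ 2) := by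
        rw [intervalIntegral.integral_comp_mul_left (fun ξ => ‖dirichletPoly I b ν ξ‖ ^ 2) hT.ne',
          mul_neg, smul_eq_mul]
        field_simp
    _ ≤ _ := by gcongr

theorem exists_integral_dirichletPoly_sq_le : ∃ C : ℝ, 0 < C ∧
    ∀ {ι : Type*} {I : Finset ι} (b : ι → ℂ) {ν : ι → ℕ} {N R : ℕ},
      (∀ i ∈ I, 1 ≤ ν i ∧ ν i ≤ N) → (∀ l, {i ∈ I | ν i = l}.card ≤ R) → ∀ {X : ℝ}, 0 < X →
        ∫ ξ in (-X)..X, ‖dirichletPoly I b ν ξ‖ ^ 2 ≤ C * R * (X + N) * ∑ i ∈ I, ‖b i‖ ^ 2 := by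
  obtain ⟨ξ₀, C, hξ₀, hC, hle⟩ := exists_integral_dirichletPoly_sq_le_integral_shortSum_sq
  set J := ∫ w, bump w ^ 2
  have : 0 ≤ J := integral_nonneg fun w => sq_nonneg _
  refine ⟨C * (J + 1) * (ξ₀⁻¹ + 4), by positivity, fun {ι I} b {ν N R} hν hR X hX => ?_⟩
  have hT : 0 < X / ξ₀ := by positivity
  have hlin : X / ξ₀ + 4 * N ≤ (ξ₀⁻¹ + 4) * (X + N) := by
    rw [div_eq_inv_mul, add_mul, mul_add, mul_add]
    linarith [show 0 ≤ ξ₀⁻¹ * N + 4 * X by positivity]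
  calc ∫ ξ in (-X)..X, ‖dirichletPoly I b ν ξ‖ ^ 2
      ≤ C * (X / ξ₀) * ∫ w, ‖shortSum I b ν (X / ξ₀) w‖ ^ 2 := by
        simpa only [div_mul_cancel₀ _ hξ₀.ne'] using hle I b ν hT
    _ ≤ C * (X / ξ₀) * (J * R * (1 + 4 * N / (X / ξ₀)) * ∑ i ∈ I, ‖b i‖ ^ 2) := by
        gcongr
        exact integral_norm_shortSum_sq_le hν hR hT b
    _ = C * J * R * (X / ξ₀ + 4 * N) * ∑ i ∈ I, ‖b i‖ ^ 2 := by field_simp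
    _ ≤ C * (J + 1) * R * ((ξ₀⁻¹ + 4) * (X + N)) * ∑ i ∈ I, ‖b i‖ ^ 2 := by
        gcongr
        linarith
    _ = _ := by ring

theorem norm_sq_mul_norm_sq_le_indicator_add {a d : ℂ} {M W Z : ℝ} (ha : ‖a‖ ≤ M) (hd : ‖d‖ ≤ W)
    (hZ : 0 < Z) (j : ℕ) (ξ : ℝ) :
    ‖a‖ ^ 2 * ‖d‖ ^ 2 ≤ (Set.Ioc (-Z) Z).indicator (fun _ => M ^ 2 * ‖d‖ ^ 2) ξ +
      M * W ^ 2 / Z ^ j * (‖ξ‖ ^ j * ‖a‖) := by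
  have hM : 0 ≤ M := (norm_nonneg _).trans ha
  by_cases hξ : ξ ∈ Set.Ioc (-Z) Z
  · rw [Set.indicator_of_mem hξ]
    refine le_add_of_le_of_nonneg (by gcongr) (by positivity)
  · have hZξ : Z ≤ ‖ξ‖ := by
      by_contra! h
      obtain ⟨h₁, h₂⟩ := abs_lt.mp h
      exact hξ ⟨h₁, h₂.le⟩
    rw [Set.indicator_of_notMem hξ, zero_add]
    calc ‖a‖ ^ 2 * ‖d‖ ^ 2 = ‖a‖ * ‖a‖ * ‖d‖ ^ 2 * 1 := by ring
      _ ≤ M * ‖a‖ * W ^ 2 * (‖ξ‖ ^ j / Z ^ j) := by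
          gcongr
          rw [one_le_div (by positivity)]
          gcongr
      _ = _ := by ring

theorem exists_integral_norm_sq_mul_norm_sq_le (φ : 𝓢(ℝ, ℂ)) (j : ℕ) : ∃ C : ℝ, 0 < C ∧
    ∀ {D : ℝ → ℂ} {W Z : ℝ}, Continuous D → (∀ ξ, ‖D ξ‖ ≤ W) → 0 < Z →
      Integrable (fun ξ => ‖φ ξ‖ ^ 2 * ‖D ξ‖ ^ 2) →
        ∫ ξ, ‖φ ξ‖ ^ 2 * ‖D ξ‖ ^ 2 ≤ C * ((∫ ξ in (-Z)..Z, ‖D ξ‖ ^ 2) + W ^ 2 / Z ^ j) := by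
  obtain ⟨M, hM⟩ : ∃ M, ∀ ξ, ‖φ ξ‖ ≤ M := ⟨_, φ.norm_le_seminorm ℝ⟩
  have : 0 ≤ M := (norm_nonneg _).trans (hM 0)
  set Q := ∫ ξ, ‖ξ‖ ^ j * ‖φ ξ‖
  have : 0 ≤ Q := integral_nonneg fun ξ => by positivity
  refine ⟨M ^ 2 + M * Q + 1, by positivity, fun {D W Z} hD hDW hZ hInt => ?_⟩
  have hlocal : Integrable ((Set.Ioc (-Z) Z).indicator fun ξ => M ^ 2 * ‖D ξ‖ ^ 2) :=
    (integrable_indicator_iff measurableSet_Ioc).mpr (Continuous.integrableOn_Ioc (by fun_prop))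
  have htail : Integrable fun ξ => M * W ^ 2 / Z ^ j * (‖ξ‖ ^ j * ‖φ ξ‖) :=
    (φ.integrable_pow_mul volume j).const_mul _
  have : 0 ≤ ∫ ξ in (-Z)..Z, ‖D ξ‖ ^ 2 :=
    intervalIntegral.integral_nonneg (by linarith) fun _ _ => by positivity
  calc ∫ ξ, ‖φ ξ‖ ^ 2 * ‖D ξ‖ ^ 2
      ≤ ∫ ξ, ((Set.Ioc (-Z) Z).indicator (fun ξ => M ^ 2 * ‖D ξ‖ ^ 2) ξ +
          M * W ^ 2 / Z ^ j * (‖ξ‖ ^ j * ‖φ ξ‖)) :=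
        integral_mono hInt (hlocal.add htail) fun ξ =>
          norm_sq_mul_norm_sq_le_indicator_add (hM ξ) (hDW ξ) hZ j ξ
    _ = M ^ 2 * (∫ ξ in (-Z)..Z, ‖D ξ‖ ^ 2) + M * Q * (W ^ 2 / Z ^ j) := by
        rw [integral_add hlocal htail, integral_const_mul, integral_indicator measurableSet_Ioc,
          ← intervalIntegral.integral_of_le (by linarith), intervalIntegral.integral_const_mul]
        ring
    _ ≤ (M ^ 2 + M * Q + 1) * (∫ ξ in (-Z)..Z, ‖D ξ‖ ^ 2) +
          (M ^ 2 + M * Q + 1) * (W ^ 2 / Z ^ j) := by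
        gcongr
        · linarith [show 0 ≤ M * Q by positivity]
        · linarith [sq_nonneg M]
    _ = _ := (mul_add _ _ _).symm

theorem exists_integral_shortSum_sq_le (j : ℕ) : ∃ C : ℝ, 0 < C ∧
    ∀ {ι : Type*} (I : Finset ι) (b : ι → ℂ) (ν : ι → ℕ) {T Z : ℝ}, 0 < T → 0 < Z →
      ∫ w, ‖shortSum I b ν T w‖ ^ 2 ≤
        C * (T⁻¹ * (∫ ξ in (-(T * Z))..(T * Z), ‖dirichletPoly I b ν ξ‖ ^ 2) +
          (∑ i ∈ I, ‖b i‖) ^ 2 / Z ^ j) := by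
  obtain ⟨C, hC, hle⟩ := exists_integral_norm_sq_mul_norm_sq_le (𝓕 schwartzBump) j
  refine ⟨C, hC, fun I b ν T Z hT hZ => ?_⟩
  have h := hle ((continuous_dirichletPoly I b ν).comp (continuous_const_mul T))
    (fun ξ => norm_dirichletPoly_le I b ν _) hZ
    (integrable_fourier_bump_sq_mul_dirichletPoly_sq I b ν T)
  rw [integral_norm_shortSum_sq]
  simpa only [Function.comp_apply, smul_eq_mul, mul_neg,
    intervalIntegral.integral_comp_mul_left (fun ξ => ‖dirichletPoly I b ν ξ‖ ^ 2) hT.ne'] using h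

end MeanValue

section CoprimePoly

theorem exp_neg_log_natCast_mul {n m : ℕ} (hn : n ≠ 0) (hm : m ≠ 0) (ξ : ℝ) :
    Complex.exp ((-(2 * π * ξ * Real.log (n * m : ℕ)) : ℝ) * Complex.I) =
      Complex.exp ((-(2 * π * ξ * Real.log n) : ℝ) * Complex.I) *
      Complex.exp ((-(2 * π * ξ * Real.log m) : ℝ) * Complex.I) := by
  rw [← Complex.exp_add, Nat.cast_mul,
    Real.log_mul (Nat.cast_ne_zero.mpr hn) (Nat.cast_ne_zero.mpr hm)]
  congr 1
  push_cast
  ring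

theorem dirichletPoly_mul_dirichletPoly {ι κ : Type*} {I : Finset ι} {J : Finset κ} {ν : ι → ℕ}
    {μ : κ → ℕ} (hν : ∀ i ∈ I, ν i ≠ 0) (hμ : ∀ j ∈ J, μ j ≠ 0) (b : ι → ℂ) (c : κ → ℂ) (ξ : ℝ) :
    dirichletPoly I b ν ξ * dirichletPoly J c μ ξ =
      dirichletPoly (I ×ˢ J) (fun x => b x.1 * c x.2) (fun x => ν x.1 * μ x.2) ξ := by
  simp only [dirichletPoly, Finset.sum_mul_sum, Finset.sum_product]
  refine Finset.sum_congr rfl fun i hi => Finset.sum_congr rfl fun j hj => ?_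
  rw [mul_mul_mul_comm, exp_neg_log_natCast_mul (hν i hi) (hμ j hj)]

theorem prod_dirichletPoly {ι κ : Type*} [Fintype κ] [DecidableEq κ] {I : κ → Finset ι}
    {ν : κ → ι → ℕ} (hν : ∀ k, ∀ i ∈ I k, ν k i ≠ 0) (b : κ → ι → ℂ) (ξ : ℝ) :
    ∏ k, dirichletPoly (I k) (b k) (ν k) ξ =
      dirichletPoly (Fintype.piFinset I) (fun i => ∏ k, b k (i k)) (fun i => ∏ k, ν k (i k)) ξ := by
  simp only [dirichletPoly, Finset.prod_univ_sum]
  refine Finset.sum_congr rfl fun i hi => ?_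
  rw [Finset.prod_mul_distrib, ← Complex.exp_sum, Nat.cast_prod, Real.log_prod fun k _ =>
    Nat.cast_ne_zero.mpr (hν k _ (Fintype.mem_piFinset.mp hi k))]
  congr 2
  push_cast
  rw [Finset.mul_sum, ← Finset.sum_neg_distrib, Finset.sum_mul]

/-- The part of the Dirichlet polynomial `∑ α n n^(-2πiξ)`, `1 ≤ n ≤ N`, over the multiples of
`g`. -/
noncomputable def dvdPoly (N : ℕ) (α : ℕ → ℂ) (g : ℕ) (ξ : ℝ) : ℂ :=
  dirichletPoly {n ∈ Finset.Icc 1 N | g ∣ n} α id ξ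

theorem continuous_dvdPoly (N : ℕ) (α : ℕ → ℂ) (g : ℕ) : Continuous (dvdPoly N α g) :=
  continuous_dirichletPoly _ _ _

/-- The pairs of coprime positive integers up to `N₁` and `N₂`, over which products of two
Dirichlet polynomials are taken so that `A (n * m) = A n * A m`. -/
def coprimePairs (N₁ N₂ : ℕ) : Finset (ℕ × ℕ) :=
  {x ∈ Finset.Icc 1 N₁ ×ˢ Finset.Icc 1 N₂ | x.1.Coprime x.2}

theorem mem_coprimePairs {N₁ N₂ : ℕ} {x : ℕ × ℕ} : x ∈ coprimePairs N₁ N₂ ↔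
    ((1 ≤ x.1 ∧ x.1 ≤ N₁) ∧ 1 ≤ x.2 ∧ x.2 ≤ N₂) ∧ x.1.Coprime x.2 := by
  simp only [coprimePairs, Finset.mem_filter, Finset.mem_product, Finset.mem_Icc]

theorem mul_mem_Icc_of_mem_coprimePairs {N₁ N₂ : ℕ} {x : ℕ × ℕ} (hx : x ∈ coprimePairs N₁ N₂) :
    x.1 * x.2 ∈ Finset.Icc 1 (N₁ * N₂) := by
  obtain ⟨⟨h₁, h₂⟩, -⟩ := mem_coprimePairs.mp hx
  exact Finset.mem_Icc.mpr ⟨Nat.mul_pos h₁.1 h₂.1, Nat.mul_le_mul h₁.2 h₂.2⟩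

theorem card_coprimePairs_filter_mul_eq_le (N₁ N₂ l : ℕ) :
    {x ∈ coprimePairs N₁ N₂ | x.1 * x.2 = l}.card ≤ l.divisors.card := by
  have hpair {x : ℕ × ℕ} (hx : x ∈ {x ∈ coprimePairs N₁ N₂ | x.1 * x.2 = l}) :
      0 < x.1 ∧ 0 < x.2 ∧ x.1 * x.2 = l := by
    obtain ⟨hx, h⟩ := Finset.mem_filter.mp hx
    obtain ⟨⟨h₁, h₂⟩, -⟩ := mem_coprimePairs.mp hx
    exact ⟨h₁.1, h₂.1, h⟩
  refine Finset.card_le_card_of_injOn Prod.fst (fun x hx => ?_) fun x hx y hy hxy => ?_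
  · obtain ⟨h₁, h₂, rfl⟩ := hpair hx
    exact Nat.mem_divisors.mpr ⟨dvd_mul_right _ _, (Nat.mul_pos h₁ h₂).ne'⟩
  · obtain ⟨h₁, -, hx⟩ := hpair hx
    refine Prod.ext hxy (Nat.eq_of_mul_eq_mul_left h₁ ?_)
    rw [hx, hxy, (hpair hy).2.2]

/-- The product of two Dirichlet polynomials of lengths `N₁` and `N₂`, restricted to coprime
variables. -/
noncomputable def coprimePoly (N₁ N₂ : ℕ) (α β : ℕ → ℂ) (ξ : ℝ) : ℂ :=
  dirichletPoly (coprimePairs N₁ N₂) (fun x => α x.1 * β x.2) (fun x => x.1 * x.2) ξ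

theorem continuous_coprimePoly (N₁ N₂ : ℕ) (α β : ℕ → ℂ) : Continuous (coprimePoly N₁ N₂ α β) :=
  continuous_dirichletPoly _ _ _

theorem sum_moebius_common_divisors {n N : ℕ} (hn : n ∈ Finset.Icc 1 N) (m : ℕ) :
    ∑ g ∈ Finset.Icc 1 N with g ∣ n ∧ g ∣ m, ArithmeticFunction.moebius g =
      if n.Coprime m then 1 else 0 := by
  obtain ⟨hn₁, hnN⟩ := Finset.mem_Icc.mp hn
  have hgcd : n.gcd m ≠ 0 := (Nat.gcd_pos_of_pos_left m hn₁).ne'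
  have hdivisors : {g ∈ Finset.Icc 1 N | g ∣ n ∧ g ∣ m} = (n.gcd m).divisors := by
    ext g
    simp only [Finset.mem_filter, Finset.mem_Icc, Nat.mem_divisors, Nat.dvd_gcd_iff]
    refine ⟨fun h => ⟨h.2, hgcd⟩, fun h => ⟨⟨Nat.pos_of_dvd_of_pos h.1.1 hn₁, ?_⟩, h.1⟩⟩
    exact (Nat.le_of_dvd hn₁ h.1.1).trans hnN
  rw [hdivisors, ← ArithmeticFunction.coe_zeta_mul_apply, ArithmeticFunction.coe_zeta_mul_moebius,
    ArithmeticFunction.one_apply]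

theorem coprimePoly_eq_sum (N₁ N₂ : ℕ) (α β : ℕ → ℂ) (ξ : ℝ) :
    coprimePoly N₁ N₂ α β ξ = ∑ g ∈ Finset.Icc 1 N₁,
      (ArithmeticFunction.moebius g : ℂ) * (dvdPoly N₁ α g ξ * dvdPoly N₂ β g ξ) := by
  have hne (N g : ℕ) : ∀ n ∈ {n ∈ Finset.Icc 1 N | g ∣ n}, id n ≠ 0 := fun n hn =>
    Nat.one_le_iff_ne_zero.mp (Finset.mem_Icc.mp (Finset.mem_filter.mp hn).1).1
  simp_rw [dvdPoly, dirichletPoly_mul_dirichletPoly (hne N₁ _) (hne N₂ _), ← Finset.filter_product,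
    dirichletPoly, Finset.sum_filter, Finset.mul_sum]
  rw [Finset.sum_comm, coprimePoly, dirichletPoly, coprimePairs, Finset.sum_filter]
  refine Finset.sum_congr rfl fun x hx => ?_
  have hmoebius := sum_moebius_common_divisors (Finset.mem_product.mp hx).1 x.2
  simp_rw [mul_ite, mul_zero]
  rw [← Finset.sum_filter, ← Finset.sum_mul, ← Int.cast_sum, hmoebius]
  split_ifs
  · rw [Int.cast_one, one_mul]
    rfl
  · rw [Int.cast_zero, zero_mul]

/-- The sum of `|dvdPoly|²` over all moduli up to `G`; by Cauchy–Schwarz, two such sums control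
`coprimePoly`. -/
noncomputable def dvdSquareSum (G N : ℕ) (α : ℕ → ℂ) (ξ : ℝ) : ℝ :=
  ∑ g ∈ Finset.Icc 1 G, ‖dvdPoly N α g ξ‖ ^ 2

theorem continuous_dvdSquareSum (G N : ℕ) (α : ℕ → ℂ) : Continuous (dvdSquareSum G N α) := by
  unfold dvdSquareSum
  have := continuous_dvdPoly N α
  fun_prop

theorem dvdSquareSum_nonneg (G N : ℕ) (α : ℕ → ℂ) (ξ : ℝ) : 0 ≤ dvdSquareSum G N α ξ :=
  Finset.sum_nonneg fun _ _ => by positivity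

theorem norm_coprimePoly_sq_le (N₁ N₂ : ℕ) (α β : ℕ → ℂ) (ξ : ℝ) :
    ‖coprimePoly N₁ N₂ α β ξ‖ ^ 2 ≤ dvdSquareSum N₁ N₁ α ξ * dvdSquareSum N₁ N₂ β ξ := by
  rw [coprimePoly_eq_sum]
  calc _ ≤ (∑ g ∈ Finset.Icc 1 N₁, ‖dvdPoly N₁ α g ξ‖ * ‖dvdPoly N₂ β g ξ‖) ^ 2 := by
        gcongr
        refine norm_sum_le_of_le _ fun g _ => ?_
        rw [norm_mul, norm_mul, Complex.norm_intCast]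
        refine mul_le_of_le_one_left (by positivity) ?_
        exact_mod_cast ArithmeticFunction.abs_moebius_le_one
    _ ≤ _ := Finset.sum_mul_sq_le_sq_mul_sq _ _ _

theorem sum_sum_dvd_le (G N : ℕ) {f : ℕ → ℝ} (hf : ∀ n, 0 ≤ f n) :
    ∑ g ∈ Finset.Icc 1 G, ∑ n ∈ Finset.Icc 1 N with g ∣ n, f n ≤
      ∑ n ∈ Finset.Icc 1 N, (n.divisors.card : ℝ) * f n := by
  simp_rw [Finset.sum_filter]
  rw [Finset.sum_comm]
  refine Finset.sum_le_sum fun n hn => ?_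
  rw [← Finset.sum_filter, Finset.sum_const, nsmul_eq_mul]
  gcongr
  · exact hf n
  · exact fun g hg => Nat.mem_divisors.mpr ⟨(Finset.mem_filter.mp hg).2,
      Nat.one_le_iff_ne_zero.mp (Finset.mem_Icc.mp hn).1⟩

theorem exists_integral_dvdSquareSum_le : ∃ C : ℝ, 0 < C ∧ ∀ (G N : ℕ) (β : ℕ → ℂ) {X : ℝ}, 0 < X →
    ∫ ξ in (-X)..X, dvdSquareSum G N β ξ ≤
      C * (X + N) * ∑ n ∈ Finset.Icc 1 N, (n.divisors.card : ℝ) * ‖β n‖ ^ 2 := by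
  obtain ⟨C, hC, hmean⟩ := exists_integral_dirichletPoly_sq_le
  refine ⟨C, hC, fun G N β X hX => ?_⟩
  unfold dvdSquareSum
  rw [intervalIntegral.integral_finsetSum fun g _ =>
    ((continuous_dvdPoly N β g).norm.fun_pow 2).intervalIntegrable _ _]
  calc _ ≤ ∑ g ∈ Finset.Icc 1 G, C * (1 : ℕ) * (X + N) *
        ∑ n ∈ Finset.Icc 1 N with g ∣ n, ‖β n‖ ^ 2 := by
        refine Finset.sum_le_sum fun g _ => hmean _ ?_ (fun l => ?_) hX
        · exact fun n hn => Finset.mem_Icc.mp (Finset.mem_filter.mp hn).1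
        · exact Finset.card_le_one.mpr fun a ha b hb =>
            (Finset.mem_filter.mp ha).2.trans (Finset.mem_filter.mp hb).2.symm
    _ = C * (X + N) * ∑ g ∈ Finset.Icc 1 G, ∑ n ∈ Finset.Icc 1 N with g ∣ n, ‖β n‖ ^ 2 := by
        rw [Nat.cast_one, mul_one, Finset.mul_sum]
    _ ≤ _ := by
        gcongr
        exact sum_sum_dvd_le G N fun n => by positivity

theorem prod_mem_Icc_pow {k N : ℕ} {n : Fin k → ℕ} (hn : ∀ i, n i ∈ Finset.Icc 1 N) :
    ∏ i, n i ∈ Finset.Icc 1 (N ^ k) := by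
  simp only [Finset.mem_Icc] at hn ⊢
  refine ⟨Finset.one_le_prod' fun i _ => (hn i).1, ?_⟩
  calc ∏ i, n i ≤ ∏ _i : Fin k, N := Finset.prod_le_prod' fun i _ => (hn i).2
    _ = N ^ k := by simp

theorem card_filter_prod_eq_le {k N R : ℕ} {I : Finset (Fin k → ℕ)}
    (hI : ∀ n ∈ I, ∀ i, n i ∈ Finset.Icc 1 N)
    (hR : ∀ l, 1 ≤ l → l ≤ N ^ k → l.divisors.card ^ k ≤ R) (l : ℕ) :
    {n ∈ I | ∏ i, n i = l}.card ≤ R := by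
  by_cases hl : l ∈ Finset.Icc 1 (N ^ k)
  · obtain ⟨hl₁, hlN⟩ := Finset.mem_Icc.mp hl
    calc _ ≤ (Fintype.piFinset fun _ : Fin k => l.divisors).card := by
          refine Finset.card_le_card fun n hn => Fintype.mem_piFinset.mpr fun i =>
            Nat.mem_divisors.mpr ⟨?_, Nat.one_le_iff_ne_zero.mp hl₁⟩
          rw [← (Finset.mem_filter.mp hn).2]
          exact Finset.dvd_prod_of_mem _ (Finset.mem_univ i)
      _ = l.divisors.card ^ k := by simp
      _ ≤ R := hR l hl₁ hlN
  · have hempty : {n ∈ I | ∏ i, n i = l} = ∅ := Finset.filter_eq_empty_iff.mpr fun n hn h =>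
      hl (h ▸ prod_mem_Icc_pow (hI n hn))
    simp [hempty]

theorem dvdSquareSum_pow (G N k : ℕ) (α : ℕ → ℂ) (ξ : ℝ) :
    dvdSquareSum G N α ξ ^ k = ∑ g ∈ Fintype.piFinset fun _ : Fin k => Finset.Icc 1 G,
      ‖dirichletPoly (Fintype.piFinset fun i => {n ∈ Finset.Icc 1 N | g i ∣ n})
        (fun n => ∏ i, α (n i)) (fun n => ∏ i, n i) ξ‖ ^ 2 := by
  rw [dvdSquareSum, Finset.sum_pow']
  refine Finset.sum_congr rfl fun g _ => ?_
  have hne : ∀ i, ∀ n ∈ {n ∈ Finset.Icc 1 N | g i ∣ n}, id n ≠ 0 := fun i n hn =>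
    Nat.one_le_iff_ne_zero.mp (Finset.mem_Icc.mp (Finset.mem_filter.mp hn).1).1
  rw [Finset.prod_pow, ← norm_prod]
  exact congrArg (‖·‖ ^ 2) (prod_dirichletPoly hne (fun _ => α) ξ)

theorem exists_integral_dvdSquareSum_pow_le : ∃ C : ℝ, 0 < C ∧ ∀ (G : ℕ) {N k R : ℕ} (α : ℕ → ℂ),
    (∀ l, 1 ≤ l → l ≤ N ^ k → l.divisors.card ^ k ≤ R) → ∀ {X : ℝ}, 0 < X →
    ∫ ξ in (-X)..X, dvdSquareSum G N α ξ ^ k ≤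
      C * R * (X + N ^ k) * (∑ n ∈ Finset.Icc 1 N, (n.divisors.card : ℝ) * ‖α n‖ ^ 2) ^ k := by
  obtain ⟨C, hC, hmean⟩ := exists_integral_dirichletPoly_sq_le
  refine ⟨C, hC, fun G N k R α hR X hX => ?_⟩
  simp_rw [dvdSquareSum_pow]
  rw [intervalIntegral.integral_finsetSum fun g _ =>
    ((continuous_dirichletPoly _ _ _).norm.fun_pow 2).intervalIntegrable _ _]
  calc _ ≤ ∑ g ∈ Fintype.piFinset fun _ : Fin k => Finset.Icc 1 G, C * R * (X + (N ^ k : ℕ)) *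
        ∑ n ∈ Fintype.piFinset fun i => {n ∈ Finset.Icc 1 N | g i ∣ n}, ‖∏ i, α (n i)‖ ^ 2 := by
        refine Finset.sum_le_sum fun g _ => ?_
        have hI : ∀ n ∈ Fintype.piFinset fun i => {n ∈ Finset.Icc 1 N | g i ∣ n},
            ∀ i, n i ∈ Finset.Icc 1 N := fun n hn i =>
          (Finset.mem_filter.mp (Fintype.mem_piFinset.mp hn i)).1
        exact hmean _ (fun n hn => Finset.mem_Icc.mp (prod_mem_Icc_pow (hI n hn)))
          (card_filter_prod_eq_le hI hR) hX
    _ = C * R * (X + N ^ k) *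
        (∑ g ∈ Finset.Icc 1 G, ∑ n ∈ Finset.Icc 1 N with g ∣ n, ‖α n‖ ^ 2) ^ k := by
        rw [← Finset.mul_sum, Finset.sum_pow', Nat.cast_pow]
        simp_rw [Finset.prod_univ_sum, norm_prod, Finset.prod_pow]
    _ ≤ _ := by
        gcongr
        exact sum_sum_dvd_le G N fun n => by positivity

/- Where the first factor of the Cauchy–Schwarz bound is at most `Λ` it is replaced by `Λ`; on the
exceptional set the pointwise bound `B` is paired with a high moment of that factor. -/
theorem norm_coprimePoly_sq_le_add {N₁ N₂ : ℕ} {α β : ℕ → ℂ} {ξ Λ B : ℝ} (hΛ : 0 < Λ)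
    (hB : ‖coprimePoly N₁ N₂ α β ξ‖ ≤ B) (k : ℕ) :
    ‖coprimePoly N₁ N₂ α β ξ‖ ^ 2 ≤
      Λ * dvdSquareSum N₁ N₂ β ξ + B ^ 2 / Λ ^ k * dvdSquareSum N₁ N₁ α ξ ^ k := by
  have hα := dvdSquareSum_nonneg N₁ N₁ α ξ
  have hβ := dvdSquareSum_nonneg N₁ N₂ β ξ
  rcases le_total (dvdSquareSum N₁ N₁ α ξ) Λ with h | h
  · calc _ ≤ dvdSquareSum N₁ N₁ α ξ * dvdSquareSum N₁ N₂ β ξ := norm_coprimePoly_sq_le _ _ _ _ _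
      _ ≤ Λ * dvdSquareSum N₁ N₂ β ξ := by gcongr
      _ ≤ _ := le_add_of_nonneg_right (by positivity)
  · calc _ ≤ B ^ 2 := by gcongr
      _ ≤ B ^ 2 * (dvdSquareSum N₁ N₁ α ξ / Λ) ^ k :=
          le_mul_of_one_le_right (by positivity) (one_le_pow₀ ((one_le_div hΛ).mpr h))
      _ = B ^ 2 / Λ ^ k * dvdSquareSum N₁ N₁ α ξ ^ k := by rw [div_pow]; ring
      _ ≤ _ := le_add_of_nonneg_left (by positivity)

theorem exists_integral_coprimePoly_sq_le_add : ∃ C : ℝ, 0 < C ∧ ∀ {N₁ N₂ k R : ℕ} {α β : ℕ → ℂ},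
    (∀ l, 1 ≤ l → l ≤ N₁ ^ k → l.divisors.card ^ k ≤ R) →
    ∀ {X Λ B : ℝ}, 0 < X → 0 < Λ →
    (∀ ξ : ℝ, |ξ| ≤ X → ‖coprimePoly N₁ N₂ α β ξ‖ ≤ B) →
    ∫ ξ in (-X)..X, ‖coprimePoly N₁ N₂ α β ξ‖ ^ 2 ≤
      C * (Λ * (X + N₂) * (∑ m ∈ Finset.Icc 1 N₂, (m.divisors.card : ℝ) * ‖β m‖ ^ 2) +
        B ^ 2 / Λ ^ k * R * (X + N₁ ^ k) *
          (∑ n ∈ Finset.Icc 1 N₁, (n.divisors.card : ℝ) * ‖α n‖ ^ 2) ^ k) := by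
  obtain ⟨C₁, hC₁, hmean⟩ := exists_integral_dvdSquareSum_le
  obtain ⟨C₂, hC₂, hmoment⟩ := exists_integral_dvdSquareSum_pow_le
  refine ⟨C₁ + C₂, add_pos hC₁ hC₂, fun {N₁ N₂ k R α β} hR {X Λ B} hX hΛ hB => ?_⟩
  have hcα := continuous_dvdSquareSum N₁ N₁ α
  have hcβ := continuous_dvdSquareSum N₁ N₂ β
  set Sβ := ∑ m ∈ Finset.Icc 1 N₂, (m.divisors.card : ℝ) * ‖β m‖ ^ 2
  set Sα := ∑ n ∈ Finset.Icc 1 N₁, (n.divisors.card : ℝ) * ‖α n‖ ^ 2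
  have : 0 ≤ Sβ := Finset.sum_nonneg fun _ _ => by positivity
  have : 0 ≤ Sα := Finset.sum_nonneg fun _ _ => by positivity
  calc _ ≤ ∫ ξ in (-X)..X, (Λ * dvdSquareSum N₁ N₂ β ξ +
        B ^ 2 / Λ ^ k * dvdSquareSum N₁ N₁ α ξ ^ k) :=
        intervalIntegral.integral_mono_on (by linarith)
          (((continuous_coprimePoly _ _ _ _).norm.fun_pow 2).intervalIntegrable _ _)
          (Continuous.intervalIntegrable (by fun_prop) _ _)
          fun ξ hξ => norm_coprimePoly_sq_le_add hΛ (hB ξ (abs_le.mpr hξ)) k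
    _ = Λ * (∫ ξ in (-X)..X, dvdSquareSum N₁ N₂ β ξ) +
        B ^ 2 / Λ ^ k * ∫ ξ in (-X)..X, dvdSquareSum N₁ N₁ α ξ ^ k := by
        rw [intervalIntegral.integral_add, intervalIntegral.integral_const_mul,
          intervalIntegral.integral_const_mul] <;>
        exact Continuous.intervalIntegrable (by fun_prop) _ _
    _ ≤ Λ * ((C₁ + C₂) * (X + N₂) * Sβ) +
        B ^ 2 / Λ ^ k * ((C₁ + C₂) * R * (X + N₁ ^ k) * Sα ^ k) := by
        gcongr
        · refine (hmean N₁ N₂ β hX).trans ?_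
          gcongr
          exact le_add_of_nonneg_right hC₂.le
        · refine (hmoment N₁ α hR hX).trans ?_
          gcongr
          exact le_add_of_nonneg_left hC₁.le
    _ = _ := by ring

end CoprimePoly

section SignChanges

/-- `m` is a sign change of `a`: the last nonzero term before `a m` has the opposite sign. This is
the condition counted by `signChanges`. -/
def IsSignChange (a : ℕ → ℝ) (m : ℕ) : Prop :=
  ∃ n : ℕ, 1 ≤ n ∧ n < m ∧ a n * a m < 0 ∧ ∀ j : ℕ, n < j → j < m → a j = 0

open Classical in
theorem signChanges_eq_card (a : ℕ → ℝ) (X : ℝ) :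
    signChanges a X = {m ∈ Finset.Icc 1 ⌊X⌋₊ | IsSignChange a m}.card :=
  rfl

theorem exists_isSignChange_of_mul_neg {a : ℕ → ℝ} {m n : ℕ} (hm : 1 ≤ m) (hmn : m < n)
    (h : a m * a n < 0) : ∃ l ∈ Set.Ioc m n, IsSignChange a l := by
  induction hd : n - m using Nat.strong_induction_on generalizing m n with
  | _ d ih =>
    by_cases hzero : ∀ j, m < j → j < n → a j = 0
    · exact ⟨n, ⟨hmn, le_rfl⟩, m, hm, hmn, h, hzero⟩
    push Not at hzero
    obtain ⟨j, hmj, hjn, hj⟩ := hzero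
    have hor : a m * a j < 0 ∨ a j * a n < 0 := by
      by_contra! hcon
      nlinarith [mul_nonneg hcon.1 hcon.2, mul_neg_of_neg_of_pos h (pow_pos (abs_pos.mpr hj) 2),
        sq_abs (a j)]
    rcases hor with hneg | hneg
    · obtain ⟨l, hl, hsign⟩ := ih _ (by omega) hm hmj hneg rfl
      exact ⟨l, ⟨hl.1, hl.2.trans hjn.le⟩, hsign⟩
    · obtain ⟨l, hl, hsign⟩ := ih _ (by omega) (hm.trans hmj.le) hjn hneg rfl
      exact ⟨l, ⟨hmj.trans hl.1, hl.2⟩, hsign⟩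

theorem mul_nonneg_of_forall_isSignChange_two_le {a : ℕ → ℝ} {N : ℕ} {T w : ℝ} (hT : 0 < T)
    (hw : ∀ l ≤ N, IsSignChange a l → 2 ≤ |w - T * Real.log l|) {m n : ℕ}
    (hm : m ∈ Finset.Icc 1 N) (hn : n ∈ Finset.Icc 1 N) (hmw : |w - T * Real.log m| < 2)
    (hnw : |w - T * Real.log n| < 2) : 0 ≤ a m * a n := by
  wlog hmn : m ≤ n generalizing m n
  · rw [mul_comm]
    exact this hn hm hnw hmw (by omega)
  obtain ⟨hm₁, -⟩ := Finset.mem_Icc.mp hm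
  rcases hmn.eq_or_lt with rfl | hmn
  · exact mul_self_nonneg _
  by_contra! hneg
  obtain ⟨l, ⟨hml, hln⟩, hl⟩ := exists_isSignChange_of_mul_neg hm₁ hmn hneg
  have hlog₁ : T * Real.log m ≤ T * Real.log l := by gcongr
  have hlog₂ : T * Real.log l ≤ T * Real.log n := by
    have : 0 < l := by omega
    gcongr
  have hlw := hw l (hln.trans (Finset.mem_Icc.mp hn).2) hl
  rw [abs_lt] at hmw hnw
  exact absurd hlw (not_le.mpr (abs_lt.mpr ⟨by linarith, by linarith⟩))

theorem abs_sum_eq_sum_abs_of_mul_nonneg {ι : Type*} {I : Finset ι} {x : ι → ℝ}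
    (hx : ∀ i ∈ I, ∀ j ∈ I, 0 ≤ x i * x j) : |∑ i ∈ I, x i| = ∑ i ∈ I, |x i| := by
  rw [← sq_eq_sq₀ (abs_nonneg _) (Finset.sum_nonneg fun _ _ => abs_nonneg _), sq_abs, sq, sq,
    Finset.sum_mul_sum, Finset.sum_mul_sum]
  refine Finset.sum_congr rfl fun i hi => Finset.sum_congr rfl fun j hj => ?_
  rw [← abs_mul, abs_of_nonneg (hx i hi j hj)]

theorem sq_setIntegral_le {Ω : Type*} [MeasurableSpace Ω] {μ : Measure Ω} {s : Set Ω} {f : Ω → ℝ}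
    (hs : μ s ≠ ⊤) (hf : IntegrableOn f s μ) (hf₂ : IntegrableOn (fun x => f x ^ 2) s μ) :
    (∫ x in s, f x ∂μ) ^ 2 ≤ μ.real s * ∫ x in s, f x ^ 2 ∂μ := by
  by_cases hs₀ : μ s = 0
  · simp [Measure.restrict_eq_zero.mpr hs₀]
  have hpos : 0 < μ.real s := ENNReal.toReal_pos hs₀ hs
  have hjensen := (even_two.convexOn_pow (𝕜 := ℝ)).map_set_average_le
    (continuous_pow 2).continuousOn isClosed_univ hs₀ hs (by simp) hf hf₂
  simp only [setAverage_eq, smul_eq_mul] at hjensen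
  calc (∫ x in s, f x ∂μ) ^ 2 = μ.real s ^ 2 * ((μ.real s)⁻¹ * ∫ x in s, f x ∂μ) ^ 2 := by
        field_simp
    _ ≤ μ.real s ^ 2 * ((μ.real s)⁻¹ * ∫ x in s, f x ^ 2 ∂μ) := by gcongr
    _ = μ.real s * ∫ x in s, f x ^ 2 ∂μ := by field_simp

variable {ι : Type*} {a : ℕ → ℝ} {I : Finset ι} {ν : ι → ℕ} {p : ι → ℝ} {T : ℝ}

theorem abs_shortSum_eq_of_forall_isSignChange_two_le {N : ℕ} {w : ℝ} (hT : 0 < T)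
    (hp : ∀ i ∈ I, 0 ≤ p i) (hν : ∀ i ∈ I, ν i ∈ Finset.Icc 1 N)
    (hw : ∀ l ≤ N, IsSignChange a l → 2 ≤ |w - T * Real.log l|) :
    |shortSum I (fun i => a (ν i) * p i) ν T w| = shortSum I (fun i => |a (ν i) * p i|) ν T w := by
  have hbump (u : ℝ) : 0 ≤ bump u := bump.nonneg
  simp only [shortSum, smul_eq_mul]
  rw [abs_sum_eq_sum_abs_of_mul_nonneg fun i hi j hj => ?_]
  · exact Finset.sum_congr rfl fun i _ => by rw [abs_mul, abs_of_nonneg (hbump _)]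
  by_cases hi₀ : bump (w - T * Real.log (ν i)) = 0
  · simp [hi₀]
  by_cases hj₀ : bump (w - T * Real.log (ν j)) = 0
  · simp [hj₀]
  have hsame : 0 ≤ a (ν i) * a (ν j) := mul_nonneg_of_forall_isSignChange_two_le hT hw (hν i hi)
    (hν j hj) (abs_lt_two_of_bump_ne_zero hi₀) (abs_lt_two_of_bump_ne_zero hj₀)
  calc 0 ≤ bump (w - T * Real.log (ν i)) * bump (w - T * Real.log (ν j)) *
        (p i * p j) * (a (ν i) * a (ν j)) :=
        mul_nonneg (mul_nonneg (mul_nonneg (hbump _) (hbump _)) (mul_nonneg (hp i hi) (hp j hj)))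
          hsame
    _ = _ := by ring

theorem shortSum_eq_zero_of_notMem_Icc {X w : ℝ} (hT : 0 < T)
    (hν : ∀ i ∈ I, ν i ∈ Finset.Icc 1 ⌊X⌋₊) (hw : w ∉ Set.Icc (-2) (T * Real.log X + 2))
    (b : ι → ℝ) : shortSum I b ν T w = 0 := by
  refine Finset.sum_eq_zero fun i hi => ?_
  obtain ⟨hi₁, hiX⟩ := Finset.mem_Icc.mp (hν i hi)
  have hlog : 0 ≤ T * Real.log (ν i) := mul_nonneg hT.le (Real.log_natCast_nonneg _)
  have hlogX : T * Real.log (ν i) ≤ T * Real.log X := by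
    gcongr
    exact (Nat.le_floor_iff' (Nat.one_le_iff_ne_zero.mp hi₁)).mp hiX
  by_cases hbump : bump (w - T * Real.log (ν i)) = 0
  · rw [hbump, zero_smul]
  · have hclose := abs_lt.mp (abs_lt_two_of_bump_ne_zero hbump)
    exact absurd ⟨by linarith [hclose.1], by linarith [hclose.2]⟩ hw

theorem sq_setIntegral_abs_shortSum_le {s : Set ℝ} {V : ℝ} (hV : 0 ≤ V)
    (hs : volume s ≤ ENNReal.ofReal V) (b : ι → ℝ) :
    (∫ w in s, |shortSum I b ν T w|) ^ 2 ≤ V * ∫ w, shortSum I b ν T w ^ 2 := by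
  have hInt : Integrable fun w => |shortSum I b ν T w| ^ 2 := integrable_norm_shortSum_sq I b ν T
  refine (sq_setIntegral_le (hs.trans_lt ENNReal.ofReal_lt_top).ne
    (integrable_shortSum I b ν T).abs.integrableOn hInt.integrableOn).trans ?_
  simp_rw [sq_abs] at hInt ⊢
  have hnonneg (w : ℝ) : 0 ≤ shortSum I b ν T w ^ 2 := sq_nonneg _
  exact mul_le_mul (ENNReal.toReal_le_of_le_ofReal hV hs)
    (setIntegral_le_integral hInt (.of_forall hnonneg)) (integral_nonneg hnonneg) hV

/-- The set of `w` within distance `2` of `T log m` for some sign change `m ≤ N` of `a`. -/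
def signChangeWindows (a : ℕ → ℝ) (N : ℕ) (T : ℝ) : Set ℝ :=
  ⋃ m ∈ {m ∈ Set.Icc 1 N | IsSignChange a m}, Metric.closedBall (T * Real.log m) 2

theorem two_le_abs_of_notMem_signChangeWindows {N : ℕ} {w : ℝ} (hw : w ∉ signChangeWindows a N T) :
    ∀ l ≤ N, IsSignChange a l → 2 ≤ |w - T * Real.log l| := by
  intro l hlN hl
  have hl₁ : 1 ≤ l := by
    obtain ⟨n, -, hnl, -⟩ := hl
    omega
  by_contra! hlt
  exact hw (Set.mem_biUnion ⟨⟨hl₁, hlN⟩, hl⟩ (Metric.mem_closedBall.mpr hlt.le))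

theorem measurableSet_signChangeWindows (a : ℕ → ℝ) (N : ℕ) (T : ℝ) :
    MeasurableSet (signChangeWindows a N T) :=
  .biUnion (Set.to_countable _) fun _ _ => measurableSet_closedBall

theorem volume_signChangeWindows_le (a : ℕ → ℝ) (X T : ℝ) :
    volume (signChangeWindows a ⌊X⌋₊ T) ≤ ENNReal.ofReal (4 * signChanges a X) := by
  classical
  have hset : {m ∈ Set.Icc 1 ⌊X⌋₊ | IsSignChange a m} =
      ({m ∈ Finset.Icc 1 ⌊X⌋₊ | IsSignChange a m} : Finset ℕ) := by
    ext
    simp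
  rw [signChangeWindows, hset, signChanges_eq_card]
  refine (measure_biUnion_finset_le _ _).trans_eq ?_
  simp only [Real.volume_closedBall, Finset.sum_const, nsmul_eq_mul]
  rw [← ENNReal.ofReal_natCast, ← ENNReal.ofReal_mul (by positivity)]
  exact congrArg ENNReal.ofReal (by ring)

theorem sq_setIntegral_signChangeWindows_shortSum_le (X : ℝ) {b : ι → ℝ} (hb : ∀ i, 0 ≤ b i) :
    (∫ w in signChangeWindows a ⌊X⌋₊ T, shortSum I b ν T w) ^ 2 ≤
      4 * signChanges a X * ∫ w, shortSum I b ν T w ^ 2 := by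
  have hnonneg (w : ℝ) : 0 ≤ shortSum I b ν T w :=
    Finset.sum_nonneg fun i _ => mul_nonneg bump.nonneg (hb i)
  calc _ = (∫ w in signChangeWindows a ⌊X⌋₊ T, |shortSum I b ν T w|) ^ 2 := by
        simp only [abs_of_nonneg (hnonneg _)]
    _ ≤ _ := sq_setIntegral_abs_shortSum_le (by positivity) (volume_signChangeWindows_le a X T) b

theorem sq_setIntegral_compl_signChangeWindows_shortSum_le {X : ℝ} (hX : 1 ≤ X) (hT : 0 < T)
    (hp : ∀ i ∈ I, 0 ≤ p i) (hν : ∀ i ∈ I, ν i ∈ Finset.Icc 1 ⌊X⌋₊) :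
    (∫ w in (signChangeWindows a ⌊X⌋₊ T)ᶜ, shortSum I (fun i => |a (ν i) * p i|) ν T w) ^ 2 ≤
      (T * Real.log X + 4) * ∫ w, shortSum I (fun i => a (ν i) * p i) ν T w ^ 2 := by
  set E := signChangeWindows a ⌊X⌋₊ T
  set K := Set.Icc (-2) (T * Real.log X + 2)
  have hE : MeasurableSet E := measurableSet_signChangeWindows _ _ _
  have hlog : 0 ≤ T * Real.log X := mul_nonneg hT.le (Real.log_nonneg hX)
  have hvol : volume (K \ E) ≤ ENNReal.ofReal (T * Real.log X + 4) := by
    refine (measure_mono Set.sdiff_subset).trans_eq ?_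
    rw [Real.volume_Icc]
    exact congrArg ENNReal.ofReal (by ring)
  rw [setIntegral_eq_of_subset_of_forall_sdiff_eq_zero hE.compl (Set.sdiff_subset_compl K E)
      fun w hw => shortSum_eq_zero_of_notMem_Icc hT hν (fun hK => hw.2 ⟨hK, hw.1⟩) _,
    setIntegral_congr_fun (measurableSet_Icc.diff hE) fun w hw =>
      (abs_shortSum_eq_of_forall_isSignChange_two_le hT hp hν
        (two_le_abs_of_notMem_signChangeWindows hw.2)).symm]
  exact sq_setIntegral_abs_shortSum_le (by positivity) hvol _

/- Away from the sign changes the short sum of the `a (ν i) * p i` agrees up to sign with that of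
their absolute values; near them the mass of the latter is controlled by its second moment. -/
theorem sq_integral_shortSum_abs_le {X : ℝ} (hX : 1 ≤ X) (hT : 0 < T) (hp : ∀ i ∈ I, 0 ≤ p i)
    (hν : ∀ i ∈ I, ν i ∈ Finset.Icc 1 ⌊X⌋₊) :
    (∫ w, shortSum I (fun i => |a (ν i) * p i|) ν T w) ^ 2 ≤
      8 * signChanges a X * (∫ w, shortSum I (fun i => |a (ν i) * p i|) ν T w ^ 2) +
      2 * (T * Real.log X + 4) * ∫ w, shortSum I (fun i => a (ν i) * p i) ν T w ^ 2 := by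
  rw [← integral_add_compl (measurableSet_signChangeWindows a ⌊X⌋₊ T) (integrable_shortSum _ _ _ _)]
  refine add_sq_le.trans ?_
  have hnear := sq_setIntegral_signChangeWindows_shortSum_le (a := a) (I := I) (ν := ν) (T := T) X
    (b := fun i => |a (ν i) * p i|) fun i => abs_nonneg _
  linarith [sq_setIntegral_compl_signChangeWindows_shortSum_le hX hT hp hν (a := a)]

end SignChanges

section SiftedSmoothed

/-- A smooth weight, assembled from logarithmic windows, that is at least `1` up to `e^J`
and supported on `m < e^(J + 2)`. -/
noncomputable def cutoff (J m : ℕ) : ℝ := ∑ j ∈ Finset.range (J + 1), bump (Real.log m - j)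

theorem cutoff_nonneg (J m : ℕ) : 0 ≤ cutoff J m := Finset.sum_nonneg fun _ _ => bump.nonneg

theorem cutoff_le (J m : ℕ) : cutoff J m ≤ J + 1 :=
  (Finset.sum_le_card_nsmul _ _ 1 fun _ _ => bump.le_one).trans_eq (by simp)

theorem one_le_cutoff {J m : ℕ} (hm : 1 ≤ m) (hmJ : (m : ℝ) ≤ Real.exp J) : 1 ≤ cutoff J m := by
  have hlog : 0 ≤ Real.log m := Real.log_nonneg (by exact_mod_cast hm)
  have hlogJ : Real.log m ≤ J := (Real.log_le_iff_le_exp (by exact_mod_cast hm)).mpr hmJ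
  have hone : bump (Real.log m - ⌊Real.log m⌋₊) = 1 :=
    bump_eq_one (abs_le.mpr ⟨by linarith [Nat.floor_le hlog],
      by linarith [Nat.lt_floor_add_one (Real.log m)]⟩)
  rw [← hone]
  exact Finset.single_le_sum (f := fun j : ℕ => bump (Real.log m - j)) (fun _ _ => bump.nonneg)
    (Finset.mem_range_succ_iff.mpr (Nat.floor_le_of_le hlogJ))

/-- The restriction of `f` to the integers divisible by no element of `S`, used for the short
variable of a coprime product. -/
def sifted (S : Finset ℕ) (f : ℕ → ℝ) (n : ℕ) : ℝ :=
  if ∀ q ∈ S, ¬ q ∣ n then f n else 0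

/-- The smooth truncation of `f` at `e^J`, used for the long variable of a coprime product. -/
noncomputable def smoothed (J : ℕ) (f : ℕ → ℝ) (m : ℕ) : ℝ := f m * cutoff J m

theorem abs_sifted_le (S : Finset ℕ) (f : ℕ → ℝ) (n : ℕ) : |sifted S f n| ≤ |f n| := by
  rw [sifted]
  split_ifs
  · rfl
  · simp

theorem abs_smoothed_le (J : ℕ) (f : ℕ → ℝ) (m : ℕ) : |smoothed J f m| ≤ (J + 1) * |f m| := by
  rw [smoothed, abs_mul, abs_of_nonneg (cutoff_nonneg J m), mul_comm]
  exact mul_le_mul_of_nonneg_right (cutoff_le J m) (abs_nonneg _)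

theorem abs_le_abs_smoothed {J m : ℕ} (f : ℕ → ℝ) (hm : 1 ≤ m) (hmJ : (m : ℝ) ≤ Real.exp J) :
    |f m| ≤ |smoothed J f m| := by
  rw [smoothed, abs_mul, abs_of_nonneg (cutoff_nonneg J m)]
  exact le_mul_of_one_le_right (abs_nonneg _) (one_le_cutoff hm hmJ)

/-- The twist `f(m) m^{-2πiξ}` of an arithmetic function. -/
noncomputable def twist (f : ℕ → ℝ) (ξ : ℝ) (m : ℕ) : ℂ :=
  f m * Complex.exp ((-(2 * π * ξ * Real.log m) : ℝ) * Complex.I)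

theorem norm_twist (f : ℕ → ℝ) (ξ : ℝ) (m : ℕ) : ‖twist f ξ m‖ = |f m| := by
  rw [twist, norm_mul, Complex.norm_exp_ofReal_mul_I, mul_one, Complex.norm_real, Real.norm_eq_abs]

theorem isCoprimeMultiplicative_twist {f : ℕ → ℝ} (hf : IsCoprimeMultiplicative f) (ξ : ℝ) :
    IsCoprimeMultiplicative (twist f ξ) where
  map_one := by simp [twist, hf.map_one]
  map_mul_of_coprime {m n} h := by
    rcases eq_or_ne m 0 with rfl | hm
    · simp [twist, (Nat.coprime_zero_left n).mp h, hf.map_one]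
    rcases eq_or_ne n 0 with rfl | hn
    · simp [twist, (Nat.coprime_zero_right m).mp h, hf.map_one]
    simp only [twist, hf.map_mul_of_coprime h, exp_neg_log_natCast_mul hm hn, Complex.ofReal_mul]
    ring

theorem twist_scaledCoeff (A : ℕ → ℝ) (σ ξ : ℝ) {m : ℕ} (hm : m ≠ 0) :
    twist (scaledCoeff A σ) ξ m =
      LSeries.term (fun m => (A m : ℂ)) (σ + 2 * π * ξ * Complex.I) m := by
  have hm' : (m : ℂ) ≠ 0 := Nat.cast_ne_zero.mpr hm
  rw [LSeries.term_of_ne_zero hm, div_eq_mul_inv, ← Complex.cpow_neg, neg_add,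
    Complex.cpow_add _ _ hm', twist, scaledCoeff, Complex.ofReal_mul,
    Complex.ofReal_cpow (by positivity),
    Complex.cpow_def_of_ne_zero hm' (-(2 * π * ξ * Complex.I)), ← Complex.natCast_log]
  push_cast
  ring_nf

section CoprimeProducts

variable {f : ℕ → ℝ} {p₀ N₁ N₂ J : ℕ}

theorem sum_coprimePairs {E : Type*} [AddCommMonoid E] (N₁ N₂ : ℕ) (g : ℕ × ℕ → E) :
    ∑ x ∈ coprimePairs N₁ N₂, g x =
      ∑ n ∈ Finset.Icc 1 N₁, ∑ m ∈ sievedRange n.primeFactors N₂, g (n, m) := by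
  rw [coprimePairs, Finset.sum_filter, Finset.sum_product]
  refine Finset.sum_congr rfl fun n hn => ?_
  rw [sievedRange_primeFactors (Nat.one_le_iff_ne_zero.mp (Finset.mem_Icc.mp hn).1),
    Finset.sum_filter]

theorem coprimePoly_eq_sum_smoothSum (S : Finset ℕ) (f : ℕ → ℝ) (N₁ N₂ J : ℕ) (ξ : ℝ) :
    coprimePoly N₁ N₂ (fun n => (sifted S f n : ℂ)) (fun m => (smoothed J f m : ℂ)) ξ =
      ∑ n ∈ Finset.Icc 1 N₁, twist (sifted S f) ξ n *
        ∑ j ∈ Finset.range (J + 1), smoothSum (twist f ξ) n.primeFactors N₂ j := by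
  rw [coprimePoly, dirichletPoly, sum_coprimePairs]
  refine Finset.sum_congr rfl fun n hn => ?_
  simp only [smoothSum]
  rw [Finset.sum_comm, Finset.mul_sum]
  refine Finset.sum_congr rfl fun m hm => ?_
  rw [exp_neg_log_natCast_mul (Nat.one_le_iff_ne_zero.mp (Finset.mem_Icc.mp hn).1)
      (Nat.one_le_iff_ne_zero.mp (mem_sievedRange.mp hm).1.1),
    ← Finset.mul_sum, smoothed, cutoff, twist, twist]
  push_cast
  ring

theorem le_of_mem_primeFactors {n p : ℕ} (hn : ∀ q ∈ p₀.primesBelow, ¬ q ∣ n)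
    (hp : p ∈ n.primeFactors) : p₀ ≤ p := by
  by_contra! hlt
  exact hn p (Nat.mem_primesBelow.mpr ⟨hlt, Nat.prime_of_mem_primeFactors hp⟩)
    (Nat.dvd_of_mem_primeFactors hp)

theorem norm_sum_smoothSum_twist_le (hf : IsCoprimeMultiplicative f)
    (htail : ∀ p : ℕ, p.Prime → p₀ ≤ p → ∀ K, ∑ k ∈ Finset.Ico 1 K, |f (p ^ k)| ≤ 1 / 2)
    (hJ : Real.exp (J + 2) ≤ N₂) {ξ B : ℝ}
    (hB : ∀ x : ℝ, Real.exp (x + 2) ≤ N₂ → ‖smoothSum (twist f ξ) ∅ N₂ x‖ ≤ B) {n : ℕ}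
    (hn0 : n ≠ 0) (hn : ∀ q ∈ p₀.primesBelow, ¬ q ∣ n) :
    ‖∑ j ∈ Finset.range (J + 1), smoothSum (twist f ξ) n.primeFactors N₂ j‖ ≤
      (J + 1) * (n.divisors.card * B) := by
  have hB0 : 0 ≤ B := (norm_nonneg _).trans (hB J hJ)
  have hwindow : ∀ j ∈ Finset.range (J + 1),
      ‖smoothSum (twist f ξ) n.primeFactors N₂ j‖ ≤ n.divisors.card * B := by
    intro j hj
    have hjJ : (j : ℝ) ≤ J := by exact_mod_cast Finset.mem_range_succ_iff.mp hj
    refine (norm_smoothSum_le_two_pow (isCoprimeMultiplicative_twist hf ξ) hB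
      (fun _ => Nat.prime_of_mem_primeFactors) (fun p hp K => ?_)
      ((Real.exp_le_exp.mpr (by linarith)).trans hJ)).trans ?_
    · simpa only [norm_twist] using
        htail p (Nat.prime_of_mem_primeFactors hp) (le_of_mem_primeFactors hn hp) K
    · gcongr
      exact_mod_cast two_pow_card_primeFactors_le_card_divisors hn0
  exact (norm_sum_le_of_le _ hwindow).trans_eq (by simp)

theorem norm_coprimePoly_le (hf : IsCoprimeMultiplicative f)
    (htail : ∀ p : ℕ, p.Prime → p₀ ≤ p → ∀ K, ∑ k ∈ Finset.Ico 1 K, |f (p ^ k)| ≤ 1 / 2)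
    (hJ : Real.exp (J + 2) ≤ N₂) {ξ B : ℝ}
    (hB : ∀ x : ℝ, Real.exp (x + 2) ≤ N₂ → ‖smoothSum (twist f ξ) ∅ N₂ x‖ ≤ B) :
    ‖coprimePoly N₁ N₂ (fun n => (sifted p₀.primesBelow f n : ℂ))
        (fun m => (smoothed J f m : ℂ)) ξ‖ ≤
      (∑ n ∈ Finset.Icc 1 N₁, (n.divisors.card : ℝ) * |sifted p₀.primesBelow f n|) *
        ((J + 1) * B) := by
  rw [coprimePoly_eq_sum_smoothSum, Finset.sum_mul]
  refine norm_sum_le_of_le _ fun n hn => ?_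
  rw [norm_mul, norm_twist]
  by_cases hsift : ∀ q ∈ p₀.primesBelow, ¬ q ∣ n
  · calc _ ≤ |sifted p₀.primesBelow f n| * ((J + 1) * (n.divisors.card * B)) := by
          gcongr
          exact norm_sum_smoothSum_twist_le hf htail hJ hB
            (Nat.one_le_iff_ne_zero.mp (Finset.mem_Icc.mp hn).1) hsift
      _ = _ := by ring
  · simp [sifted, if_neg hsift]

theorem sum_abs_Icc_le_card_divisors_mul (hf : IsCoprimeMultiplicative f)
    (htail : ∀ p : ℕ, p.Prime → p₀ ≤ p → ∀ K, ∑ k ∈ Finset.Ico 1 K, |f (p ^ k)| ≤ 1 / 2)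
    {n : ℕ} (hn0 : n ≠ 0) (hn : ∀ q ∈ p₀.primesBelow, ¬ q ∣ n) (M : ℕ) :
    ∑ m ∈ Finset.Icc 1 M, |f m| ≤
      n.divisors.card * ∑ m ∈ sievedRange n.primeFactors M, |f m| := by
  have hlocal : ∀ p ∈ n.primeFactors, ∀ K, ∑ k ∈ Finset.range K, |f (p ^ k)| ≤ 2 := by
    intro p hp K
    rcases K.eq_zero_or_pos with rfl | hK
    · simp
    rw [← Finset.sum_range_add_sum_Ico _ (show 1 ≤ K from hK), Finset.sum_range_one, pow_zero,
      hf.map_one, abs_one]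
    linarith [htail p (Nat.prime_of_mem_primeFactors hp) (le_of_mem_primeFactors hn hp) K]
  refine (sum_norm_Icc_le_pow_mul_sievedRange hf (fun _ => Nat.prime_of_mem_primeFactors)
    hlocal M).trans (mul_le_mul_of_nonneg_right ?_ (Finset.sum_nonneg fun _ _ => norm_nonneg _))
  exact_mod_cast two_pow_card_primeFactors_le_card_divisors hn0

theorem sum_abs_sievedRange_le_smoothed (f : ℕ → ℝ) (S : Finset ℕ) (hJ : Real.exp J ≤ N₂) :
    ∑ m ∈ sievedRange S ⌊Real.exp J⌋₊, |f m| ≤ ∑ m ∈ sievedRange S N₂, |smoothed J f m| := by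
  have hle {m : ℕ} (hm : m ∈ sievedRange S ⌊Real.exp J⌋₊) : (m : ℝ) ≤ Real.exp J :=
    (Nat.le_floor_iff (Real.exp_pos _).le).mp (mem_sievedRange.mp hm).1.2
  have hsub : sievedRange S ⌊Real.exp J⌋₊ ⊆ sievedRange S N₂ := fun m hm =>
    mem_sievedRange.mpr ⟨⟨(mem_sievedRange.mp hm).1.1, by exact_mod_cast (hle hm).trans hJ⟩,
      (mem_sievedRange.mp hm).2⟩
  calc ∑ m ∈ sievedRange S ⌊Real.exp J⌋₊, |f m|
      ≤ ∑ m ∈ sievedRange S ⌊Real.exp J⌋₊, |smoothed J f m| := by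
        exact Finset.sum_le_sum fun m hm =>
          abs_le_abs_smoothed f (mem_sievedRange.mp hm).1.1 (hle hm)
    _ ≤ _ := Finset.sum_le_sum_of_subset_of_nonneg hsub fun _ _ _ => abs_nonneg _

theorem sum_sievedRange_mul_sum_le (hf : IsCoprimeMultiplicative f)
    (htail : ∀ p : ℕ, p.Prime → p₀ ≤ p → ∀ K, ∑ k ∈ Finset.Ico 1 K, |f (p ^ k)| ≤ 1 / 2)
    {D : ℝ} (hD : ∀ n ∈ Finset.Icc 1 N₁, (n.divisors.card : ℝ) ≤ D) (hJ : Real.exp J ≤ N₂) :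
    (∑ n ∈ sievedRange p₀.primesBelow N₁, |f n|) * ∑ m ∈ Finset.Icc 1 ⌊Real.exp J⌋₊, |f m| ≤
      D * ∑ x ∈ coprimePairs N₁ N₂, |sifted p₀.primesBelow f x.1 * smoothed J f x.2| := by
  have hsub : sievedRange p₀.primesBelow N₁ ⊆ Finset.Icc 1 N₁ := Finset.filter_subset _ _
  rw [sum_coprimePairs, Finset.sum_mul, Finset.mul_sum _ _ D]
  refine (Finset.sum_le_sum fun n hn => ?_).trans
    (Finset.sum_le_sum_of_subset_of_nonneg hsub fun n hn _ =>
      mul_nonneg ((Nat.cast_nonneg _).trans (hD n hn)) (Finset.sum_nonneg fun _ _ => abs_nonneg _))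
  have hn0 : n ≠ 0 := Nat.one_le_iff_ne_zero.mp (mem_sievedRange.mp hn).1.1
  have hsift := (mem_sievedRange.mp hn).2
  have : 0 ≤ ∑ m ∈ sievedRange n.primeFactors N₂, |smoothed J f m| :=
    Finset.sum_nonneg fun _ _ => abs_nonneg _
  calc |f n| * ∑ m ∈ Finset.Icc 1 ⌊Real.exp J⌋₊, |f m|
      ≤ |f n| * (n.divisors.card * ∑ m ∈ sievedRange n.primeFactors N₂, |smoothed J f m|) := by
        gcongr
        refine (sum_abs_Icc_le_card_divisors_mul hf htail hn0 hsift _).trans ?_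
        gcongr
        exact sum_abs_sievedRange_le_smoothed f _ hJ
    _ ≤ |f n| * (D * ∑ m ∈ sievedRange n.primeFactors N₂, |smoothed J f m|) := by
        gcongr
        exact hD n (hsub hn)
    _ = _ := by
        simp only [sifted, if_pos hsift, abs_mul, ← Finset.mul_sum]
        ring

theorem sum_abs_mul_sum_abs_le (hf : IsCoprimeMultiplicative f) {Z D : ℝ}
    (hZ : ∀ p : ℕ, p.Prime → ∀ K, ∑ k ∈ Finset.range K, |f (p ^ k)| ≤ Z)
    (htail : ∀ p : ℕ, p.Prime → p₀ ≤ p → ∀ K, ∑ k ∈ Finset.Ico 1 K, |f (p ^ k)| ≤ 1 / 2)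
    (hD : ∀ n ∈ Finset.Icc 1 N₁, (n.divisors.card : ℝ) ≤ D) (hJ : Real.exp J ≤ N₂) :
    (∑ n ∈ Finset.Icc 1 N₁, |f n|) * ∑ m ∈ Finset.Icc 1 ⌊Real.exp J⌋₊, |f m| ≤
      Z ^ p₀.primesBelow.card * (D *
        ∑ x ∈ coprimePairs N₁ N₂, |sifted p₀.primesBelow f x.1 * smoothed J f x.2|) := by
  have : 0 ≤ Z := by simpa using hZ 2 Nat.prime_two 0
  have hshort : ∑ n ∈ Finset.Icc 1 N₁, |f n| ≤
      Z ^ p₀.primesBelow.card * ∑ n ∈ sievedRange p₀.primesBelow N₁, |f n| :=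
    sum_norm_Icc_le_pow_mul_sievedRange hf (fun _ => Nat.prime_of_mem_primesBelow)
      (fun p hp => hZ p (Nat.prime_of_mem_primesBelow hp)) N₁
  refine (mul_le_mul_of_nonneg_right hshort (Finset.sum_nonneg fun _ _ => abs_nonneg _)).trans ?_
  rw [mul_assoc]
  exact mul_le_mul_of_nonneg_left (sum_sievedRange_mul_sum_le hf htail hD hJ) (by positivity)

end CoprimeProducts

end SiftedSmoothed

section Lengths

/-- The length `X^δ` of the short variable. -/
noncomputable def shortLength (δ X : ℝ) : ℕ := ⌊X ^ δ⌋₊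

/-- The index `J` at which the long variable is smoothly truncated, so that `e^J ≍ X^(1-δ)`. -/
noncomputable def cutIndex (δ X : ℝ) : ℕ := ⌊(1 - δ) * Real.log X⌋₊

/-- The length of the long variable: it covers the support of `cutoff (cutIndex δ X)`. -/
noncomputable def longLength (δ X : ℝ) : ℕ := ⌈Real.exp (cutIndex δ X + 2)⌉₊

variable {δ X : ℝ}

theorem shortLength_le (hX : 0 ≤ X) : (shortLength δ X : ℝ) ≤ X ^ δ := Nat.floor_le (by positivity)

theorem cutIndex_le (hδ0 : 0 ≤ δ) (hδ : δ ≤ 1) (hX : 1 ≤ X) : (cutIndex δ X : ℝ) ≤ Real.log X := by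
  have hlog : 0 ≤ Real.log X := Real.log_nonneg hX
  exact (Nat.floor_le (mul_nonneg (by linarith) hlog)).trans
    (mul_le_of_le_one_left hlog (by linarith))

theorem exp_cutIndex_le (hδ : δ ≤ 1) (hX : 1 ≤ X) : Real.exp (cutIndex δ X) ≤ X ^ (1 - δ) := by
  rw [Real.rpow_def_of_pos (by linarith), mul_comm]
  exact Real.exp_le_exp.mpr (Nat.floor_le (mul_nonneg (by linarith) (Real.log_nonneg hX)))

theorem le_exp_cutIndex (hX : 0 < X) : Real.exp (-1) * X ^ (1 - δ) ≤ Real.exp (cutIndex δ X) := by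
  rw [Real.rpow_def_of_pos hX, mul_comm (Real.log X), ← Real.exp_add]
  refine Real.exp_le_exp.mpr ?_
  have := Nat.lt_floor_add_one ((1 - δ) * Real.log X)
  rw [cutIndex]
  linarith

theorem tendsto_exp_cutIndex (hδ : δ < 1) :
    Tendsto (fun X => Real.exp (cutIndex δ X)) atTop atTop :=
  tendsto_atTop_mono' _ ((eventually_gt_atTop 0).mono fun _ => le_exp_cutIndex)
    ((tendsto_rpow_atTop (sub_pos.mpr hδ)).const_mul_atTop (Real.exp_pos _))

theorem exp_cutIndex_add_two_le (δ X : ℝ) : Real.exp (cutIndex δ X + 2) ≤ longLength δ X :=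
  Nat.le_ceil _

theorem exp_cutIndex_le_longLength (δ X : ℝ) : Real.exp (cutIndex δ X) ≤ longLength δ X :=
  (Real.exp_le_exp.mpr (by linarith)).trans (exp_cutIndex_add_two_le δ X)

theorem longLength_le (hδ : δ ≤ 1) (hX : 1 ≤ X) : (longLength δ X : ℝ) ≤ 9 * X ^ (1 - δ) := by
  have hceil : (longLength δ X : ℝ) < Real.exp (cutIndex δ X + 2) + 1 :=
    Nat.ceil_lt_add_one (Real.exp_pos _).le
  have hexp_two : Real.exp 2 ≤ 8 := by
    rw [show (2 : ℝ) = 1 + 1 by norm_num, Real.exp_add]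
    nlinarith [Real.exp_one_lt_d9, Real.exp_pos 1]
  calc (longLength δ X : ℝ) ≤ Real.exp (cutIndex δ X) * Real.exp 2 + 1 := by
        rw [← Real.exp_add]
        exact hceil.le
    _ ≤ X ^ (1 - δ) * 8 + X ^ (1 - δ) := by
        gcongr
        · exact exp_cutIndex_le hδ hX
        · exact Real.one_le_rpow hX (by linarith)
    _ = 9 * X ^ (1 - δ) := by ring

theorem shortLength_mul_longLength_le (hδ : δ ≤ 1) (hX : 1 ≤ X) :
    (shortLength δ X : ℝ) * longLength δ X ≤ 9 * X := by
  have hX0 : 0 < X := by linarith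
  calc (shortLength δ X : ℝ) * longLength δ X ≤ X ^ δ * (9 * X ^ (1 - δ)) := by
        gcongr
        · exact shortLength_le hX0.le
        · exact longLength_le hδ hX
    _ = 9 * (X ^ δ * X ^ (1 - δ)) := by ring
    _ = 9 * X := by rw [← Real.rpow_add hX0, add_sub_cancel, Real.rpow_one]

end Lengths

section PowerBounds

variable {f g : ℝ → ℝ} {a b c : ℝ}

theorem isBigO_rpow_rpow_of_le (h : a ≤ b) :
    (fun X : ℝ => X ^ a) =O[atTop] fun X : ℝ => X ^ b := by
  refine IsBigO.of_norm_eventuallyLE ?_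
  filter_upwards [eventually_ge_atTop 1] with X hX
  rw [Real.norm_of_nonneg (by positivity)]
  exact Real.rpow_le_rpow_of_exponent_le hX h

theorem isBigO_rpow_mul (hf : f =O[atTop] fun X : ℝ => X ^ a)
    (hg : g =O[atTop] fun X : ℝ => X ^ b) (h : a + b ≤ c) :
    (fun X => f X * g X) =O[atTop] fun X : ℝ => X ^ c :=
  (hf.mul_atTop_rpow_of_isBigO_rpow a b (a + b) hg le_rfl).trans (isBigO_rpow_rpow_of_le h)

theorem isBigO_rpow_rpow {r : ℝ} (hr : 0 ≤ r) (hf : f =O[atTop] fun X : ℝ => X ^ a)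
    (h : a * r ≤ b) : (fun X => f X ^ r) =O[atTop] fun X : ℝ => X ^ b := by
  have hpos : ∀ᶠ X : ℝ in atTop, 0 < X := eventually_gt_atTop 0
  refine ((hf.rpow hr (hpos.mono fun X hX => (Real.rpow_pos_of_pos hX a).le)).trans
    (EventuallyEq.isBigO ?_)).trans (isBigO_rpow_rpow_of_le h)
  exact hpos.mono fun X hX => (Real.rpow_mul hX.le a r).symm

theorem const_isBigO_rpow (c : ℝ) (ha : 0 ≤ a) :
    (fun _ : ℝ => c) =O[atTop] fun X : ℝ => X ^ a := by
  refine IsBigO.trans ?_ (isBigO_rpow_rpow_of_le ha)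
  simpa only [Real.rpow_zero] using isBigO_const_const c (one_ne_zero : (1 : ℝ) ≠ 0) atTop

theorem isBigO_rpow_of_le (h : ∀ X : ℝ, 1 ≤ X → 0 ≤ f X ∧ f X ≤ c * X ^ a) :
    f =O[atTop] fun X : ℝ => X ^ a := by
  refine IsBigO.of_bound c ?_
  filter_upwards [eventually_ge_atTop 1] with X hX
  rw [Real.norm_of_nonneg (h X hX).1, Real.norm_of_nonneg (by positivity)]
  exact (h X hX).2

theorem log_isBigO_rpow {η : ℝ} (hη : 0 < η) : Real.log =O[atTop] fun X : ℝ => X ^ η :=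
  (isLittleO_log_rpow_atTop hη).isBigO

theorem cutIndex_isBigO {δ η : ℝ} (hη : 0 < η) (hδ0 : 0 ≤ δ) (hδ : δ ≤ 1) :
    (fun X => (cutIndex δ X : ℝ) + 1) =O[atTop] fun X : ℝ => X ^ η := by
  refine IsBigO.add (IsBigO.trans (IsBigO.of_norm_eventuallyLE ?_) (log_isBigO_rpow hη))
    (const_isBigO_rpow 1 hη.le)
  filter_upwards [eventually_ge_atTop 1] with X hX
  rw [Real.norm_of_nonneg (by positivity)]
  exact cutIndex_le hδ0 hδ hX

end PowerBounds

section Mass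

theorem NonvanishingExponent.exists_le_sum_abs_scaledCoeff {A : ℕ → ℝ} {κ : ℝ}
    (h : NonvanishingExponent A κ) {σ ε : ℝ} (hσ : 0 ≤ σ) (hε : 0 < ε) :
    ∃ c : ℝ, 0 < c ∧ ∀ᶠ y : ℝ in atTop,
      c * y ^ (κ - σ - ε) ≤ ∑ m ∈ Finset.Icc 1 ⌊y⌋₊, |scaledCoeff A σ m| := by
  obtain ⟨c, hc, X₀, hX₀⟩ := h ε hε
  refine ⟨c * (1 / 2) ^ (κ - ε), by positivity, ?_⟩
  filter_upwards [eventually_ge_atTop 2, eventually_ge_atTop (2 * X₀)] with y hy hyX₀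
  have hy0 : 0 < y := by linarith
  have hdyadic := hX₀ (y / 2) (by linarith) (by linarith)
  rw [mul_div_cancel₀ y two_ne_zero] at hdyadic
  calc c * (1 / 2) ^ (κ - ε) * y ^ (κ - σ - ε) = y ^ (-σ) * (c * (y / 2) ^ (κ - ε)) := by
        rw [show κ - σ - ε = -σ + (κ - ε) by ring, Real.rpow_add hy0,
          show y / 2 = 1 / 2 * y by ring, Real.mul_rpow (by norm_num) hy0.le]
        ring
    _ ≤ y ^ (-σ) * ∑ m ∈ Finset.Ioc ⌊y / 2⌋₊ ⌊y⌋₊, |A m| := by gcongr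
    _ ≤ ∑ m ∈ Finset.Ioc ⌊y / 2⌋₊ ⌊y⌋₊, |scaledCoeff A σ m| := by
        rw [Finset.mul_sum]
        refine Finset.sum_le_sum fun m hm => ?_
        obtain ⟨hm0, hmy⟩ := Finset.mem_Ioc.mp hm
        have hmpos : (0 : ℝ) < m := by exact_mod_cast hm0.pos
        rw [scaledCoeff, abs_mul, abs_of_pos (Real.rpow_pos_of_pos hmpos _), mul_comm]
        exact mul_le_mul_of_nonneg_left (Real.rpow_le_rpow_of_nonpos hmpos
          ((Nat.le_floor_iff hy0.le).mp hmy) (neg_nonpos.mpr hσ)) (abs_nonneg _)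
    _ ≤ ∑ m ∈ Finset.Icc 1 ⌊y⌋₊, |scaledCoeff A σ m| := by
        refine Finset.sum_le_sum_of_subset_of_nonneg (fun m hm => ?_) fun _ _ _ => abs_nonneg _
        exact Finset.mem_Icc.mpr ⟨(Finset.mem_Ioc.mp hm).1.pos, (Finset.mem_Ioc.mp hm).2⟩

theorem exists_card_divisors_le_of_mem_Icc_shortLength {η : ℝ} (hη : 0 < η) :
    ∃ C : ℝ, 0 < C ∧ ∀ δ X : ℝ, δ ≤ 1 → 1 ≤ X → ∀ n ∈ Finset.Icc 1 (shortLength δ X),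
      (n.divisors.card : ℝ) ≤ C * X ^ η := by
  obtain ⟨C, hC1, hC⟩ := exists_card_divisors_le_rpow hη
  refine ⟨C, by linarith, fun δ X hδ hX n hn => ?_⟩
  obtain ⟨hn1, hn⟩ := Finset.mem_Icc.mp hn
  refine (hC n (Nat.one_le_iff_ne_zero.mp hn1)).trans ?_
  gcongr
  calc (n : ℝ) ≤ shortLength δ X := by exact_mod_cast hn
    _ ≤ X ^ δ := shortLength_le (by linarith)
    _ ≤ X := Real.rpow_le_self_of_one_le hX hδ

/-- The coprime pairs `(n, m)` with `n ≤ X^δ` and `m ≪ X^(1-δ)`. -/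
noncomputable def lengthPairs (δ X : ℝ) : Finset (ℕ × ℕ) :=
  coprimePairs (shortLength δ X) (longLength δ X)

/-- The coefficient at `(n, m)` of the product of the sifted short sum and the smoothed long sum of
`f`; for `f` multiplicative it is a nonnegative multiple of `f (n * m)`. -/
noncomputable def pairCoeff (f : ℕ → ℝ) (p₀ : ℕ) (δ X : ℝ) (x : ℕ × ℕ) : ℝ :=
  sifted p₀.primesBelow f x.1 * smoothed (cutIndex δ X) f x.2

theorem exists_rpow_le_sum_abs_pairCoeff {f : ℕ → ℝ} (hf : IsCoprimeMultiplicative f) {p₀ : ℕ}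
    {Z : ℝ} (hZ : ∀ p : ℕ, p.Prime → ∀ K, ∑ k ∈ Finset.range K, |f (p ^ k)| ≤ Z)
    (htail : ∀ p : ℕ, p.Prime → p₀ ≤ p → ∀ K, ∑ k ∈ Finset.Ico 1 K, |f (p ^ k)| ≤ 1 / 2)
    {a c η δ : ℝ} (ha : 0 ≤ a) (hc : 0 < c)
    (hsum : ∀ᶠ y : ℝ in atTop, c * y ^ a ≤ ∑ m ∈ Finset.Icc 1 ⌊y⌋₊, |f m|)
    (hη : 0 < η) (hδ0 : 0 < δ) (hδ : δ < 1) :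
    ∃ c' : ℝ, 0 < c' ∧ ∀ᶠ X in atTop, c' * X ^ (a - η) ≤
      ∑ x ∈ lengthPairs δ X, |pairCoeff f p₀ δ X x| := by
  obtain ⟨C, hC0, hC⟩ := exists_card_divisors_le_of_mem_Icc_shortLength hη
  have hZ1 : 1 ≤ Z := by simpa [hf.map_one] using hZ 2 Nat.prime_two 1
  set q := Z ^ p₀.primesBelow.card * C with hq
  have hq0 : 0 < q := by positivity
  refine ⟨c * (c * Real.exp (-1) ^ a) / q, by positivity, ?_⟩
  filter_upwards [eventually_ge_atTop 1, (tendsto_rpow_atTop hδ0).eventually hsum,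
    (tendsto_exp_cutIndex hδ).eventually hsum] with X hX hshort hlong
  have hX0 : 0 < X := by linarith
  have hlong' : c * (Real.exp (-1) * X ^ (1 - δ)) ^ a ≤
      ∑ m ∈ Finset.Icc 1 ⌊Real.exp (cutIndex δ X)⌋₊, |f m| :=
    le_trans (by gcongr; exact le_exp_cutIndex hX0) hlong
  have hprod := (mul_le_mul hshort hlong' (by positivity)
    (Finset.sum_nonneg fun _ _ => abs_nonneg _)).trans
    (sum_abs_mul_sum_abs_le (N₁ := shortLength δ X) hf hZ htail (hC δ X hδ.le hX)
      (exp_cutIndex_le_longLength δ X))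
  change _ ≤ Z ^ p₀.primesBelow.card *
    (C * X ^ η * ∑ x ∈ lengthPairs δ X, |pairCoeff f p₀ δ X x|) at hprod
  set W := ∑ x ∈ lengthPairs δ X, |pairCoeff f p₀ δ X x|
  have hpow : (X ^ δ) ^ a * (X ^ (1 - δ)) ^ a = X ^ (a - η) * X ^ η := by
    rw [← Real.mul_rpow (by positivity) (by positivity), ← Real.rpow_add hX0, add_sub_cancel,
      Real.rpow_one, ← Real.rpow_add hX0, sub_add_cancel]
  rw [div_mul_eq_mul_div, div_le_iff₀ hq0]
  refine le_of_mul_le_mul_right ?_ (Real.rpow_pos_of_pos hX0 η)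
  calc c * (c * Real.exp (-1) ^ a) * X ^ (a - η) * X ^ η
      = c * (X ^ δ) ^ a * (c * (Real.exp (-1) * X ^ (1 - δ)) ^ a) := by
        rw [Real.mul_rpow (Real.exp_pos _).le (by positivity)]
        linear_combination -(c * (c * Real.exp (-1) ^ a)) * hpow
    _ ≤ _ := hprod
    _ = W * q * X ^ η := by rw [hq]; ring

end Mass

section SecondMoments

theorem RankinSelbergBound.exists_sum_divisors_mul_sq_le {A : ℕ → ℝ} (hRS : RankinSelbergBound A)
    {σ : ℝ} (hσ : 1 / 2 < σ) : ∃ K : ℝ, 0 < K ∧ ∀ N : ℕ,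
      ∑ n ∈ Finset.Icc 1 N, ((n.divisors.card : ℝ) * scaledCoeff A σ n) ^ 2 ≤ K := by
  obtain ⟨σ', hσ', hσσ'⟩ := exists_between hσ
  obtain ⟨C, hC1, hC⟩ := exists_card_divisors_le_rpow (sub_pos.mpr hσσ')
  have hsum := hRS.summable_scaledCoeff_sq hσ'
  have : 0 ≤ ∑' n, scaledCoeff A σ' n ^ 2 := tsum_nonneg fun _ => sq_nonneg _
  refine ⟨C ^ 2 * ∑' n, scaledCoeff A σ' n ^ 2 + 1, by positivity, fun N => ?_⟩
  have hterm : ∀ n ∈ Finset.Icc 1 N, ((n.divisors.card : ℝ) * scaledCoeff A σ n) ^ 2 ≤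
      C ^ 2 * scaledCoeff A σ' n ^ 2 := by
    intro n hn
    have hn0 : n ≠ 0 := Nat.one_le_iff_ne_zero.mp (Finset.mem_Icc.mp hn).1
    have hnpos : (0 : ℝ) < n := by exact_mod_cast Nat.pos_of_ne_zero hn0
    have hsplit : (n : ℝ) ^ (σ - σ') * scaledCoeff A σ n = scaledCoeff A σ' n := by
      rw [scaledCoeff, scaledCoeff, mul_left_comm, ← Real.rpow_add hnpos]
      ring_nf
    rw [← hsplit, ← mul_pow, ← mul_assoc, mul_pow, mul_pow _ (scaledCoeff A σ n)]
    gcongr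
    exact hC n hn0
  calc _ ≤ C ^ 2 * ∑ n ∈ Finset.Icc 1 N, scaledCoeff A σ' n ^ 2 := by
        rw [Finset.mul_sum]
        exact Finset.sum_le_sum hterm
    _ ≤ C ^ 2 * ∑' n, scaledCoeff A σ' n ^ 2 := by
        gcongr
        exact hsum.sum_le_tsum _ fun _ _ => sq_nonneg _
    _ ≤ _ := le_add_of_nonneg_right zero_le_one

variable {f g : ℕ → ℝ} {K K' : ℝ} {N : ℕ}

theorem one_le_card_divisors_of_mem_Icc {n : ℕ} (hn : n ∈ Finset.Icc 1 N) :
    (1 : ℝ) ≤ n.divisors.card := by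
  exact_mod_cast Finset.card_pos.mpr
    (Nat.nonempty_divisors.mpr (Nat.one_le_iff_ne_zero.mp (Finset.mem_Icc.mp hn).1))

theorem sum_divisors_mul_norm_sq_le
    (hK : ∑ n ∈ Finset.Icc 1 N, ((n.divisors.card : ℝ) * f n) ^ 2 ≤ K) :
    ∑ n ∈ Finset.Icc 1 N, (n.divisors.card : ℝ) * ‖(f n : ℂ)‖ ^ 2 ≤ K := by
  refine le_trans (Finset.sum_le_sum fun n hn => ?_) hK
  rw [Complex.norm_real, Real.norm_eq_abs, sq_abs, mul_pow]
  exact mul_le_mul_of_nonneg_right (le_self_pow₀ (one_le_card_divisors_of_mem_Icc hn) two_ne_zero)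
    (sq_nonneg _)

theorem sum_sq_le_of_sum_divisors_mul_sq_le
    (hK : ∑ n ∈ Finset.Icc 1 N, ((n.divisors.card : ℝ) * f n) ^ 2 ≤ K) :
    ∑ n ∈ Finset.Icc 1 N, f n ^ 2 ≤ K := by
  refine le_trans (Finset.sum_le_sum fun n hn => ?_) hK
  rw [mul_pow]
  exact le_mul_of_one_le_left (sq_nonneg _) (one_le_pow₀ (one_le_card_divisors_of_mem_Icc hn))

theorem sq_sum_divisors_mul_abs_le
    (hK : ∑ n ∈ Finset.Icc 1 N, ((n.divisors.card : ℝ) * f n) ^ 2 ≤ K) :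
    (∑ n ∈ Finset.Icc 1 N, (n.divisors.card : ℝ) * |f n|) ^ 2 ≤ N * K := by
  refine sq_sum_le_card_mul_sum_sq.trans ?_
  rw [Nat.card_Icc, Nat.add_sub_cancel]
  simp_rw [mul_pow, sq_abs, ← mul_pow]
  exact mul_le_mul_of_nonneg_left hK N.cast_nonneg

theorem sum_divisors_mul_sq_le_of_abs_le {c : ℝ} (hgf : ∀ n, |g n| ≤ c * |f n|)
    (hK : ∑ n ∈ Finset.Icc 1 N, ((n.divisors.card : ℝ) * f n) ^ 2 ≤ K) :
    ∑ n ∈ Finset.Icc 1 N, ((n.divisors.card : ℝ) * g n) ^ 2 ≤ c ^ 2 * K := by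
  refine le_trans ?_ (mul_le_mul_of_nonneg_left hK (sq_nonneg c))
  rw [Finset.mul_sum]
  refine Finset.sum_le_sum fun n _ => ?_
  rw [mul_pow, mul_pow, mul_left_comm, ← sq_abs (g n), ← sq_abs (f n), ← mul_pow c]
  gcongr
  exact hgf n

theorem sum_divisors_mul_sifted_sq_le (S : Finset ℕ)
    (hK : ∑ n ∈ Finset.Icc 1 N, ((n.divisors.card : ℝ) * f n) ^ 2 ≤ K) :
    ∑ n ∈ Finset.Icc 1 N, ((n.divisors.card : ℝ) * sifted S f n) ^ 2 ≤ K := by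
  simpa only [one_pow, one_mul] using
    sum_divisors_mul_sq_le_of_abs_le (fun n => (abs_sifted_le S f n).trans_eq (one_mul _).symm) hK

theorem sum_divisors_mul_smoothed_sq_le (J : ℕ)
    (hK : ∑ n ∈ Finset.Icc 1 N, ((n.divisors.card : ℝ) * f n) ^ 2 ≤ K) :
    ∑ n ∈ Finset.Icc 1 N, ((n.divisors.card : ℝ) * smoothed J f n) ^ 2 ≤ (J + 1) ^ 2 * K :=
  sum_divisors_mul_sq_le_of_abs_le (abs_smoothed_le J f) hK

theorem sum_coprimePairs_mul_sq_le {N₁ N₂ : ℕ} (hf : ∑ n ∈ Finset.Icc 1 N₁, f n ^ 2 ≤ K)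
    (hg : ∑ m ∈ Finset.Icc 1 N₂, g m ^ 2 ≤ K') :
    ∑ x ∈ coprimePairs N₁ N₂, (f x.1 * g x.2) ^ 2 ≤ K * K' := by
  calc ∑ x ∈ coprimePairs N₁ N₂, (f x.1 * g x.2) ^ 2
      ≤ ∑ x ∈ Finset.Icc 1 N₁ ×ˢ Finset.Icc 1 N₂, (f x.1 * g x.2) ^ 2 :=
        Finset.sum_le_sum_of_subset_of_nonneg (Finset.filter_subset _ _) fun _ _ _ => sq_nonneg _
    _ = (∑ n ∈ Finset.Icc 1 N₁, f n ^ 2) * ∑ m ∈ Finset.Icc 1 N₂, g m ^ 2 := by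
        rw [Finset.sum_mul_sum, Finset.sum_product]
        simp_rw [mul_pow]
    _ ≤ K * K' := mul_le_mul hf hg (Finset.sum_nonneg fun _ _ => sq_nonneg _)
        ((Finset.sum_nonneg fun _ _ => sq_nonneg _).trans hf)

end SecondMoments

section MeanSquare

variable {A : ℕ → ℝ} {L : ℂ → ℂ} {θ η σ : ℝ} {p₀ : ℕ}

theorem IsEntireDirichletSeries.exists_norm_coprimePoly_le
    (hL : IsEntireDirichletSeries (fun m => (A m : ℂ)) L) (hA : IsCoprimeMultiplicative A)
    (hθ : 0 ≤ θ) (hLθ : LindelofExponent L θ) (hη : 0 < η) (hσ : 1 / 2 < σ)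
    (htail : ∀ p : ℕ, p.Prime → p₀ ≤ p →
      ∀ K, ∑ k ∈ Finset.Ico 1 K, |scaledCoeff A σ (p ^ k)| ≤ 1 / 2) :
    ∃ C : ℝ, 0 < C ∧ ∀ {N₁ N₂ J : ℕ}, Real.exp (J + 2) ≤ N₂ → ∀ {X ξ : ℝ}, |ξ| ≤ X →
      ‖coprimePoly N₁ N₂ (fun n => (sifted p₀.primesBelow (scaledCoeff A σ) n : ℂ))
        (fun m => (smoothed J (scaledCoeff A σ) m : ℂ)) ξ‖ ≤
      (∑ n ∈ Finset.Icc 1 N₁,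
          (n.divisors.card : ℝ) * |sifted p₀.primesBelow (scaledCoeff A σ) n|) *
        ((J + 1) * (C * (1 + X) ^ (θ + η))) := by
  obtain ⟨C, hC0, hC⟩ := hL.exists_norm_smooth_sum_le hθ hLθ hη
  have hpi := Real.pi_pos
  have hσ0 : 0 < σ := by linarith
  refine ⟨C * (1 + σ + 2 * π) ^ (θ + η), by positivity, fun {N₁ N₂ J} hJ {X ξ} hξ => ?_⟩
  have hX : 0 ≤ X := (abs_nonneg ξ).trans hξ
  refine norm_coprimePoly_le (isCoprimeMultiplicative_scaledCoeff hA σ) htail hJ fun x hx => ?_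
  set s : ℂ := σ + 2 * π * ξ * Complex.I with hs
  have hsX : 1 + ‖s‖ ≤ (1 + σ + 2 * π) * (1 + X) := by
    have hnorm : ‖s‖ ≤ σ + 2 * π * |ξ| := by
      refine (norm_add_le _ _).trans_eq ?_
      simp [abs_of_pos hσ0, abs_of_pos hpi]
    nlinarith [mul_le_mul_of_nonneg_left hξ hpi.le]
  have hsum : smoothSum (twist (scaledCoeff A σ) ξ) ∅ N₂ x =
      ∑ m ∈ Finset.Icc 1 N₂, LSeries.term (fun m => (A m : ℂ)) s m * bump (Real.log m - x) := by
    rw [smoothSum, sievedRange_empty]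
    refine Finset.sum_congr rfl fun m hm => ?_
    rw [twist_scaledCoeff A σ ξ (Nat.one_le_iff_ne_zero.mp (Finset.mem_Icc.mp hm).1)]
  rw [hsum, mul_assoc, ← Real.mul_rpow (by positivity) (by positivity)]
  refine (hC s x N₂ (by simpa [hs] using hσ) hx).trans ?_
  gcongr

theorem IsEntireDirichletSeries.exists_integral_coprimePoly_sq_le
    (hL : IsEntireDirichletSeries (fun m => (A m : ℂ)) L) (hA : IsCoprimeMultiplicative A)
    (hθ : 0 ≤ θ) (hLθ : LindelofExponent L θ) (hRS : RankinSelbergBound A) (hη : 0 < η)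
    (hσ : 1 / 2 < σ) (htail : ∀ p : ℕ, p.Prime → p₀ ≤ p →
      ∀ K, ∑ k ∈ Finset.Ico 1 K, |scaledCoeff A σ (p ^ k)| ≤ 1 / 2) (k : ℕ) :
    ∃ C : ℝ, 0 < C ∧ ∀ {N₁ N₂ J R : ℕ}, Real.exp (J + 2) ≤ N₂ →
      (∀ l, 1 ≤ l → l ≤ N₁ ^ k → l.divisors.card ^ k ≤ R) → ∀ {X Λ : ℝ}, 0 < X → 0 < Λ →
      ∫ ξ in (-X)..X, ‖coprimePoly N₁ N₂
        (fun n => (sifted p₀.primesBelow (scaledCoeff A σ) n : ℂ))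
        (fun m => (smoothed J (scaledCoeff A σ) m : ℂ)) ξ‖ ^ 2 ≤
      C * ((J + 1) ^ 2 * (Λ * (X + N₂) +
        N₁ * ((1 + X) ^ (θ + η)) ^ 2 * (Λ ^ k)⁻¹ * R * (X + N₁ ^ k))) := by
  obtain ⟨K, hK0, hK⟩ := hRS.exists_sum_divisors_mul_sq_le hσ
  obtain ⟨C₁, hC₁, hpoint⟩ := hL.exists_norm_coprimePoly_le hA hθ hLθ hη hσ htail
  obtain ⟨C₂, hC₂, hmean⟩ := exists_integral_coprimePoly_sq_le_add
  refine ⟨C₂ * (K + K * C₁ ^ 2 * K ^ k), by positivity, ?_⟩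
  intro N₁ N₂ J R hJ hR X Λ hX hΛ
  have hsift := sum_divisors_mul_sifted_sq_le p₀.primesBelow (hK N₁)
  refine (hmean hR hX hΛ fun ξ hξ => hpoint hJ hξ).trans ?_
  rw [mul_assoc C₂]
  refine mul_le_mul_of_nonneg_left ?_ hC₂.le
  set M := (1 + X) ^ (θ + η)
  set D := ∑ n ∈ Finset.Icc 1 N₁,
    (n.divisors.card : ℝ) * |sifted p₀.primesBelow (scaledCoeff A σ) n|
  have hlong : Λ * (X + N₂) * ∑ m ∈ Finset.Icc 1 N₂,
      (m.divisors.card : ℝ) * ‖(smoothed J (scaledCoeff A σ) m : ℂ)‖ ^ 2 ≤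
        Λ * (X + N₂) * ((J + 1) ^ 2 * K) := by
    gcongr
    exact sum_divisors_mul_norm_sq_le (sum_divisors_mul_smoothed_sq_le J (hK N₂))
  have hshort : (D * ((J + 1) * (C₁ * M))) ^ 2 / Λ ^ k * R * (X + N₁ ^ k) *
      (∑ n ∈ Finset.Icc 1 N₁,
        (n.divisors.card : ℝ) * ‖(sifted p₀.primesBelow (scaledCoeff A σ) n : ℂ)‖ ^ 2) ^ k ≤
      N₁ * K * ((J + 1) * (C₁ * M)) ^ 2 / Λ ^ k * R * (X + N₁ ^ k) * K ^ k := by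
    rw [mul_pow D]
    gcongr
    · exact sq_sum_divisors_mul_abs_le hsift
    · exact sum_divisors_mul_norm_sq_le hsift
  refine (add_le_add hlong hshort).trans ?_
  set P := (J + 1) ^ 2 * (Λ * (X + N₂)) with hP
  set P' := (J + 1) ^ 2 * (N₁ * M ^ 2 * (Λ ^ k)⁻¹ * R * (X + N₁ ^ k)) with hP'
  have hP0 : 0 ≤ P := by positivity
  have hP'0 : 0 ≤ P' := by positivity
  have hKk : 0 ≤ K * C₁ ^ 2 * K ^ k := by positivity
  calc _ = K * P + K * C₁ ^ 2 * K ^ k * P' := by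
        rw [hP, hP', div_eq_mul_inv]
        ring
    _ ≤ (K + K * C₁ ^ 2 * K ^ k) * (P + P') := by nlinarith
    _ = _ := by
        rw [hP, hP']
        ring

end MeanSquare

section MeanSquareGrowth

theorem exists_card_divisors_pow_le {η : ℝ} (hη : 0 < η) (k : ℕ) :
    ∃ C : ℝ, 0 < C ∧ ∀ {δ X : ℝ}, k * δ ≤ 2 → 1 ≤ X → ∀ l, 1 ≤ l → l ≤ shortLength δ X ^ k →
      (l.divisors.card : ℝ) ^ k ≤ C * X ^ η := by
  obtain ⟨C, hC1, hC⟩ := exists_card_divisors_le_rpow (show 0 < η / (2 * (k + 1)) by positivity)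
  refine ⟨C ^ k, by positivity, fun {δ X} hkδ hX l hl1 hl => ?_⟩
  have hX0 : 0 < X := by linarith
  have hl2 : (l : ℝ) ≤ X ^ (2 : ℝ) := by
    calc (l : ℝ) ≤ (shortLength δ X : ℝ) ^ k := by exact_mod_cast hl
      _ ≤ (X ^ δ) ^ k := by gcongr; exact shortLength_le hX0.le
      _ = X ^ (k * δ) := by rw [mul_comm, Real.rpow_mul hX0.le, Real.rpow_natCast]
      _ ≤ X ^ (2 : ℝ) := Real.rpow_le_rpow_of_exponent_le hX hkδ
  have hexp : 2 * (η / (2 * (k + 1))) * k ≤ η := by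
    rw [show 2 * (η / (2 * ((k : ℝ) + 1))) * k = η * (k / (k + 1)) by field_simp]
    exact mul_le_of_le_one_right hη.le ((div_le_one (by positivity)).mpr (by linarith))
  calc (l.divisors.card : ℝ) ^ k ≤ (C * (X ^ (2 : ℝ)) ^ (η / (2 * (k + 1)))) ^ k := by
        gcongr
        exact (hC l (Nat.one_le_iff_ne_zero.mp hl1)).trans (by gcongr)
    _ = C ^ k * X ^ (2 * (η / (2 * (k + 1))) * k) := by
        rw [mul_pow, ← Real.rpow_mul hX0.le, ← Real.rpow_natCast (X ^ _), ← Real.rpow_mul hX0.le]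
    _ ≤ C ^ k * X ^ η := by gcongr

theorem exists_one_le_natCast_mul_le {δ : ℝ} (hδ : 0 < δ) :
    ∃ k : ℕ, 1 ≤ k * δ ∧ k * δ ≤ 1 + δ := by
  refine ⟨⌈1 / δ⌉₊, (div_le_iff₀ hδ).mp (Nat.le_ceil _), ?_⟩
  calc ⌈1 / δ⌉₊ * δ ≤ (1 / δ + 1) * δ :=
        mul_le_mul_of_nonneg_right (Nat.ceil_lt_add_one (by positivity)).le hδ.le
    _ = 1 + δ := by field_simp

theorem shortLength_isBigO (δ : ℝ) :
    (fun X => (shortLength δ X : ℝ)) =O[atTop] fun X : ℝ => X ^ δ :=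
  isBigO_rpow_of_le (c := 1) fun X hX =>
    ⟨Nat.cast_nonneg _, (shortLength_le (by linarith)).trans_eq (one_mul _).symm⟩

theorem longLength_isBigO {δ : ℝ} (hδ : δ ≤ 1) :
    (fun X => (longLength δ X : ℝ)) =O[atTop] fun X : ℝ => X ^ (1 - δ) :=
  isBigO_rpow_of_le fun _ hX => ⟨Nat.cast_nonneg _, longLength_le hδ hX⟩

variable {δ η θ b c : ℝ}

theorem long_term_isBigO (hδ0 : 0 ≤ δ) (hδ : δ ≤ 1) (hη : 0 < η) (hb : b ≤ 1 - δ)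
    (hc : 1 - 2 * δ ^ 2 + η ≤ c) :
    (fun X : ℝ => ((cutIndex δ X : ℝ) + 1) ^ 2 * (X ^ (δ * (1 - 2 * δ)) * (X ^ b + longLength δ X)))
      =O[atTop] fun X : ℝ => X ^ c := by
  have hJ := cutIndex_isBigO (half_pos hη) hδ0 hδ
  simp_rw [pow_two (_ + (1 : ℝ))]
  exact isBigO_rpow_mul (isBigO_rpow_mul hJ hJ (add_halves η).le)
    (isBigO_rpow_mul (isBigO_refl _ _)
      (IsBigO.add (isBigO_rpow_rpow_of_le hb) (longLength_isBigO hδ)) le_rfl) (by linarith)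

theorem short_term_isBigO (hδ0 : 0 ≤ δ) (hδ : δ ≤ 1 / 2) (hη : 0 < η) (hθ : 0 ≤ θ)
    (hb0 : 0 ≤ b) (hb : b ≤ 1) (hc : 2 * b * (θ + η) + 4 * δ + 2 * η ≤ c) {k : ℕ}
    (hk1 : 1 ≤ k * δ) (hk : k * δ ≤ 1 + δ) {R : ℝ → ℝ} (hR : R =O[atTop] fun X : ℝ => X ^ η) :
    (fun X : ℝ => ((cutIndex δ X : ℝ) + 1) ^ 2 *
      (shortLength δ X * ((1 + X ^ b) ^ (θ + η)) ^ 2 * ((X ^ (δ * (1 - 2 * δ))) ^ k)⁻¹ * R X *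
        (X ^ b + (shortLength δ X : ℝ) ^ k))) =O[atTop] fun X : ℝ => X ^ c := by
  have hJ := cutIndex_isBigO (half_pos hη) hδ0 (by linarith)
  have hL : (fun X : ℝ => (1 + X ^ b) ^ (θ + η)) =O[atTop] fun X : ℝ => X ^ (b * (θ + η)) :=
    isBigO_rpow_rpow (by linarith) (IsBigO.add (const_isBigO_rpow 1 hb0) (isBigO_refl _ _)) le_rfl
  have hΛ : (fun X : ℝ => ((X ^ (δ * (1 - 2 * δ))) ^ k)⁻¹) =O[atTop]
      fun X : ℝ => X ^ (-(1 - 2 * δ)) := by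
    refine IsBigO.trans (EventuallyEq.isBigO ?_)
      (isBigO_rpow_rpow_of_le (a := -(δ * (1 - 2 * δ) * k)) (by nlinarith))
    filter_upwards [eventually_ge_atTop 0] with X hX
    rw [Real.rpow_neg hX, Real.rpow_mul hX _ (k : ℝ), Real.rpow_natCast]
  have hN : (fun X => (shortLength δ X : ℝ) ^ k) =O[atTop] fun X : ℝ => X ^ (1 + δ) := by
    simp_rw [← Real.rpow_natCast]
    exact isBigO_rpow_rpow k.cast_nonneg (shortLength_isBigO δ) (by linarith)
  simp_rw [pow_two (_ + (1 : ℝ)), pow_two (_ ^ (θ + η))]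
  exact isBigO_rpow_mul (isBigO_rpow_mul hJ hJ (add_halves η).le)
    (isBigO_rpow_mul (isBigO_rpow_mul (isBigO_rpow_mul (isBigO_rpow_mul (shortLength_isBigO δ)
      (isBigO_rpow_mul hL hL le_rfl) le_rfl) hΛ le_rfl) hR le_rfl)
      (IsBigO.add (isBigO_rpow_rpow_of_le (by linarith)) hN) le_rfl) (by linarith)

theorem IsEntireDirichletSeries.integral_dirichletPoly_pairCoeff_sq_isBigO {A : ℕ → ℝ} {L : ℂ → ℂ}
    {σ : ℝ} {p₀ : ℕ} (hL : IsEntireDirichletSeries (fun m => (A m : ℂ)) L)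
    (hA : IsCoprimeMultiplicative A) (hθ : 0 ≤ θ) (hLθ : LindelofExponent L θ)
    (hRS : RankinSelbergBound A) (hη : 0 < η) (hσ : 1 / 2 < σ) (htail : ∀ p : ℕ, p.Prime → p₀ ≤ p →
      ∀ K, ∑ k ∈ Finset.Ico 1 K, |scaledCoeff A σ (p ^ k)| ≤ 1 / 2)
    (hδ0 : 0 < δ) (hδ : δ ≤ 1 / 2) (hb0 : 0 ≤ b) (hb : b ≤ 1 - δ)
    (hc : 1 - 2 * δ ^ 2 + η ≤ c) (hc' : 2 * b * (θ + η) + 4 * δ + 2 * η ≤ c) :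
    (fun X : ℝ => ∫ ξ in (-(X ^ b))..(X ^ b),
      ‖dirichletPoly (lengthPairs δ X) (fun x => (pairCoeff (scaledCoeff A σ) p₀ δ X x : ℂ))
        (fun x => x.1 * x.2) ξ‖ ^ 2) =O[atTop] fun X : ℝ => X ^ c := by
  obtain ⟨k, hk1, hk⟩ := exists_one_le_natCast_mul_le hδ0
  obtain ⟨C, -, hC⟩ := hL.exists_integral_coprimePoly_sq_le hA hθ hLθ hRS hη hσ htail k
  obtain ⟨C', hC'0, hC'⟩ := exists_card_divisors_pow_le hη k
  have hR : (fun X : ℝ => (⌊C' * X ^ η⌋₊ : ℝ)) =O[atTop] fun X : ℝ => X ^ η :=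
    isBigO_rpow_of_le fun X hX => ⟨Nat.cast_nonneg _, Nat.floor_le (by positivity)⟩
  refine IsBigO.trans (IsBigO.of_norm_eventuallyLE ?_)
    ((IsBigO.add (long_term_isBigO hδ0.le (by linarith) hη hb hc) (short_term_isBigO hδ0.le hδ hη
      hθ hb0 (by linarith) hc' hk1 hk hR)).const_mul_left C)
  filter_upwards [eventually_ge_atTop 1] with X hX
  have hXb : 0 < X ^ b := by positivity
  rw [Real.norm_of_nonneg
    (intervalIntegral.integral_nonneg (by linarith) fun _ _ => sq_nonneg _), ← mul_add]
  simp_rw [pairCoeff, Complex.ofReal_mul]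
  exact hC (exp_cutIndex_add_two_le δ X)
    (fun l hl1 hl => Nat.le_floor (by exact_mod_cast hC' (by linarith) hX l hl1 hl)) hXb
    (by positivity)

end MeanSquareGrowth

section PairSums

variable {f : ℕ → ℝ} {p₀ : ℕ} {δ X : ℝ} {x : ℕ × ℕ}

theorem mul_mem_Icc_of_mem_lengthPairs (hδ : δ ≤ 1) (hX : 1 ≤ X) (hx : x ∈ lengthPairs δ X) :
    x.1 * x.2 ∈ Finset.Icc 1 ⌊9 * X⌋₊ := by
  obtain ⟨hpos, hle⟩ := Finset.mem_Icc.mp (mul_mem_Icc_of_mem_coprimePairs hx)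
  refine Finset.mem_Icc.mpr ⟨hpos, hle.trans (Nat.le_floor ?_)⟩
  exact_mod_cast shortLength_mul_longLength_le hδ hX

theorem exists_card_lengthPairs_filter_mul_eq_le {η : ℝ} (hη : 0 < η) : ∃ C : ℝ, 0 < C ∧
    ∀ {δ X : ℝ}, δ ≤ 1 → 1 ≤ X → ∀ l,
      ({x ∈ lengthPairs δ X | x.1 * x.2 = l}.card : ℝ) ≤ C * X ^ η := by
  obtain ⟨C, hC1, hC⟩ := exists_card_divisors_le_rpow hη
  refine ⟨C * 9 ^ η, by positivity, fun {δ X} hδ hX l => ?_⟩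
  rcases Finset.eq_empty_or_nonempty {x ∈ lengthPairs δ X | x.1 * x.2 = l} with hempty | ⟨x, hx⟩
  · rw [hempty, Finset.card_empty, Nat.cast_zero]
    positivity
  obtain ⟨hmem, rfl⟩ := Finset.mem_filter.mp hx
  obtain ⟨hpos, hle⟩ := Finset.mem_Icc.mp (mul_mem_Icc_of_mem_lengthPairs hδ hX hmem)
  calc _ ≤ ((x.1 * x.2).divisors.card : ℝ) := by
        exact_mod_cast card_coprimePairs_filter_mul_eq_le _ _ _
    _ ≤ C * ((x.1 * x.2 : ℕ) : ℝ) ^ η := hC _ (Nat.one_le_iff_ne_zero.mp hpos)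
    _ ≤ C * (9 * X) ^ η := by
        gcongr
        exact (Nat.le_floor_iff (by linarith)).mp hle
    _ = C * 9 ^ η * X ^ η := by rw [Real.mul_rpow (by norm_num) (by linarith), mul_assoc]

theorem pairCoeff_one_nonneg (p₀ : ℕ) (δ X : ℝ) (x : ℕ × ℕ) : 0 ≤ pairCoeff 1 p₀ δ X x := by
  refine mul_nonneg ?_ (mul_nonneg zero_le_one (cutoff_nonneg _ _))
  rw [sifted]
  split_ifs
  · exact zero_le_one
  · rfl

theorem pairCoeff_eq_mul_pairCoeff_one (hf : IsCoprimeMultiplicative f) (p₀ : ℕ)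
    (hx : x ∈ lengthPairs δ X) :
    pairCoeff f p₀ δ X x = f (x.1 * x.2) * pairCoeff 1 p₀ δ X x := by
  rw [hf.map_mul_of_coprime (mem_coprimePairs.mp hx).2]
  simp only [pairCoeff, sifted, smoothed, Pi.one_apply]
  split_ifs <;> ring

theorem sq_sum_abs_pairCoeff_le (hf : IsCoprimeMultiplicative f) (p₀ : ℕ) (hδ : δ ≤ 1)
    (hX : 1 ≤ X) {T : ℝ} (hT : 0 < T) :
    ((∫ w, bump w) * ∑ x ∈ lengthPairs δ X, |pairCoeff f p₀ δ X x|) ^ 2 ≤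
      8 * signChanges f (9 * X) * (∫ w, shortSum (lengthPairs δ X) (|pairCoeff f p₀ δ X ·|)
        (fun x => x.1 * x.2) T w ^ 2) +
      2 * (T * Real.log (9 * X) + 4) * ∫ w, shortSum (lengthPairs δ X) (pairCoeff f p₀ δ X)
        (fun x => x.1 * x.2) T w ^ 2 := by
  have hsigned : shortSum (lengthPairs δ X) (fun x => f (x.1 * x.2) * pairCoeff 1 p₀ δ X x)
      (fun x => x.1 * x.2) T =
      shortSum (lengthPairs δ X) (pairCoeff f p₀ δ X) (fun x => x.1 * x.2) T :=
    funext fun w => Finset.sum_congr rfl fun x hx => by rw [pairCoeff_eq_mul_pairCoeff_one hf p₀ hx]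
  have habs : shortSum (lengthPairs δ X) (fun x => |f (x.1 * x.2) * pairCoeff 1 p₀ δ X x|)
      (fun x => x.1 * x.2) T =
      shortSum (lengthPairs δ X) (|pairCoeff f p₀ δ X ·|) (fun x => x.1 * x.2) T :=
    funext fun w => Finset.sum_congr rfl fun x hx => by
      simp only [pairCoeff_eq_mul_pairCoeff_one hf p₀ hx]
  have h := sq_integral_shortSum_abs_le (a := f) (show 1 ≤ 9 * X by linarith) hT
    (fun x _ => pairCoeff_one_nonneg p₀ δ X x)
    fun x hx => mul_mem_Icc_of_mem_lengthPairs hδ hX hx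
  rwa [hsigned, habs, integral_shortSum, smul_eq_mul] at h

theorem sum_pairCoeff_sq_le (p₀ : ℕ) (δ X : ℝ) {K : ℝ}
    (hK : ∀ N : ℕ, ∑ n ∈ Finset.Icc 1 N, ((n.divisors.card : ℝ) * f n) ^ 2 ≤ K) :
    ∑ x ∈ lengthPairs δ X, pairCoeff f p₀ δ X x ^ 2 ≤ K * ((cutIndex δ X + 1) ^ 2 * K) :=
  sum_coprimePairs_mul_sq_le
    (sum_sq_le_of_sum_divisors_mul_sq_le (sum_divisors_mul_sifted_sq_le _ (hK _)))
    (sum_sq_le_of_sum_divisors_mul_sq_le (sum_divisors_mul_smoothed_sq_le _ (hK _)))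

theorem exists_integral_shortSum_abs_pairCoeff_sq_le (f : ℕ → ℝ) {η : ℝ} (hη : 0 < η) :
    ∃ C : ℝ, 0 < C ∧ ∀ (p₀ : ℕ) {δ X T : ℝ}, δ ≤ 1 → 1 ≤ X → 0 < T →
      ∫ w, shortSum (lengthPairs δ X) (|pairCoeff f p₀ δ X ·|) (fun x => x.1 * x.2) T w ^ 2 ≤
        C * (X ^ η * (1 + 36 * X / T) * ∑ x ∈ lengthPairs δ X, pairCoeff f p₀ δ X x ^ 2) := by
  obtain ⟨C, hC0, hC⟩ := exists_card_lengthPairs_filter_mul_eq_le hη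
  set B := ∫ w, bump w ^ 2
  have : 0 ≤ B := integral_nonneg fun _ => sq_nonneg _
  refine ⟨(B + 1) * C, by positivity, fun p₀ {δ X T} hδ hX hT => ?_⟩
  have hsq : 0 ≤ ∑ x ∈ lengthPairs δ X, pairCoeff f p₀ δ X x ^ 2 :=
    Finset.sum_nonneg fun _ _ => sq_nonneg _
  have h := integral_norm_shortSum_sq_le (I := lengthPairs δ X) (ν := fun x => x.1 * x.2)
    (fun x hx => Finset.mem_Icc.mp (mul_mem_Icc_of_mem_lengthPairs hδ hX hx))
    (fun l => Nat.le_floor (hC hδ hX l)) hT (|pairCoeff f p₀ δ X ·|)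
  simp only [Real.norm_eq_abs, sq_abs] at h
  have hN : (⌊9 * X⌋₊ : ℝ) ≤ 9 * X := Nat.floor_le (by linarith)
  have hR : (⌊C * X ^ η⌋₊ : ℝ) ≤ C * X ^ η := Nat.floor_le (by positivity)
  calc _ ≤ B * ⌊C * X ^ η⌋₊ * (1 + 4 * ⌊9 * X⌋₊ / T) *
        ∑ x ∈ lengthPairs δ X, pairCoeff f p₀ δ X x ^ 2 := h
    _ ≤ (B + 1) * (C * X ^ η) * (1 + 4 * (9 * X) / T) *
        ∑ x ∈ lengthPairs δ X, pairCoeff f p₀ δ X x ^ 2 := by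
        refine mul_le_mul_of_nonneg_right ?_ hsq
        gcongr
        exact le_add_of_nonneg_right zero_le_one
    _ = _ := by ring

theorem integral_shortSum_abs_pairCoeff_sq_isBigO (p₀ : ℕ) {K : ℝ}
    (hK : ∀ N : ℕ, ∑ n ∈ Finset.Icc 1 N, ((n.divisors.card : ℝ) * f n) ^ 2 ≤ K)
    {τ η : ℝ} (hδ0 : 0 ≤ δ) (hδ : δ ≤ 1) (hτ : τ ≤ 1) (hη : 0 < η) :
    (fun X : ℝ => ∫ w, shortSum (lengthPairs δ X) (|pairCoeff f p₀ δ X ·|)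
      (fun x => x.1 * x.2) (X ^ τ) w ^ 2) =O[atTop] fun X : ℝ => X ^ (1 - τ + 2 * η) := by
  obtain ⟨C, -, hC⟩ := exists_integral_shortSum_abs_pairCoeff_sq_le f hη
  have hwindow : (fun X : ℝ => 1 + 36 * X / X ^ τ) =O[atTop] fun X : ℝ => X ^ (1 - τ) := by
    refine IsBigO.add (const_isBigO_rpow 1 (by linarith)) (isBigO_rpow_of_le (c := 36) ?_)
    intro X hX
    have hX0 : 0 < X := by linarith
    rw [Real.rpow_sub hX0, Real.rpow_one, mul_div_assoc]
    exact ⟨by positivity, le_rfl⟩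
  have hJ := cutIndex_isBigO (half_pos hη) hδ0 hδ
  have hsq : (fun X => ∑ x ∈ lengthPairs δ X, pairCoeff f p₀ δ X x ^ 2) =O[atTop]
      fun X : ℝ => X ^ η := by
    refine IsBigO.trans (IsBigO.of_norm_le fun X => ?_) ((isBigO_rpow_mul hJ hJ
      (add_halves η).le).const_mul_left (K * K))
    rw [Real.norm_of_nonneg (Finset.sum_nonneg fun _ _ => sq_nonneg _), ← pow_two]
    exact (sum_pairCoeff_sq_le p₀ δ X hK).trans_eq (by ring)
  refine IsBigO.trans (IsBigO.of_norm_eventuallyLE ?_) ((isBigO_rpow_mul (isBigO_rpow_mul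
    (isBigO_refl (fun X : ℝ => X ^ η) atTop) hwindow le_rfl) hsq (by linarith)).const_mul_left C)
  filter_upwards [eventually_ge_atTop 1] with X hX
  rw [Real.norm_of_nonneg (integral_nonneg fun _ => sq_nonneg _)]
  exact hC p₀ hδ hX (by positivity)

end PairSums

section PowerComparison

theorem eventually_le_of_isBigO_rpow {f : ℝ → ℝ} {a b c : ℝ} (hf : f =O[atTop] fun X : ℝ => X ^ a)
    (hab : a < b) (hc : 0 < c) : ∀ᶠ X in atTop, f X ≤ c * X ^ b := by
  obtain ⟨C, hC⟩ := hf.bound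
  filter_upwards [hC, eventually_gt_atTop 0,
    (tendsto_rpow_atTop (sub_pos.mpr hab)).eventually_ge_atTop (C / c)] with X hX hX0 hlarge
  rw [Real.norm_of_nonneg (Real.rpow_nonneg hX0.le a)] at hX
  rw [div_le_iff₀ hc] at hlarge
  calc f X ≤ C * X ^ a := (le_abs_self _).trans hX
    _ ≤ X ^ (b - a) * c * X ^ a := by gcongr
    _ = c * (X ^ (b - a) * X ^ a) := by ring
    _ = c * X ^ b := by rw [← Real.rpow_add hX0, sub_add_cancel]

/- By `exists_integral_shortSum_sq_le` with `Z = X ^ η`, the tail costs only a negative power of `X`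
relative to the square of the mass. -/
theorem eventually_mul_integral_shortSum_sq_le {ι : Type*} {I : ℝ → Finset ι} {b : ℝ → ι → ℝ}
    {ν : ι → ℕ} {g : ℝ → ℝ} {τ η a c d c₀ β : ℝ} (hη : 0 < η)
    (hI : (fun X : ℝ => ∫ ξ in (-(X ^ (τ + η)))..(X ^ (τ + η)),
      ‖dirichletPoly (I X) (fun i => (b X i : ℂ)) ν ξ‖ ^ 2) =O[atTop] fun X : ℝ => X ^ c)
    (hg : g =O[atTop] fun X : ℝ => X ^ d) (hg0 : ∀ᶠ X in atTop, 0 ≤ g X) (hacd : c + d - τ < 2 * a)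
    (hc₀ : 0 < c₀) (hmass : ∀ᶠ X in atTop, c₀ * X ^ a ≤ ∑ i ∈ I X, |b X i|) (hβ : 0 < β) :
    ∀ᶠ X in atTop, g X * ∫ w, shortSum (I X) (b X) ν (X ^ τ) w ^ 2 ≤
      β * (∑ i ∈ I X, |b X i|) ^ 2 := by
  obtain ⟨j, hj⟩ := exists_nat_gt (d / η)
  rw [div_lt_iff₀ hη] at hj
  obtain ⟨C, hC0, hC⟩ := exists_integral_shortSum_sq_le j
  have hmain : (fun X => g X * (X ^ (-τ) * ∫ ξ in (-(X ^ (τ + η)))..(X ^ (τ + η)),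
      ‖dirichletPoly (I X) (fun i => (b X i : ℂ)) ν ξ‖ ^ 2)) =O[atTop]
        fun X : ℝ => X ^ (c + d - τ) :=
    isBigO_rpow_mul hg (isBigO_rpow_mul (isBigO_refl _ _) hI le_rfl) (by linarith)
  have htail : (fun X => g X * X ^ (-(j * η))) =O[atTop] fun X : ℝ => X ^ (d - j * η) :=
    isBigO_rpow_mul hg (isBigO_refl _ _) le_rfl
  filter_upwards [eventually_le_of_isBigO_rpow hmain hacd (c := β * c₀ ^ 2 / (2 * C))
    (by positivity), eventually_le_of_isBigO_rpow htail (sub_neg.mpr hj) (c := β / (2 * C))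
    (by positivity), hg0, hmass, eventually_gt_atTop 0] with X hmain htail hg0 hmass hX
  set W := ∑ i ∈ I X, |b X i| with hW
  set D := ∫ ξ in (-(X ^ (τ + η)))..(X ^ (τ + η)),
    ‖dirichletPoly (I X) (fun i => (b X i : ℂ)) ν ξ‖ ^ 2 with hD
  have hmass_sq : c₀ ^ 2 * X ^ (2 * a) ≤ W ^ 2 := by
    rw [mul_comm 2, Real.rpow_mul hX.le, Real.rpow_two, ← mul_pow]
    gcongr
  have hsplit : ∫ w, shortSum (I X) (b X) ν (X ^ τ) w ^ 2 ≤
      C * (X ^ (-τ) * D + W ^ 2 * X ^ (-(j * η))) := by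
    have h := hC (I X) (fun i => (b X i : ℂ)) ν (Real.rpow_pos_of_pos hX τ)
      (Real.rpow_pos_of_pos hX η)
    simp only [shortSum_ofReal, Complex.norm_real, Real.norm_eq_abs, sq_abs] at h
    rwa [← Real.rpow_add hX, ← hD, ← hW, ← Real.rpow_neg hX.le, ← Real.rpow_mul_natCast hX.le,
      div_eq_mul_inv, mul_comm η, ← Real.rpow_neg hX.le] at h
  rw [Real.rpow_zero, mul_one] at htail
  calc _ ≤ g X * (C * (X ^ (-τ) * D + W ^ 2 * X ^ (-(j * η)))) := by gcongr
    _ = C * (g X * (X ^ (-τ) * D)) + C * W ^ 2 * (g X * X ^ (-(j * η))) := by ring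
    _ ≤ C * (β * c₀ ^ 2 / (2 * C) * X ^ (2 * a)) + C * W ^ 2 * (β / (2 * C)) := by gcongr
    _ = β / 2 * (c₀ ^ 2 * X ^ (2 * a)) + β / 2 * W ^ 2 := by field_simp
    _ ≤ β / 2 * W ^ 2 + β / 2 * W ^ 2 := by gcongr
    _ = _ := by ring

end PowerComparison

section LowerBound

variable {δ τ η : ℝ}

theorem rpow_mul_log_add_isBigO (hτ : 0 ≤ τ) (hη : 0 < η) :
    (fun X : ℝ => X ^ τ * Real.log (9 * X) + 4) =O[atTop] fun X : ℝ => X ^ (τ + η) := by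
  have hlog : (fun X : ℝ => Real.log (9 * X)) =O[atTop] fun X : ℝ => X ^ η := by
    refine ((const_isBigO_rpow (Real.log 9) hη.le).add (log_isBigO_rpow hη)).congr' ?_ .rfl
    filter_upwards [eventually_gt_atTop 0] with X hX
    rw [Real.log_mul (by norm_num) hX.ne']
  exact (isBigO_rpow_mul (isBigO_refl _ _) hlog le_rfl).add (const_isBigO_rpow 4 (by positivity))

theorem exists_rpow_le_signChanges_of_isBigO {f : ℕ → ℝ} (hf : IsCoprimeMultiplicative f) {p₀ : ℕ}
    {K : ℝ} (hK : ∀ N : ℕ, ∑ n ∈ Finset.Icc 1 N, ((n.divisors.card : ℝ) * f n) ^ 2 ≤ K)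
    (hδ0 : 0 ≤ δ) (hδ : δ ≤ 1) (hτ0 : 0 ≤ τ) (hτ : τ ≤ 1) (hη : 0 < η) {a c c₀ : ℝ}
    (hac : c + η < 2 * a) (hc₀ : 0 < c₀)
    (hmass : ∀ᶠ X in atTop, c₀ * X ^ a ≤ ∑ x ∈ lengthPairs δ X, |pairCoeff f p₀ δ X x|)
    (hsigned : (fun X : ℝ => ∫ ξ in (-(X ^ (τ + η)))..(X ^ (τ + η)),
      ‖dirichletPoly (lengthPairs δ X) (fun x => (pairCoeff f p₀ δ X x : ℂ))
        (fun x => x.1 * x.2) ξ‖ ^ 2) =O[atTop] fun X : ℝ => X ^ c) :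
    ∃ c' : ℝ, 0 < c' ∧ ∀ᶠ X in atTop,
      c' * X ^ (2 * a - (1 - τ + 2 * η)) ≤ signChanges f (9 * X) := by
  have hB : 0 < ∫ w, bump w := bump.integral_pos
  set B := ∫ w, bump w
  obtain ⟨C, hC0, habs⟩ :=
    (integral_shortSum_abs_pairCoeff_sq_isBigO p₀ hK hδ0 hδ hτ hη).exists_pos
  have hsigned' := eventually_mul_integral_shortSum_sq_le hη hsigned
    (rpow_mul_log_add_isBigO hτ0 hη) ?_ (by linarith) hc₀ hmass (β := B ^ 2 / 4) (by positivity)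
  · refine ⟨B ^ 2 * c₀ ^ 2 / (16 * C), by positivity, ?_⟩
    filter_upwards [hsigned', hmass, habs.bound, eventually_ge_atTop 1] with X hsigned hmass habs hX
    have hX0 : 0 < X := by linarith
    have hmain := sq_sum_abs_pairCoeff_le hf p₀ hδ hX (Real.rpow_pos_of_pos hX0 τ)
    rw [Real.norm_of_nonneg (integral_nonneg fun _ => sq_nonneg _),
      Real.norm_of_nonneg (by positivity)] at habs
    set W := ∑ x ∈ lengthPairs δ X, |pairCoeff f p₀ δ X x|
    set M := ∫ w, shortSum (lengthPairs δ X) (|pairCoeff f p₀ δ X ·|)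
      (fun x => x.1 * x.2) (X ^ τ) w ^ 2
    set S := (signChanges f (9 * X) : ℝ)
    have hmass_sq : c₀ ^ 2 * X ^ (2 * a) ≤ W ^ 2 := by
      rw [mul_comm 2, Real.rpow_mul hX0.le, Real.rpow_two, ← mul_pow]
      gcongr
    have hfew : B ^ 2 * W ^ 2 ≤ 16 * (S * M) := by linarith
    rw [Real.rpow_sub hX0, div_mul_div_comm, div_le_iff₀ (by positivity)]
    calc B ^ 2 * c₀ ^ 2 * X ^ (2 * a) ≤ B ^ 2 * W ^ 2 := by
          rw [mul_assoc]
          gcongr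
      _ ≤ 16 * (S * (C * X ^ (1 - τ + 2 * η))) := hfew.trans (by gcongr)
      _ = _ := by ring
  · filter_upwards [eventually_ge_atTop 1] with X hX
    have : 0 ≤ Real.log (9 * X) := Real.log_nonneg (by linarith)
    positivity

theorem isSignChange_scaledCoeff_iff (A : ℕ → ℝ) (σ : ℝ) (m : ℕ) :
    IsSignChange (scaledCoeff A σ) m ↔ IsSignChange A m := by
  have hpow {l : ℕ} (hl : 1 ≤ l) : 0 < (l : ℝ) ^ (-σ) :=
    Real.rpow_pos_of_pos (by exact_mod_cast hl) _
  refine exists_congr fun n => and_congr_right fun hn => and_congr_right fun hnm =>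
    and_congr ?_ (forall_congr' fun j => forall_congr' fun hnj => imp_congr_right fun _ => ?_)
  · rw [scaledCoeff, scaledCoeff, mul_mul_mul_comm,
      mul_comm, ← smul_eq_mul,
      smul_neg_iff_of_pos_left (mul_pos (hpow hn) (hpow (hn.trans hnm.le)))]
  · rw [scaledCoeff, mul_eq_zero_iff_right (hpow (hn.trans hnj.le)).ne']

theorem signChanges_scaledCoeff (A : ℕ → ℝ) (σ X : ℝ) :
    signChanges (scaledCoeff A σ) X = signChanges A X := by
  rw [signChanges_eq_card, signChanges_eq_card]
  congr 1
  ext m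
  simp only [Finset.mem_filter, isSignChange_scaledCoeff_iff]

theorem exists_admissible_exponents {θ : ℝ} (hθ : 1 / 2 ≤ θ) (hδ0 : 0 < δ) (hδ : δ < 1 / 6) :
    ∃ η : ℝ, 0 < η ∧ 41 * η ≤ δ ^ 2 ∧ (1 - 6 * δ) / (2 * θ) + 11 * η ≤ 1 - δ ∧
      2 * ((1 - 6 * δ) / (2 * θ) + 11 * η) * (θ + η) + 4 * δ + 2 * η ≤ 1 - δ ^ 2 - 8 * η := by
  set η := δ ^ 2 / (22 * θ + 30)
  have hη : η * (22 * θ + 30) = δ ^ 2 := div_mul_cancel₀ _ (by positivity)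
  have hη0 : 0 < η := by positivity
  have hη41 : 41 * η ≤ δ ^ 2 := by nlinarith
  have hb : (1 - 6 * δ) / (2 * θ) + 11 * η ≤ 1 - δ := by
    have : (1 - 6 * δ) / (2 * θ) ≤ 1 - 6 * δ := div_le_self (by linarith) (by linarith)
    nlinarith
  refine ⟨η, hη0, hη41, hb, ?_⟩
  have hθb : (1 - 6 * δ) / (2 * θ) * (2 * θ) = 1 - 6 * δ := div_mul_cancel₀ _ (by positivity)
  have hηb := mul_le_mul_of_nonneg_right (hb.trans (by linarith : 1 - δ ≤ 1)) hη0.le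
  nlinarith

theorem IsEntireDirichletSeries.exists_rpow_le_signChanges {A : ℕ → ℝ} {L : ℂ → ℂ}
    (hL : IsEntireDirichletSeries (fun m => (A m : ℂ)) L) (hA : IsCoprimeMultiplicative A)
    {θ κ : ℝ} (hθ : 1 / 2 ≤ θ) (hLθ : LindelofExponent L θ) (hRS : RankinSelbergBound A)
    (hAκ : NonvanishingExponent A κ) (hδ0 : 0 < δ) (hδ : δ < 1 / 6) (hκδ : 2 - 2 * κ ≤ δ ^ 2) :
    ∃ c η : ℝ, 0 < c ∧ 0 < η ∧ ∀ᶠ X in atTop,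
      c * X ^ (2 * κ - 2 + (1 - 6 * δ) / (2 * θ) + η) ≤ signChanges A (9 * X) := by
  obtain ⟨η, hη, hη41, hb, hc⟩ := exists_admissible_exponents hθ hδ0 hδ
  have hquot : 0 ≤ (1 - 6 * δ) / (2 * θ) := div_nonneg (by linarith) (by linarith)
  set τ := (1 - 6 * δ) / (2 * θ) + 10 * η with hτ
  have hbτ : (1 - 6 * δ) / (2 * θ) + 11 * η = τ + η := by rw [hτ]; ring
  rw [hbτ] at hb hc
  have hσ : 1 / 2 < 1 / 2 + η := by linarith
  have hf := isCoprimeMultiplicative_scaledCoeff hA (1 / 2 + η)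
  obtain ⟨Z, hZ⟩ := hRS.exists_local_sum_le hσ
  obtain ⟨p₀, htail⟩ := hRS.exists_local_tail_le hσ
  obtain ⟨K, -, hK⟩ := hRS.exists_sum_divisors_mul_sq_le hσ
  obtain ⟨c₁, hc₁, hsum⟩ := hAκ.exists_le_sum_abs_scaledCoeff (σ := 1 / 2 + η) (by linarith) hη
  obtain ⟨c₀, hc₀, hmass⟩ := exists_rpow_le_sum_abs_pairCoeff hf hZ htail (by nlinarith) hc₁ hsum
    hη hδ0 (by linarith)
  have hsigned := hL.integral_dirichletPoly_pairCoeff_sq_isBigO hA (by linarith) hLθ hRS hη hσ htail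
    hδ0 (by linarith) (by linarith) hb (c := 1 - δ ^ 2 - 8 * η) (by linarith) hc
  obtain ⟨c', hc', hlower⟩ := exists_rpow_le_signChanges_of_isBigO hf hK hδ0.le (by linarith)
    (by linarith) (by linarith) hη (by linarith) hc₀ hmass hsigned
  refine ⟨c', 2 * η, hc', by linarith, hlower.mono fun X hX => ?_⟩
  rw [signChanges_scaledCoeff] at hX
  convert hX using 3
  rw [hτ]
  ring

end LowerBound

section ExistsSignChange

theorem LindelofExponent.mono {L : ℂ → ℂ} {θ θ' : ℝ} (h : LindelofExponent L θ) (hθ : θ ≤ θ') :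
    LindelofExponent L θ' := by
  intro ε hε
  obtain ⟨C, hC⟩ := h ε hε
  have hC0 : 0 ≤ C := by simpa using (norm_nonneg _).trans (hC 0)
  refine ⟨C, fun t => (hC t).trans ?_⟩
  gcongr
  linarith [abs_nonneg t]

theorem NonvanishingExponent.exists_ne_zero {A : ℕ → ℝ} {κ : ℝ} (h : NonvanishingExponent A κ) :
    ∃ m ≠ 0, A m ≠ 0 := by
  obtain ⟨c, hc, X₀, hX₀⟩ := h 1 one_pos
  have hX1 : 1 ≤ max X₀ 1 := le_max_right _ _
  have hpos : 0 < ∑ m ∈ Finset.Ioc ⌊max X₀ 1⌋₊ ⌊2 * max X₀ 1⌋₊, |A m| :=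
    lt_of_lt_of_le (by positivity) (hX₀ _ (le_max_left _ _) hX1)
  obtain ⟨m, hm, hm0⟩ := Finset.exists_ne_zero_of_sum_ne_zero hpos.ne'
  exact ⟨m, Nat.ne_zero_of_lt (Finset.mem_Ioc.mp hm).1, abs_ne_zero.mp hm0⟩

theorem RankinSelbergBound.sq_sum_abs_Ioc_isBigO {A : ℕ → ℝ} (hRS : RankinSelbergBound A) {e : ℝ}
    (he : 0 < e) : (fun X : ℝ => (∑ m ∈ Finset.Ioc ⌊X⌋₊ ⌊2 * X⌋₊, |A m|) ^ 2) =O[atTop]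
      fun X : ℝ => X ^ (2 + e) := by
  obtain ⟨C, hC⟩ := hRS e he
  refine isBigO_rpow_of_le (c := 2 * (C * 2 ^ (1 + e))) fun X hX => ⟨sq_nonneg _, ?_⟩
  have hX0 : 0 < X := by linarith
  have hsum : ∑ m ∈ Finset.Ioc ⌊X⌋₊ ⌊2 * X⌋₊, |A m| ^ 2 ≤ C * (2 * X) ^ (1 + e) := by
    refine le_trans ?_ (hC (2 * X) (by linarith))
    refine Finset.sum_le_sum_of_subset_of_nonneg (fun m hm => ?_) fun _ _ _ => sq_nonneg _
    obtain ⟨hXm, hm⟩ := Finset.mem_Ioc.mp hm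
    exact Finset.mem_Icc.mpr ⟨by omega, hm⟩
  have hcard : ((Finset.Ioc ⌊X⌋₊ ⌊2 * X⌋₊).card : ℝ) ≤ 2 * X := by
    rw [Nat.card_Ioc]
    exact le_trans (by exact_mod_cast Nat.sub_le _ _) (Nat.floor_le (by linarith))
  calc _ ≤ ((Finset.Ioc ⌊X⌋₊ ⌊2 * X⌋₊).card : ℝ) *
        ∑ m ∈ Finset.Ioc ⌊X⌋₊ ⌊2 * X⌋₊, |A m| ^ 2 := sq_sum_le_card_mul_sum_sq
    _ ≤ 2 * X * (C * (2 * X) ^ (1 + e)) :=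
        mul_le_mul hcard hsum (Finset.sum_nonneg fun _ _ => sq_nonneg _) (by linarith)
    _ = 2 * (C * 2 ^ (1 + e)) * (X * X ^ (1 + e)) := by
        rw [Real.mul_rpow (by norm_num) hX0.le]
        ring
    _ = _ := by
        rw [← Real.rpow_one_add' hX0.le (by linarith), ← add_assoc, one_add_one_eq_two]

theorem NonvanishingExponent.le_one {A : ℕ → ℝ} {κ : ℝ} (h : NonvanishingExponent A κ)
    (hRS : RankinSelbergBound A) : κ ≤ 1 := by
  by_contra! hκ
  obtain ⟨c, hc, X₀, hX₀⟩ := h ((κ - 1) / 4) (by linarith)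
  have hupper := eventually_le_of_isBigO_rpow
    (hRS.sq_sum_abs_Ioc_isBigO (e := (κ - 1) / 4) (by linarith))
    (b := (κ - (κ - 1) / 4) * 2) (by linarith) (c := c ^ 2 / 2) (by positivity)
  obtain ⟨X, hupper, hX, hX1⟩ :=
    (hupper.and ((eventually_ge_atTop X₀).and (eventually_ge_atTop 1))).exists
  have hX0 : 0 < X := by linarith
  have hlower : (c * X ^ (κ - (κ - 1) / 4)) ^ 2 ≤
      (∑ m ∈ Finset.Ioc ⌊X⌋₊ ⌊2 * X⌋₊, |A m|) ^ 2 := by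
    gcongr
    exact hX₀ X hX hX1
  rw [mul_pow, ← Real.rpow_mul_natCast hX0.le, Nat.cast_ofNat] at hlower
  have : 0 < c ^ 2 * X ^ ((κ - (κ - 1) / 4) * 2) := by positivity
  linarith

variable {A : ℕ → ℝ} {L : ℂ → ℂ}

open scoped ComplexOrder in
/- Landau's theorem, applied to `L` with the terms `m ∈ S` of its Dirichlet series removed: this
function is entire and its coefficients are nonnegative, so it is positive at `0`. -/
theorem IsEntireDirichletSeries.sum_lt_of_nonneg
    (hL : IsEntireDirichletSeries (fun m => (A m : ℂ)) L) (hA1 : 0 < A 1)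
    (hA : ∀ m, 1 ≤ m → 0 ≤ A m) {S : Finset ℕ} (hS : ∀ m ∈ S, 1 < m) :
    ∑ m ∈ S, A m < (L 0).re := by
  set b : ℕ → ℂ := fun m => if m ∈ insert 0 S then A m else 0 with hb
  set f : ℂ → ℂ := fun s => L s - ∑ m ∈ S, LSeries.term b s m with hf
  have hentire : Differentiable ℂ f := hL.entire.sub <| .fun_sum fun m _ s =>
    (LSeries.hasDerivAt_term _ m s).differentiableAt
  have hsum {s : ℂ} (hs : 1 < s.re) : LSeriesHasSum ((fun m => (A m : ℂ)) - b) s (f s) := by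
    refine (hL.dirichlet_series s hs).sub (hasSum_sum_of_ne_finset_zero fun m hm => ?_)
    rcases eq_or_ne m 0 with rfl | hm0
    · exact LSeries.term_zero _ _
    · simp [hb, hm0, hm]
  have hnonneg : 0 ≤ (fun m => (A m : ℂ)) - b := by
    intro m
    by_cases hm : m ∈ insert 0 S
    · have hbm : b m = A m := if_pos hm
      simp [hbm]
    · have hbm : b m = 0 := if_neg hm
      have hm0 : m ≠ 0 := fun h => hm (h ▸ Finset.mem_insert_self _ _)
      simpa [hbm] using hA m (Nat.one_le_iff_ne_zero.mpr hm0)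
  have hone : 1 ∉ S := fun h => lt_irrefl _ (hS 1 h)
  have hpos : 0 < f 0 := LSeries.positive_of_differentiable_of_eqOn hnonneg
    (by simpa [hb, hone] using hA1) hentire (x := 1)
    (LSeries.abscissaOfAbsConv_le_of_forall_lt_LSeriesSummable fun y hy =>
      (hsum (by simpa using hy)).LSeriesSummable)
    (fun s hs => (hsum hs).LSeries_eq.symm) 0
  have hf0 : f 0 = L 0 - ∑ m ∈ S, A m := by
    rw [hf, Complex.ofReal_sum]
    refine congrArg _ (Finset.sum_congr rfl fun m hm => ?_)
    simp [LSeries.term_of_ne_zero (hS m hm).ne_bot, hb, hm]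
  rw [hf0, Complex.lt_def, Complex.sub_re, Complex.ofReal_re] at hpos
  exact sub_pos.mp hpos.1

theorem IsEntireDirichletSeries.exists_neg (hL : IsEntireDirichletSeries (fun m => (A m : ℂ)) L)
    (hA1 : 0 < A 1) {κ : ℝ} (hκ : 0 < κ) (hAκ : NonvanishingExponent A κ) :
    ∃ m, 1 ≤ m ∧ A m < 0 := by
  by_contra! hA
  obtain ⟨c, hc, X₀, hX₀⟩ := hAκ (κ / 2) (by linarith)
  have hlim : Tendsto (fun X : ℝ => c * X ^ (κ - κ / 2)) atTop atTop :=
    (tendsto_rpow_atTop (by linarith)).const_mul_atTop hc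
  obtain ⟨X, hlarge, hX, hX1⟩ := ((hlim.eventually_ge_atTop (L 0).re).and
    ((eventually_ge_atTop X₀).and (eventually_ge_atTop 1))).exists
  have hS : ∀ m ∈ Finset.Ioc ⌊X⌋₊ ⌊2 * X⌋₊, 1 < m := fun m hm =>
    ((Nat.one_le_floor_iff X).mpr hX1).trans_lt (Finset.mem_Ioc.mp hm).1
  have hsum := hX₀ X hX hX1
  rw [Finset.sum_congr rfl fun m hm => abs_of_nonneg (hA m (hS m hm).le)] at hsum
  exact (hL.sum_lt_of_nonneg hA1 hA hS).not_ge (hlarge.trans hsum)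

theorem IsEntireDirichletSeries.eventually_one_le_signChanges
    (hL : IsEntireDirichletSeries (fun m => (A m : ℂ)) L) (hA1 : 0 < A 1) {κ : ℝ} (hκ : 0 < κ)
    (hAκ : NonvanishingExponent A κ) : ∀ᶠ X in atTop, 1 ≤ signChanges A X := by
  classical
  obtain ⟨m, hm, hneg⟩ := hL.exists_neg hA1 hκ hAκ
  have hm1 : 1 < m := hm.lt_of_ne fun h => hneg.not_gt (h ▸ hA1)
  obtain ⟨l, hl, hsign⟩ :=
    exists_isSignChange_of_mul_neg le_rfl hm1 (mul_neg_of_pos_of_neg hA1 hneg)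
  filter_upwards [eventually_ge_atTop (m : ℝ)] with X hX
  rw [signChanges_eq_card, Nat.one_le_iff_ne_zero, Finset.card_ne_zero]
  exact ⟨l, Finset.mem_filter.mpr ⟨Finset.mem_Icc.mpr ⟨hl.1.le, hl.2.trans (Nat.le_floor hX)⟩,
    hsign⟩⟩

end ExistsSignChange

section MainTheorem

variable {A : ℕ → ℝ} {L : ℂ → ℂ} {θ κ δ : ℝ}

theorem IsEntireDirichletSeries.eventually_rpow_le_signChanges
    (hL : IsEntireDirichletSeries (fun m => (A m : ℂ)) L) (hA : IsCoprimeMultiplicative A)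
    (hθ : 1 / 2 ≤ θ) (hLθ : LindelofExponent L θ) (hRS : RankinSelbergBound A) (hκ : 0 < κ)
    (hAκ : NonvanishingExponent A κ) (hδ0 : 0 < δ) (hκδ : 2 - 2 * κ ≤ δ ^ 2) :
    ∀ᶠ X in atTop, X ^ (2 * κ - 2 + (1 - 6 * δ) / (2 * θ)) ≤ (signChanges A X : ℝ) := by
  set e := 2 * κ - 2 + (1 - 6 * δ) / (2 * θ)
  rcases le_or_gt e 0 with he0 | he0
  · filter_upwards [eventually_ge_atTop 1, hL.eventually_one_le_signChanges
      (hA.map_one ▸ one_pos) hκ hAκ] with X hX hone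
    exact (Real.rpow_le_one_of_one_le_of_nonpos hX he0).trans (by exact_mod_cast hone)
  have hδ : δ < 1 / 6 := by
    by_contra! hδ
    have hquot : (1 - 6 * δ) / (2 * θ) ≤ 0 :=
      div_nonpos_of_nonpos_of_nonneg (by linarith) (by linarith)
    linarith [hAκ.le_one hRS]
  obtain ⟨c, η, hc, hη, hlower⟩ := hL.exists_rpow_le_signChanges hA hθ hLθ hRS hAκ hδ0 hδ hκδ
  have hscale : (fun X : ℝ => (9 * X) ^ e) =O[atTop] fun X : ℝ => X ^ e :=
    isBigO_rpow_of_le (c := 9 ^ e) fun X hX =>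
      ⟨by positivity, (Real.mul_rpow (by norm_num) (by linarith)).le⟩
  have hmain : ∀ᶠ X in atTop, (9 * X) ^ e ≤ (signChanges A (9 * X) : ℝ) := by
    filter_upwards [eventually_le_of_isBigO_rpow hscale (lt_add_of_pos_right e hη) hc, hlower]
      with X hX hlower
    exact hX.trans hlower
  refine ((tendsto_id.atTop_div_const (by norm_num : (0 : ℝ) < 9)).eventually hmain).mono
    fun X hX => ?_
  rwa [id, mul_div_cancel₀ X (by norm_num : (9 : ℝ) ≠ 0)] at hX

theorem theorem1_general (hL : IsEntireDirichletSeries (fun m => (A m : ℂ)) L)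
    (hA : IsCoprimeMultiplicative A) (hLθ : LindelofExponent L θ) (hRS : RankinSelbergBound A)
    (hκ : 0 < κ) (hAκ : NonvanishingExponent A κ) {ε : ℝ} (hε : 0 < ε)
    (hδ : δ = Real.sqrt (2 - 2 * κ + ε)) :
    (1 / 2 ≤ θ → ∃ X₀ : ℝ, ∀ X : ℝ, X₀ ≤ X → 1 ≤ X →
      X ^ (2 * κ - 2 + 1 / (2 * θ) - δ - (6 * δ + 2 * δ ^ 2) / (2 * θ)) ≤
        (signChanges A X : ℝ)) ∧
    (θ ≤ 1 / 2 → ∃ X₀ : ℝ, ∀ X : ℝ, X₀ ≤ X → 1 ≤ X →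
      X ^ (2 * κ - 1 - 6 * δ) ≤ (signChanges A X : ℝ)) := by
  have hκ1 : κ ≤ 1 := hAκ.le_one hRS
  have hδ0 : 0 < δ := hδ ▸ Real.sqrt_pos.mpr (by linarith)
  have hκδ : 2 - 2 * κ ≤ δ ^ 2 := by
    rw [hδ, Real.sq_sqrt (by linarith)]
    linarith
  refine ⟨fun hθ => ?_, fun hθ => ?_⟩
  · obtain ⟨X₀, hX₀⟩ := eventually_atTop.mp
      (hL.eventually_rpow_le_signChanges hA hθ hLθ hRS hκ hAκ hδ0 hκδ)
    refine ⟨X₀, fun X hX hX1 => (Real.rpow_le_rpow_of_exponent_le hX1 ?_).trans (hX₀ X hX)⟩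
    have : 0 ≤ 2 * δ ^ 2 / (2 * θ) := by positivity
    rw [sub_div, add_div]
    linarith
  · obtain ⟨X₀, hX₀⟩ := eventually_atTop.mp
      (hL.eventually_rpow_le_signChanges hA le_rfl (hLθ.mono hθ) hRS hκ hAκ hδ0 hκδ)
    refine ⟨X₀, fun X hX _ => ?_⟩
    convert hX₀ X hX using 2
    ring

end MainTheorem

theorem theorem1 (A : ℕ → ℝ) (L : ℂ → ℂ) (θ κ : ℝ)
    (hL : IsSelbergLFunction A L)
    (hθ : 0 ≤ θ) (hLθ : LindelofExponent L θ)
    (hRS : RankinSelbergBound A)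
    (hκ : 0 < κ) (hAκ : NonvanishingExponent A κ) :
    (1 / 2 ≤ θ →
      1 - (2 * (7 * θ + 3 + Real.sqrt ((7 * θ + 3) ^ 2 + 2)) ^ 2)⁻¹ ≤ κ →
      ∀ ε : ℝ, 0 < ε → ∀ δ : ℝ, δ = Real.sqrt (2 - 2 * κ + ε) →
        ∃ X₀ : ℝ, ∀ X : ℝ, X₀ ≤ X → 1 ≤ X →
          X ^ (2 * κ - 2 + 1 / (2 * θ) - δ - (6 * δ + 2 * δ ^ 2) / (2 * θ))
            ≤ (signChanges A X : ℝ)) ∧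
    (θ ≤ 1 / 2 →
      -(17 / 2) + 3 * Real.sqrt 10 ≤ κ →
      ∀ ε : ℝ, 0 < ε → ∀ δ : ℝ, δ = Real.sqrt (2 - 2 * κ + ε) →
        ∃ X₀ : ℝ, ∀ X : ℝ, X₀ ≤ X → 1 ≤ X →
          X ^ (2 * κ - 1 - 6 * δ) ≤ (signChanges A X : ℝ)) := by
  have h {ε δ : ℝ} := theorem1_general (ε := ε) (δ := δ) hL.isEntireDirichletSeries
    (hL.isCoprimeMultiplicative hAκ.exists_ne_zero) hLθ hRS hκ hAκ
  exact ⟨fun hθ _ _ hε _ hδ => (h hε hδ).1 hθ, fun hθ _ _ hε _ hδ => (h hε hδ).2 hθ⟩
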